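/- **Definitions.** Languages are subsets of $\{0,1\}^*$, and $n=|z|$ denotes the length of an instance $z$. $\mathsf{EEXP}=\bigcup_p \mathsf{DTIME}(2^{2^{p(n)}})$, the union over polynomials $p$; $\mathsf{RE}$ is the class of recursively enumerable languages; $f(n)=\mathrm{poly}(n)$ means that $f$ is bounded above by a polynomial. Let $r,q,a,t:\mathbb N\to\mathbb N$. A *verifier* with parameters $[r,q,a,t]$ is a pair of deterministic multi-tape Turing machines $(S,D)$ such that, for every $z$ with $|z|=n$: the sampler $S$, given $z$ and any seed in $\{0,1\}^{r(n)}$, halts within $t(n)$ steps and outputs a pair of questions in $\{0,1\}^{q(n)}\times\{0,1\}^{q(n)}$; the decider $D$, given $z$, any $x,y\in\{0,1\}^{q(n)}$ and any $\alpha,\beta\in\{0,1\}^{a(n)}$, halts within $t(n)$ steps and accepts or rejects. With a uniformly random seed this defines a two-player one-round game $G^z$, with question sets $\{0,1\}^{q(n)}$ and answer sets $\{0,1\}^{a(n)}$. Its value $\mathrm{val}^*(G^z)$ is the supremum of the winning probability over all finite-dimensional tensor product strategies; its synchronous value $\omega^s(G^z)$ is the supremum over all finite-dimensional synchronous strategies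 (a maximally entangled state, projective measurements $A^x_a$ of one player and the transposes $B^x_a=(A^x_a)^T$ of the other). For real numbers $s<c$, $\mathsf{MIP}^*_{c,s}[r,q,a,t]$ is the class of languages $L$ that have a verifier with parameters $[r,q,a,t]$ such that $\mathrm{val}^*(G^z)\ge c$ for $z\in L$ and $\mathrm{val}^*(G^z)\le s$ for $z\notin L$. The zero-gap class $\mathsf{MIP}^*_0[r,q,a,t]$ is defined in the same way with $\mathrm{val}^*(G^z)=1$ for $z\in L$ and $\mathrm{val}^*(G^z)<1$ for $z\notin L$, and $\mathsf{MIP}^{*,\mathrm{sync}}_0[r,q,a,t]$ with $\omega^s$ in place of $\mathrm{val}^*$. **Theorem.** (1) Let $r,q,a,t:\mathbb N\to\mathbb N$ with $r(n),t(n)=\mathrm{poly}(n)$, and suppose that there are constants $n_0$ and $\gamma<\tfrac12$ such that $q(n)+a(n)\le\gamma\log_2 n$ for all $n>n_0$. Then $\mathsf{EEXP}\not\subseteq\mathsf{MIP}^*_{c,s}[r,q,a,t]$ for all real $s<c$ (in particular for $c=\tfrac23,s=\tfrac13$ and for $c=1,s=\tfrac12$), and likewise $\mathsf{EEXP}\not\subseteq\mathsf{MIP}^*_0[r,q,a,t]$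 and $\mathsf{EEXP}\not\subseteq\mathsf{MIP}^{*,\mathrm{sync}}_0[r,q,a,t]$. (2) Any $\mathsf{MIP}^*$ protocol for $\mathsf{RE}$ needs $\Omega(\log n)$ communication: let $q,a:\mathbb N\to\mathbb N$ and suppose that, for some real $s<c$, every $L\in\mathsf{RE}$ belongs to $\mathsf{MIP}^*_{c,s}[r,q,a,t]$ for some $r(n),t(n)=\mathrm{poly}(n)$ (which may depend on $L$). Then the total communication satisfies $2(q(n)+a(n))=\Omega(\log n)$. The same holds with $\mathsf{MIP}^*_0$ or with $\mathsf{MIP}^{*,\mathrm{sync}}_0$ in place of $\mathsf{MIP}^*_{c,s}$. -/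

import Mathlib

/-! ### Deterministic multi-tape Turing machines with a step count -/

/-- Tape symbols: the blank (`none`), the bits `0` and `1`, and finitely many auxiliary symbols. -/
abbrev TapeSymbol (numAux : ℕ) : Type := Option (Bool ⊕ Fin numAux)

/-- The tape contents that represent a bit string. -/
def bitSymbols (numAux : ℕ) (x : List Bool) : List (TapeSymbol numAux) :=
  x.map fun b => some (Sum.inl b)

/-- A deterministic Turing machine with `m` input/output tapes and any finite number of work tapes,
all of them infinite in both directions. In one step, depending on the state and on the symbols
under the heads, it either halts (`none`), or enters a new state, writes one symbol on every tape
and then moves every head by at most one cell (`none` means that the head stays). -/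
structure MultiTapeTM (m : ℕ) where
  numWork : ℕ
  numAux : ℕ
  numStates : ℕ
  start : Fin numStates
  accepting : Fin numStates → Bool
  trans : Fin numStates → (Fin m ⊕ Fin numWork → TapeSymbol numAux) →
    Option (Fin numStates ×
      (Fin m ⊕ Fin numWork → TapeSymbol numAux × Option Turing.Dir))

namespace MultiTapeTM

variable {m : ℕ}

/-- Configurations: the current state, and all the tapes with their head positions. -/
structure Cfg (M : MultiTapeTM m) where
  state : Fin M.numStates
  tape : Fin m ⊕ Fin M.numWork → Turing.Tape (TapeSymbol M.numAux)

/-- The initial configuration: `inp i` is written on the `i`-th input/output tape, with the head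
on its first symbol, and the work tapes are blank. -/
def init (M : MultiTapeTM m) (inp : Fin m → List Bool) : M.Cfg where
  state := M.start
  tape := Sum.elim (fun i => Turing.Tape.mk₁ (bitSymbols M.numAux (inp i)))
    (fun _ => Turing.Tape.mk₁ [])

/-- One step of computation; `none` if the machine halts. -/
def step (M : MultiTapeTM m) (c : M.Cfg) : Option M.Cfg :=
  (M.trans c.state fun i => (c.tape i).head).map fun p =>
    { state := p.1
      tape := fun i =>
        let T := (c.tape i).write (p.2 i).1
        match (p.2 i).2 with
        | none => T
        | some d => T.move d }

/-- The configuration after `T` steps (a halted machine keeps its configuration). -/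
def after (M : MultiTapeTM m) (inp : Fin m → List Bool) (T : ℕ) : M.Cfg :=
  (fun c => (M.step c).getD c)^[T] (M.init inp)

/-- On the given input the machine halts after at most `T` steps. -/
def HaltsWithin (M : MultiTapeTM m) (inp : Fin m → List Bool) (T : ℕ) : Prop :=
  M.step (M.after inp T) = none

/-- On the given input the machine halts after at most `T` steps, with the verdict `b`. -/
def Decides (M : MultiTapeTM m) (inp : Fin m → List Bool) (T : ℕ) (b : Bool) : Prop :=
  M.HaltsWithin inp T ∧ M.accepting (M.after inp T).state = b

/-- After `T` steps, the contents of the `i`-th input/output tape, from the head to the right,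
are the bit string `x` followed by blanks. -/
def HasOutput (M : MultiTapeTM m) (inp : Fin m → List Bool) (T : ℕ) (i : Fin m)
    (x : List Bool) : Prop :=
  ((M.after inp T).tape (Sum.inl i)).right₀ = Turing.ListBlank.mk (bitSymbols M.numAux x)

end MultiTapeTM

/-! ### Complexity classes of languages over the alphabet `{0, 1}` -/

/-- `f n = poly(n)`. -/
def PolyBounded (f : ℕ → ℕ) : Prop :=
  ∃ p : Polynomial ℕ, ∀ n, f n ≤ p.eval n

/-- Doubly exponential time: the union of `DTIME(2 ^ 2 ^ p(n))` over the polynomials `p`. -/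
def EEXP : Set (Set (List Bool)) :=
  {L | ∃ (M : MultiTapeTM 1) (p : Polynomial ℕ), ∀ z : List Bool,
    ∃ b : Bool, M.Decides ![z] (2 ^ 2 ^ p.eval z.length) b ∧ (b = true ↔ z ∈ L)}

/-- The recursively enumerable languages. -/
def RE : Set (Set (List Bool)) :=
  {L | REPred fun z => z ∈ L}

/-! ### Nonlocal games and their values -/

section

open scoped ComplexOrder

/-- A two-player one-round game with question sets `X`, `Y` and answer sets `A`, `B`. -/
structure NonlocalGame (X Y A B : Type) where
  /-- the question distribution -/
  μ : PMF (X × Y)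
  /-- the decision predicate -/
  D : X → Y → A → B → Bool

/-- A tensor product strategy on `ℂ ^ dA ⊗ ℂ ^ dB`: a unit vector `ψ`, and a POVM on the
corresponding factor for each question to either player. -/
structure Strategy (X Y A B : Type) [Fintype A] [Fintype B] where
  dA : ℕ
  dB : ℕ
  ψ : Fin dA × Fin dB → ℂ
  unit : star ψ ⬝ᵥ ψ = 1
  MA : X → A → Matrix (Fin dA) (Fin dA) ℂ
  MB : Y → B → Matrix (Fin dB) (Fin dB) ℂ
  posA : ∀ x a, (MA x a).PosSemidef
  posB : ∀ y b, (MB y b).PosSemidef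
  sumA : ∀ x, ∑ a, MA x a = 1
  sumB : ∀ y, ∑ b, MB y b = 1

/-- A finite-dimensional synchronous strategy: one projective measurement on `ℂ ^ d` for each
question. The players share a maximally entangled state, Alice measures with `P`, and Bob with the
transposes. -/
structure SyncStrategy (X A : Type) [Fintype A] where
  d : ℕ
  d_pos : 0 < d
  P : X → A → Matrix (Fin d) (Fin d) ℂ
  herm : ∀ x a, (P x a).IsHermitian
  proj : ∀ x a, P x a * P x a = P x a
  sum : ∀ x, ∑ a, P x a = 1

/-- The maximally entangled state `d ^ (-1/2) ∑ᵢ |i⟩|i⟩`. -/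
noncomputable def maxEntangled (d : ℕ) : Fin d × Fin d → ℂ :=
  fun p => if p.1 = p.2 then ((Real.sqrt d)⁻¹ : ℝ) else 0

namespace NonlocalGame

variable {X Y A B : Type} [Fintype X] [Fintype Y] [Fintype A] [Fintype B]

/-- `∑ μ(x, y) D(x, y, a, b) ⟨ψ| MA x a ⊗ MB y b |ψ⟩`. -/
noncomputable def winProb (G : NonlocalGame X Y A B) {dA dB : ℕ} (ψ : Fin dA × Fin dB → ℂ)
    (MA : X → A → Matrix (Fin dA) (Fin dA) ℂ) (MB : Y → B → Matrix (Fin dB) (Fin dB) ℂ) : ℝ :=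
  ∑ x, ∑ y, ∑ a, ∑ b, (G.μ (x, y)).toReal * (if G.D x y a b then 1 else 0) *
    (star ψ ⬝ᵥ (Matrix.kronecker (MA x a) (MB y b)).mulVec ψ).re

/-- The tensor product value: the supremum of the winning probability over all tensor product
strategies. -/
noncomputable def val (G : NonlocalGame X Y A B) : ℝ :=
  ⨆ S : Strategy X Y A B, G.winProb S.ψ S.MA S.MB

/-- The synchronous value of a game in which the players have the same questions and answers. -/
noncomputable def syncVal (G : NonlocalGame X X A A) : ℝ :=
  ⨆ S : SyncStrategy X A, G.winProb (maxEntangled S.d) S.P fun y b => (S.P y b).transpose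

end NonlocalGame

end

/-! ### `MIP*` protocols -/

/-- Bit strings of length `n`. -/
abbrev Bits (n : ℕ) : Type := Fin n → Bool

/-- A sampler and a decider with resource bounds, as functions of the length of the instance `z`:
`r` for the length of the random seed, `q` for the length of a question to a single player, `a` for
the length of an answer of a single player, and `t` for the running times.
The sampler receives `z` and the seed on its first two tapes and leaves the two questions on the
other two. The decider receives `z`, the questions and the answers on its five tapes, and accepts
or rejects. The functions `questions` and `verdict` are what the two machines compute. -/
structure Verifier (r q a t : ℕ → ℕ) where
  sampler : MultiTapeTM 4
  decider : MultiTapeTM 5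
  questions : ∀ z : List Bool, Bits (r z.length) → Bits (q z.length) × Bits (q z.length)
  verdict : ∀ z : List Bool, Bits (q z.length) → Bits (q z.length) →
    Bits (a z.length) → Bits (a z.length) → Bool
  sampler_halts : ∀ (z : List Bool) (s : Bits (r z.length)),
    sampler.HaltsWithin ![z, List.ofFn s, [], []] (t z.length)
  sampler_fst : ∀ (z : List Bool) (s : Bits (r z.length)),
    sampler.HasOutput ![z, List.ofFn s, [], []] (t z.length) 2 (List.ofFn (questions z s).1)
  sampler_snd : ∀ (z : List Bool) (s : Bits (r z.length)),
    sampler.HasOutput ![z, List.ofFn s, [], []] (t z.length) 3 (List.ofFn (questions z s).2)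
  decider_spec : ∀ (z : List Bool) (x y : Bits (q z.length)) (α β : Bits (a z.length)),
    decider.Decides ![z, List.ofFn x, List.ofFn y, List.ofFn α, List.ofFn β] (t z.length) (verdict z x y α β)

/-- The game that is played on the instance `z`: the questions are sampled with a uniformly random
seed. -/
noncomputable def Verifier.game {r q a t : ℕ → ℕ} (V : Verifier r q a t) (z : List Bool) :
    NonlocalGame (Bits (q z.length)) (Bits (q z.length)) (Bits (a z.length)) (Bits (a z.length)) where
  μ := (PMF.uniformOfFintype (Bits (r z.length))).map (V.questions z)
  D := V.verdict z

/-- The languages with a two-player one-round entangled protocol with the given resource bounds,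
completeness `c` and soundness `s`. -/
def MIPStar (c s : ℝ) (r q a t : ℕ → ℕ) : Set (Set (List Bool)) :=
  {L | ∃ V : Verifier r q a t, ∀ z,
    (z ∈ L → c ≤ (V.game z).val) ∧ (z ∉ L → (V.game z).val ≤ s)}

/-- The zero-gap class. -/
def MIPStarZero (r q a t : ℕ → ℕ) : Set (Set (List Bool)) :=
  {L | ∃ V : Verifier r q a t, ∀ z,
    (z ∈ L → (V.game z).val = 1) ∧ (z ∉ L → (V.game z).val < 1)}

/-- The zero-gap class, with the synchronous value instead of the tensor product value. -/
def MIPStarZeroSync (r q a t : ℕ → ℕ) : Set (Set (List Bool)) :=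
  {L | ∃ V : Verifier r q a t, ∀ z,
    (z ∈ L → (V.game z).syncVal = 1) ∧ (z ∉ L → (V.game z).syncVal < 1)}

/-! No value of a game is ever computed: if the messages are short, there are simply too few games.
The value of the game on an instance depends only on its table of losses (`NonlocalGame.loss`): for
each pair of questions and each pair of answers, the probability of the questions if the answers
lose, and `0` otherwise. The table has `4 ^ (q + a)` entries. Round each of them up to `s` bits.

Counting. If `q + a ≤ γ log₂ n` with `γ < 1/2`, then `s * 4 ^ (q + a) < n` for large `n`, even with
`s = 2 q + k + 1`. A verifier then sorts the `2 ^ n` instances of length `n` into at most `2 ^ (n -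
1)` classes with equal rounded tables, and at most `2 ^ 2 ^ (n - 1)` sets of instances are unions of
classes. The `2 ^ (8 n)` choices of machine codes and parameters below `2 ^ n` cannot exhaust all `2
^ 2 ^ n` sets (`Diag.exists_good`). The least set that escapes is the slice of `Diag.lang` at length
`n`: for each choice it contains some `z` and omits some `z'` with the same rounded table.

Stability. Equal rounded tables make the values differ by at most `4 ^ q / (2 ^ s - 1)`, which is
smaller than any given gap for suitable `k` (`NonlocalGame.Close.val_le`). Since rounding up keeps
zero and nonzero entries apart, the value `1` also passes from one game to the other
(`NonlocalGame.Close.iSup_win_eq_one`). Hence no verifier with short messages treats `z` and `z'`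
differently enough, with or without a gap.

Complexity. The language is found by exhaustive search over sets, codes, instances and seeds. This
is expressed by arithmetic with polynomially bounded recursion (`PolyRec`) in the numbers `n`, `x`,
`N = 2 ^ n`, `B = 2 ^ N` and `W = 2 ^ (N * N)`. Such recursions are compiled to counter programs of
polynomial cost and these to Turing machines, which gives `EEXP` (`expLang_mem_EEXP`); they are also
primitive recursive, which gives `RE`. Verifiers enter as numbers: a configuration is a number whose
digits to the base `B` are moved by affine maps, with coefficients stored by Gödel's `β` function
(`MultiTapeTM.IsCode.machRun_cfgNum`). Any verifier with polynomial bounds is simulated faithfully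
at all large lengths with short messages (`Verifier.exists_fits`). -/

/-! ### Counter programs -/

/-- Structured programs on registers that hold natural numbers, with a read-once input string. -/
inductive CounterProg : Type
  | skip
  | inc (i : ℕ)
  | dec (i : ℕ)
  | seq (P Q : CounterProg)
  /-- repeat `P` as long as the register `i` is not zero -/
  | loop (i : ℕ) (P : CounterProg)
  /-- consume the whole input, and run `P` for each `0` and `Q` for each `1` -/
  | scan (P Q : CounterProg)

namespace CounterProg

/-- `Exec P R w R' w' τ`: from the registers `R` and the remaining input `w` the program `P` leads
to `R'` and `w'`, at cost `τ`. -/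
inductive Exec : CounterProg → (ℕ → ℕ) → List Bool → (ℕ → ℕ) → List Bool → ℕ → Prop
  | skip (R w) : Exec skip R w R w 0
  | inc (i R w) : Exec (inc i) R w (Function.update R i (R i + 1)) w 1
  | dec (i R w) : Exec (dec i) R w (Function.update R i (R i - 1)) w 1
  | seq {P Q R w R₁ w₁ R₂ w₂ τ₁ τ₂} : Exec P R w R₁ w₁ τ₁ → Exec Q R₁ w₁ R₂ w₂ τ₂ →
      Exec (seq P Q) R w R₂ w₂ (τ₁ + τ₂)
  | loop_zero {i R w} (P) : R i = 0 → Exec (loop i P) R w R w 1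
  | loop_succ {i P R w R₁ w₁ R₂ w₂ τ₁ τ₂} : R i ≠ 0 → Exec P R w R₁ w₁ τ₁ →
      Exec (loop i P) R₁ w₁ R₂ w₂ τ₂ → Exec (loop i P) R w R₂ w₂ (τ₁ + τ₂ + 2)
  | scan_nil (P Q R) : Exec (scan P Q) R [] R [] 1
  | scan_cons {P Q R b w R₁ w₁ R₂ w₂ τ₁ τ₂} : Exec (bif b then Q else P) R w R₁ w₁ τ₁ →
      Exec (scan P Q) R₁ w₁ R₂ w₂ τ₂ → Exec (scan P Q) R (b :: w) R₂ w₂ (τ₁ + τ₂ + 2)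

end CounterProg

/-- Instructions of flat counter machines; the targets of jumps are absolute. -/
inductive CounterInstr : Type
  /-- write the zero mark on all work tapes -/
  | mark
  | inc (i : ℕ)
  | dec (i : ℕ)
  /-- jump if the register `i` is zero -/
  | jz (i t : ℕ)
  | jmp (t : ℕ)
  /-- consume a bit of the input: jump to `t` after a `1`, and to `e` if there is none -/
  | read (t e : ℕ)

namespace CounterInstr

/-- The register that an instruction tests. -/
def reg : CounterInstr → ℕ
  | jz i _ => i
  | _ => 0

end CounterInstr

namespace CounterProg

/-- Flat code for a structured program that starts at position `o`. -/
def compile : CounterProg → ℕ → List CounterInstr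
  | skip, _ => []
  | inc i, _ => [.inc i]
  | dec i, _ => [.dec i]
  | seq P Q, o => compile P o ++ compile Q (o + (compile P o).length)
  | loop i P, o =>
    .jz i (o + (compile P (o + 1)).length + 2) :: (compile P (o + 1) ++ [.jmp o])
  | scan P Q, o =>
    .read (o + (compile P (o + 1)).length + 2)
      (o + (compile P (o + 1)).length +
        (compile Q (o + (compile P (o + 1)).length + 2)).length + 3) ::
      (compile P (o + 1) ++ (.jmp o ::
        (compile Q (o + (compile P (o + 1)).length + 2) ++ [.jmp o])))

end CounterProg

/-! ### Flat counter machines as Turing machines -/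

/-- The content of a work tape that stands for the number `v`: a mark on cell `0`, and the head
on cell `v`. -/
def counterTape (v : ℕ) : Turing.Tape (TapeSymbol 0) :=
  (Turing.Tape.move Turing.Dir.right)^[v] ((Turing.Tape.mk₁ []).write (some (Sum.inl true)))

/-- Only cell `0` is marked, so the symbol under the head reveals whether the register is zero. -/
theorem counterTape_head (v : ℕ) :
    (counterTape v).head = if v = 0 then some (Sum.inl true) else none := by
  rw [counterTape, Turing.Tape.move_right_n_head, Turing.Tape.write_nth]
  cases v with
  | zero => simp
  | succ v =>
    rw [if_neg (by omega), if_neg (by omega)]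
    show (Turing.Tape.mk' _ _).nth ((v + 1 : ℕ) : ℤ) = _
    rw [Turing.Tape.mk'_nth_nat]
    simp [Turing.ListBlank.nth_mk, List.getI]
    rfl

theorem counterTape_succ (v : ℕ) :
    (counterTape v).move Turing.Dir.right = counterTape (v + 1) := by
  rw [counterTape, counterTape, Function.iterate_succ_apply']

theorem counterTape_pred (v : ℕ) :
    (counterTape (v + 1)).move Turing.Dir.left = counterTape v := by
  rw [← counterTape_succ, Turing.Tape.move_right_left]

/-- The effect of one step of a Turing machine on a tape. -/
def tapeAction {Γ : Type} [Inhabited Γ] (T : Turing.Tape Γ) (p : Γ × Option Turing.Dir) :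
    Turing.Tape Γ :=
  match p.2 with
  | none => T.write p.1
  | some d => (T.write p.1).move d

/-- The number of registers of the flat code `C`. -/
def flatRegs (C : List CounterInstr) : ℕ := (C.map CounterInstr.reg).sum

/-- The transition function of the Turing machine that runs the flat code `C`. -/
def flatTrans (C : List CounterInstr) (q : Fin (C.length + 2))
    (h : Fin 1 ⊕ Fin (flatRegs C + 1) → TapeSymbol 0) :
    Option (Fin (C.length + 2) ×
      (Fin 1 ⊕ Fin (flatRegs C + 1) → TapeSymbol 0 × Option Turing.Dir)) :=
  match C[q.val]? with
  | none => none
  | some .mark => some (Fin.ofNat _ (q.val + 1),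
      Sum.elim (fun j => (h (.inl j), none)) fun _ => (some (Sum.inl true), none))
  | some (.inc i) => some (Fin.ofNat _ (q.val + 1),
      Sum.elim (fun j => (h (.inl j), none)) fun j =>
        (h (.inr j), if j.val = i then some Turing.Dir.right else none))
  | some (.dec i) => some (Fin.ofNat _ (q.val + 1),
      Sum.elim (fun j => (h (.inl j), none)) fun j =>
        (h (.inr j), if j.val = i ∧ h (.inr j) = none then some Turing.Dir.left else none))
  | some (.jz i t) => some (Fin.ofNat _ (if h (.inr (Fin.ofNat _ i)) = none then q.val + 1 else t),
      fun j => (h j, none))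
  | some (.jmp t) => some (Fin.ofNat _ t, fun j => (h j, none))
  | some (.read t e) => some (
      Fin.ofNat _ (if h (.inl 0) = some (.inl true) then t
        else if h (.inl 0) = none then e else q.val + 1),
      Sum.elim (fun j => (h (.inl j), if h (.inl j) = none then none else some Turing.Dir.right))
        fun j => (h (.inr j), none))

/-- The Turing machine that runs the flat code `C`, with the verdict `accept` in the state
number `acc`. -/
def flatTM (C : List CounterInstr) (acc : ℕ) : MultiTapeTM 1 where
  numWork := flatRegs C + 1
  numAux := 0
  -- The two states beyond the last instruction halt, which leaves room for two verdicts.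
  numStates := C.length + 2
  start := 0
  accepting q := decide (q.val = acc)
  trans := flatTrans C

/-- The configuration `c` of `flatTM C acc` represents the program counter `pc`, the registers `R`
and the remaining input `w`. -/
structure FlatRep (C : List CounterInstr) (acc pc : ℕ) (R : ℕ → ℕ) (w : List Bool)
    (c : (flatTM C acc).Cfg) : Prop where
  state : c.state = Fin.ofNat (C.length + 2) pc
  input : @Eq (Turing.ListBlank (TapeSymbol 0)) (c.tape (.inl 0)).right₀
    (Turing.ListBlank.mk (bitSymbols 0 w))
  work : ∀ j : Fin (flatRegs C + 1),
    @Eq (Turing.Tape (TapeSymbol 0)) (c.tape (.inr j)) (counterTape (R j.val))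

/-- The symbols under the heads, for the registers `R` and the remaining input `w`. -/
def flatHeads (C : List CounterInstr) (R : ℕ → ℕ) (w : List Bool) :
    Fin 1 ⊕ Fin (flatRegs C + 1) → TapeSymbol 0 :=
  Sum.elim (fun _ => w.head?.map Sum.inl)
    fun j => if R j.val = 0 then some (Sum.inl true) else none

/-- In `n` steps each configuration that represents the first situation is turned into one that
represents the second. -/
def FlatRuns (C : List CounterInstr) (acc n pc : ℕ) (R : ℕ → ℕ) (w : List Bool)
    (pc' : ℕ) (R' : ℕ → ℕ) (w' : List Bool) : Prop :=
  ∀ c, FlatRep C acc pc R w c →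
    FlatRep C acc pc' R' w' ((fun c => ((flatTM C acc).step c).getD c)^[n] c)

theorem FlatRuns.trans {C acc n m pc R w pc₁ R₁ w₁ pc₂ R₂ w₂}
    (h : FlatRuns C acc n pc R w pc₁ R₁ w₁) (h' : FlatRuns C acc m pc₁ R₁ w₁ pc₂ R₂ w₂) :
    FlatRuns C acc (n + m) pc R w pc₂ R₂ w₂ := by
  intro c hc
  rw [Nat.add_comm, Function.iterate_add_apply]
  exact h' _ (h _ hc)

theorem FlatRuns.refl (C acc pc R w) : FlatRuns C acc 0 pc R w pc R w := fun _ h => h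

theorem FlatRuns.one {C acc pc R w pc' R' w'}
    (h : ∀ c, FlatRep C acc pc R w c → ∃ c', (flatTM C acc).step c = some c' ∧
      FlatRep C acc pc' R' w' c') :
    FlatRuns C acc 1 pc R w pc' R' w' := by
  intro c hc
  obtain ⟨c', h1, h2⟩ := h c hc
  simpa [h1] using h2

theorem lt_length_of_getElem?_eq_some {α} {l : List α} {i : ℕ} {x : α} (h : l[i]? = some x) :
    i < l.length := by
  by_contra hn
  rw [List.getElem?_eq_none (by omega)] at h
  cases h

section flat

variable {C : List CounterInstr} {acc pc : ℕ} {R : ℕ → ℕ} {w : List Bool}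

theorem right₀_eq_mk_bitSymbols {T : Turing.Tape (TapeSymbol 0)}
    (h : T.right₀ = Turing.ListBlank.mk (bitSymbols 0 w)) :
    T.head = w.head?.map Sum.inl ∧ T.right = Turing.ListBlank.mk (bitSymbols 0 w.tail) := by
  have h1 := congrArg Turing.ListBlank.head h
  have h2 := congrArg Turing.ListBlank.tail h
  rw [Turing.Tape.right₀, Turing.ListBlank.head_cons] at h1
  rw [Turing.Tape.right₀, Turing.ListBlank.tail_cons] at h2
  rw [h1, h2, Turing.ListBlank.head_mk, Turing.ListBlank.tail_mk]
  cases w <;> exact ⟨rfl, rfl⟩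

theorem tapeAction_head_none {Γ : Type} [Inhabited Γ] (T : Turing.Tape Γ) :
    tapeAction T (T.head, none) = T := T.write_self

theorem tapeAction_head_some {Γ : Type} [Inhabited Γ] (T : Turing.Tape Γ) (d) :
    tapeAction T (T.head, some d) = T.move d := by
  rw [tapeAction]; dsimp only; rw [T.write_self]

theorem tapeAction_input {T : Turing.Tape (TapeSymbol 0)} {p : TapeSymbol 0 × Option Turing.Dir}
    {w' : List Bool} (hT : T.right₀ = Turing.ListBlank.mk (bitSymbols 0 w))
    (hp : p = (w.head?.map Sum.inl, none) ∧ w' = w ∨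
      p = (w.head?.map Sum.inl, some Turing.Dir.right) ∧ w' = w.tail) :
    (tapeAction T p).right₀ = Turing.ListBlank.mk (bitSymbols 0 w') := by
  obtain ⟨h1, h2⟩ := right₀_eq_mk_bitSymbols hT
  rcases hp with ⟨h3, h4⟩ | ⟨h3, h4⟩
  · rw [h3, h4, ← h1, tapeAction_head_none, hT]
  · rw [h3, h4, ← h1, tapeAction_head_some, ← h2]
    exact Turing.ListBlank.cons_head_tail _

theorem FlatRep.heads {c} (hc : FlatRep C acc pc R w c) :
    (fun i => (c.tape i).head) = flatHeads C R w := by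
  funext i
  rcases i with i | j
  · have : i = 0 := Subsingleton.elim _ _
    subst this
    exact (right₀_eq_mk_bitSymbols hc.input).1
  · show @Turing.Tape.head (TapeSymbol 0) _ (c.tape (.inr j)) = _
    rw [hc.work j, counterTape_head]
    rfl

/-- Reduces a step of the Turing machine to an evaluation of the transition function at the symbols
that `R` and `w` predict, and a check of each tape by itself. -/
theorem FlatRep.step {c pc' R' w'} {q : Fin (C.length + 2)}
    {f : Fin 1 ⊕ Fin (flatRegs C + 1) → TapeSymbol 0 × Option Turing.Dir}
    (hc : FlatRep C acc pc R w c) (hpc : pc < C.length + 2)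
    (htr : flatTrans C ⟨pc, hpc⟩ (flatHeads C R w) = some (q, f)) (hq : q = Fin.ofNat _ pc')
    (hin : f (.inl 0) = (w.head?.map Sum.inl, none) ∧ w' = w ∨
      f (.inl 0) = (w.head?.map Sum.inl, some Turing.Dir.right) ∧ w' = w.tail)
    (hwork : ∀ j, tapeAction (counterTape (R j.val)) (f (.inr j)) = counterTape (R' j.val)) :
    ∃ c', (flatTM C acc).step c = some c' ∧ FlatRep C acc pc' R' w' c' := by
  have hst : c.state = ⟨pc, hpc⟩ := by
    rw [hc.state]; exact Fin.ext (Nat.mod_eq_of_lt hpc)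
  refine ⟨⟨q, fun i => tapeAction (c.tape i) (f i)⟩, ?_, hq, ?_, fun j => ?_⟩
  · have : (flatTM C acc).trans c.state (fun i => (c.tape i).head) = some (q, f) := by
      rw [hst]
      exact (congrArg (flatTrans C ⟨pc, hpc⟩) hc.heads).trans htr
    rw [MultiTapeTM.step, this]
    refine congrArg some ?_
    dsimp only
    congr 1
  · exact tapeAction_input hc.input hin
  · exact (congrArg (fun T => tapeAction (Γ := TapeSymbol 0) T (f (.inr j))) (hc.work j)).trans
      (hwork j)

theorem flatRuns_of_getElem? {ins : CounterInstr} (h : C[pc]? = some ins) {pc' R' w'}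
    (H : ∀ hpc : pc < C.length + 2, ∃ f : _ → TapeSymbol 0 × Option Turing.Dir,
      flatTrans C ⟨pc, hpc⟩ (flatHeads C R w) = some (Fin.ofNat _ pc', f) ∧
      (f (.inl 0) = (w.head?.map Sum.inl, none) ∧ w' = w ∨
        f (.inl 0) = (w.head?.map Sum.inl, some Turing.Dir.right) ∧ w' = w.tail) ∧
      ∀ j, tapeAction (counterTape (R j.val)) (f (.inr j)) = counterTape (R' j.val)) :
    FlatRuns C acc 1 pc R w pc' R' w' := by
  have hpc : pc < C.length + 2 := by have := lt_length_of_getElem?_eq_some h; omega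
  obtain ⟨f, h1, h2, h3⟩ := H hpc
  exact FlatRuns.one fun c hc => hc.step hpc h1 rfl h2 h3

theorem flatHeads_inr (j) : flatHeads C R w (.inr j) = (counterTape (R j.val)).head := by
  rw [counterTape_head]; rfl

theorem flatRuns_inc {i : ℕ} (h : C[pc]? = some (.inc i)) :
    FlatRuns C acc 1 pc R w (pc + 1) (Function.update R i (R i + 1)) w := by
  refine flatRuns_of_getElem? h fun hpc => ⟨_, by simp only [flatTrans, h]; rfl,
    .inl ⟨rfl, rfl⟩, fun j => ?_⟩
  simp only [Sum.elim_inr, flatHeads_inr]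
  by_cases hj : j.val = i
  · subst hj
    simp [tapeAction_head_some, counterTape_succ]
  · simp [hj, tapeAction_head_none]

theorem flatRuns_dec {i : ℕ} (h : C[pc]? = some (.dec i)) :
    FlatRuns C acc 1 pc R w (pc + 1) (Function.update R i (R i - 1)) w := by
  refine flatRuns_of_getElem? h fun hpc => ⟨_, by simp only [flatTrans, h]; rfl,
    .inl ⟨rfl, rfl⟩, fun j => ?_⟩
  simp only [Sum.elim_inr, flatHeads_inr]
  by_cases hj : j.val = i
  · subst hj
    rcases hR : R j.val with _ | v
    · rw [if_neg (by simp [counterTape_head]), tapeAction_head_none]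
      simp
    · rw [if_pos ⟨rfl, by simp [counterTape_head]⟩, tapeAction_head_some, counterTape_pred]
      simp
  · simp [hj, tapeAction_head_none]

theorem flatRuns_jmp {t : ℕ} (h : C[pc]? = some (.jmp t)) :
    FlatRuns C acc 1 pc R w t R w := by
  refine flatRuns_of_getElem? h fun hpc => ⟨_, by simp only [flatTrans, h]; rfl,
    .inl ⟨rfl, rfl⟩, fun j => ?_⟩
  simp only [flatHeads_inr, tapeAction_head_none]

theorem flatRuns_jz {i t : ℕ} (h : C[pc]? = some (.jz i t)) :
    FlatRuns C acc 1 pc R w (if R i = 0 then t else pc + 1) R w := by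
  -- `flatRegs` is the sum of the indices of all tested registers, so it bounds each of them and the
  -- tested register has a tape of its own. Registers that are never tested may lack a tape: they
  -- influence nothing.
  have hi : i < flatRegs C + 1 := by
    have : i ∈ C.map CounterInstr.reg :=
      List.mem_map.2 ⟨_, List.mem_of_getElem? h, rfl⟩
    have := List.le_sum_of_mem this
    rw [flatRegs]
    omega
  have hR : R (Fin.ofNat (flatRegs C + 1) i).val = R i :=
    congrArg R (Nat.mod_eq_of_lt hi)
  refine flatRuns_of_getElem? h fun hpc => ⟨fun j => (flatHeads C R w j, none), ?_,
    .inl ⟨rfl, rfl⟩, fun j => ?_⟩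
  · simp only [flatTrans, h, flatHeads_inr, counterTape_head, hR]
    by_cases h0 : R i = 0 <;> simp [h0]
  · simp only [flatHeads_inr, tapeAction_head_none]

theorem flatRuns_read_nil {t e : ℕ} (h : C[pc]? = some (.read t e)) :
    FlatRuns C acc 1 pc R [] e R [] := by
  refine flatRuns_of_getElem? h fun hpc => ⟨_, by simp only [flatTrans, h]; rfl,
    .inl ⟨rfl, rfl⟩, fun j => ?_⟩
  simp only [Sum.elim_inr, flatHeads_inr, tapeAction_head_none]

theorem flatRuns_read_cons {t e : ℕ} {b : Bool} (h : C[pc]? = some (.read t e)) :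
    FlatRuns C acc 1 pc R (b :: w) (bif b then t else pc + 1) R w := by
  refine flatRuns_of_getElem? h fun hpc => ⟨Sum.elim
    (fun _ => (some (.inl b), some Turing.Dir.right)) fun j => (flatHeads C R w (.inr j), none),
    ?_, .inr ⟨rfl, rfl⟩, fun j => ?_⟩
  · cases b <;> (simp only [flatTrans, h]; rfl)
  simp only [Sum.elim_inr, flatHeads_inr, tapeAction_head_none]

end flat

/-- The code fragment `l` stands at position `o` of the code `C`. -/
def CodeAt (C : List CounterInstr) (o : ℕ) (l : List CounterInstr) : Prop :=
  ∀ i, i < l.length → C[o + i]? = l[i]?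

theorem CodeAt.left {C o l l'} (h : CodeAt C o (l ++ l')) : CodeAt C o l := by
  intro i hi
  rw [h i (by simp; omega), List.getElem?_append_left hi]

theorem CodeAt.right {C o l l'} (h : CodeAt C o (l ++ l')) : CodeAt C (o + l.length) l' := by
  intro i hi
  rw [Nat.add_assoc, h _ (by simp; omega), List.getElem?_append_right (by omega)]
  congr 1; omega

theorem CodeAt.head {C o x l} (h : CodeAt C o (x :: l)) : C[o]? = some x :=
  h 0 (by simp)

theorem CodeAt.tail {C o x l} (h : CodeAt C o (x :: l)) : CodeAt C (o + 1) l :=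
  CodeAt.right (l := [x]) h

/-- Induction on the execution. The extra cost `2` of each turn of a loop or scan pays for the test
and for the jump back, so the cost bounds the number of machine steps. -/
theorem CounterProg.Exec.flatRuns {C acc P R w R' w' τ} (h : CounterProg.Exec P R w R' w' τ) :
    ∀ {o}, CodeAt C o (P.compile o) →
      ∃ n ≤ τ, FlatRuns C acc n o R w (o + (P.compile o).length) R' w' := by
  induction h with
  | skip R w => exact fun _ => ⟨0, le_rfl, FlatRuns.refl _ _ _ _ _⟩
  | inc i R w => exact fun h => ⟨1, le_rfl, flatRuns_inc h.head⟩
  | dec i R w => exact fun h => ⟨1, le_rfl, flatRuns_dec h.head⟩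
  | seq _ _ ih₁ ih₂ =>
    intro o h
    obtain ⟨n, hn, r⟩ := ih₁ h.left
    obtain ⟨m, hm, r'⟩ := ih₂ h.right
    refine ⟨n + m, by omega, ?_⟩
    have := r.trans r'
    simpa [CounterProg.compile, Nat.add_assoc] using this
  | @loop_zero i R w P h0 =>
    intro o h
    refine ⟨1, le_rfl, ?_⟩
    have := flatRuns_jz (acc := acc) (R := R) (w := w) h.head
    rw [if_pos h0] at this
    simpa [CounterProg.compile, Nat.add_assoc] using this
  | @loop_succ i P R w R₁ w₁ R₂ w₂ τ₁ τ₂ h0 _ _ ih₁ ih₂ =>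
    intro o h
    have r₀ := flatRuns_jz (acc := acc) (R := R) (w := w) h.head
    rw [if_neg h0] at r₀
    obtain ⟨n, hn, r₁⟩ := ih₁ h.tail.left
    have r₂ := flatRuns_jmp (acc := acc) (R := R₁) (w := w₁) h.tail.right.head
    obtain ⟨m, hm, r₃⟩ := ih₂ h
    exact ⟨1 + n + 1 + m, by omega, ((r₀.trans r₁).trans r₂).trans r₃⟩
  | scan_nil P Q R =>
    intro o h
    refine ⟨1, le_rfl, ?_⟩
    have := flatRuns_read_nil (acc := acc) (R := R) h.head
    refine cast ?_ this
    congr 1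
    simp [CounterProg.compile]; omega
  | @scan_cons P Q R b w R₁ w₁ R₂ w₂ τ₁ τ₂ _ _ ih₁ ih₂ =>
    intro o h
    have r₀ := flatRuns_read_cons (acc := acc) (R := R) (w := w) (b := b) h.head
    obtain ⟨m, hm, r₃⟩ := ih₂ h
    cases b
    · obtain ⟨n, hn, r₁⟩ := ih₁ h.tail.left
      have r₂ := flatRuns_jmp (acc := acc) (R := R₁) (w := w₁) h.tail.right.head
      exact ⟨1 + n + 1 + m, by omega, ((r₀.trans r₁).trans r₂).trans r₃⟩
    · have e : o + 1 + (P.compile (o + 1)).length + 1 = o + (P.compile (o + 1)).length + 2 := by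
        omega
      have hQ := h.tail.right.tail
      rw [e] at hQ
      obtain ⟨n, hn, r₁⟩ := ih₁ hQ.left
      have r₂ := flatRuns_jmp (acc := acc) (R := R₁) (w := w₁) hQ.right.head
      exact ⟨1 + n + 1 + m, by omega, ((r₀.trans r₁).trans r₂).trans r₃⟩

theorem flatTM_step_eq_none {C acc} {c : (flatTM C acc).Cfg}
    (h : C[Fin.val (n := C.length + 2) c.state]? = none) : (flatTM C acc).step c = none := by
  have : ∀ (q : Fin (C.length + 2)) hd, C[q.val]? = none → flatTrans C q hd = none :=
    fun q hd hq => by simp only [flatTrans, hq]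
  have h' : (flatTM C acc).trans c.state (fun i => (c.tape i).head) = none :=
    this c.state (fun i => (c.tape i).head) h
  rw [MultiTapeTM.step, h']
  rfl

theorem MultiTapeTM.after_add {m : ℕ} (M : MultiTapeTM m) (inp) (n k : ℕ) :
    M.after inp (n + k) = (fun c => (M.step c).getD c)^[k] (M.after inp n) := by
  rw [MultiTapeTM.after, MultiTapeTM.after, Nat.add_comm, Function.iterate_add_apply]

theorem MultiTapeTM.HaltsWithin.after_eq {m : ℕ} {M : MultiTapeTM m} {inp} {n k : ℕ}
    (h : M.HaltsWithin inp n) (hk : n ≤ k) : M.after inp k = M.after inp n := by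
  obtain ⟨k, rfl⟩ := Nat.exists_eq_add_of_le hk
  rw [MultiTapeTM.after_add]
  exact Function.iterate_fixed (by rw [h]; rfl) k

theorem MultiTapeTM.Decides.mono {m : ℕ} {M : MultiTapeTM m} {inp} {n k : ℕ} {b : Bool}
    (h : M.Decides inp n b) (hk : n ≤ k) : M.Decides inp k b := by
  have := h.1.after_eq hk
  exact ⟨by rw [MultiTapeTM.HaltsWithin, this]; exact h.1, by rw [this]; exact h.2⟩

/-- The Turing machine that runs the program `P` and accepts if the register `i` is not zero at
the end. -/
theorem CounterProg.exists_turingMachine (P : CounterProg) (i : ℕ) :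
    ∃ M : MultiTapeTM 1, ∀ z R' w' τ, P.Exec (fun _ => 0) z R' w' τ →
      M.Decides ![z] (τ + 2) (decide (R' i ≠ 0)) := by
  set e := 1 + (P.compile 1).length with he
  -- Position `e` holds the final test. It jumps to `e + 2` if the register is zero and falls
  -- through to `e + 1` otherwise; both lie beyond the code, and `e + 1` is made the accepting
  -- state. The mark and this test are the two steps beyond `τ`.
  set C : List CounterInstr := .mark :: (P.compile 1 ++ [.jz i (e + 2)]) with hC
  have hlen : C.length = e + 1 := by simp [hC, he]; omega
  have hcode : CodeAt C 0 C := fun i _ => by simp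
  refine ⟨flatTM C (e + 1), fun z R' w' τ hP => ?_⟩
  obtain ⟨n, hn, r⟩ := hP.flatRuns (acc := e + 1) (CodeAt.left (CodeAt.tail hcode))
  have r' := flatRuns_jz (acc := e + 1) (R := R') (w := w')
    (CodeAt.head (CodeAt.right (CodeAt.tail hcode)))
  have h0 : FlatRep C (e + 1) 1 (fun _ => 0) z ((flatTM C (e + 1)).after ![z] 1) := by
    refine ⟨rfl, ?_, fun j => rfl⟩
    show (tapeAction (Γ := TapeSymbol 0) (Turing.Tape.mk₁ (bitSymbols 0 z))
      ((Turing.Tape.mk₁ (bitSymbols 0 z)).head, none)).right₀ = _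
    rw [tapeAction_head_none]
    exact Turing.Tape.mk'_right₀ _ _
  have h1 := r.trans r' _ h0
  rw [← MultiTapeTM.after_add] at h1
  have hst : ((flatTM C (e + 1)).after ![z] (1 + (n + 1))).state.val =
      if R' i = 0 then e + 2 else e + 1 := by
    rw [h1.state]
    simp only [Fin.ofNat, hlen, ← he, Nat.zero_add]
    refine (Nat.mod_eq_of_lt ?_).trans ?_ <;> split_ifs <;> omega
  refine MultiTapeTM.Decides.mono (n := 1 + (n + 1)) ⟨?_, ?_⟩ (by omega)
  · have : C[((flatTM C (e + 1)).after ![z] (1 + (n + 1))).state.val]? = none := by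
      rw [hst]
      apply List.getElem?_eq_none
      split_ifs <;> omega
    exact flatTM_step_eq_none this
  · show decide (_ = _) = _
    rw [hst]
    congr 1
    by_cases h : R' i = 0 <;> simp [h]

/-! ### Arithmetic with counter programs -/

namespace CounterProg

/-- The program `P` turns the registers `R` into `R'` at cost at most `τ`, and leaves the input
alone. -/
def Does (P : CounterProg) (R R' : ℕ → ℕ) (τ : ℕ) : Prop :=
  ∀ w, ∃ τ' ≤ τ, Exec P R w R' w τ'

theorem Does.mono {P R R' τ τ'} (h : Does P R R' τ) (hτ : τ ≤ τ') : Does P R R' τ' := fun w =>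
  let ⟨t, ht, e⟩ := h w
  ⟨t, ht.trans hτ, e⟩

theorem Does.of_eq {P R R₁ R' τ τ'} (h : Does P R R₁ τ) (hR : R₁ = R') (hτ : τ ≤ τ') :
    Does P R R' τ' :=
  hR ▸ h.mono hτ

theorem Does.seq {P Q R R₁ R₂ τ₁ τ₂} (h₁ : Does P R R₁ τ₁) (h₂ : Does Q R₁ R₂ τ₂) :
    Does (seq P Q) R R₂ (τ₁ + τ₂) := fun w =>
  let ⟨_, ht₁, e₁⟩ := h₁ w
  let ⟨_, ht₂, e₂⟩ := h₂ w
  ⟨_, Nat.add_le_add ht₁ ht₂, e₁.seq e₂⟩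

theorem does_skip (R) : Does skip R R 0 := fun _ => ⟨0, le_rfl, .skip _ _⟩

theorem does_inc (i R) : Does (inc i) R (Function.update R i (R i + 1)) 1 :=
  fun _ => ⟨1, le_rfl, .inc _ _ _⟩

theorem does_dec (i R) : Does (dec i) R (Function.update R i (R i - 1)) 1 :=
  fun _ => ⟨1, le_rfl, .dec _ _ _⟩

/-- `S j` is the state of the registers after `j` turns: a loop is verified by exhibiting its whole
history. -/
theorem does_loop {i : ℕ} {P : CounterProg} {t : ℕ → ℕ} {n : ℕ} :
    ∀ {S : ℕ → ℕ → ℕ}, (∀ j < n, S j i ≠ 0) → S n i = 0 →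
      (∀ j < n, Does P (S j) (S (j + 1)) (t j)) →
      Does (loop i P) (S 0) (S n) (∑ j ∈ Finset.range n, (t j + 2) + 1) := by
  induction n generalizing t with
  | zero => exact fun _ h _ w => ⟨1, by simp, .loop_zero _ h⟩
  | succ n ih =>
    intro S h1 h2 h3 w
    obtain ⟨τ₁, ht₁, e₁⟩ := h3 0 (by omega) w
    obtain ⟨τ₂, ht₂, e₂⟩ := ih (t := fun j => t (j + 1)) (S := fun j => S (j + 1))
      (fun j hj => h1 _ (by omega)) h2 (fun j hj => h3 _ (by omega)) w
    refine ⟨_, ?_, .loop_succ (h1 0 (by omega)) e₁ e₂⟩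
    rw [Finset.sum_range_succ']
    omega

/-- Run `P 0`, …, `P (n - 1)`. -/
def seqAll (P : ℕ → CounterProg) : ℕ → CounterProg
  | 0 => skip
  | n + 1 => seq (seqAll P n) (P n)

theorem does_seqAll {P : ℕ → CounterProg} {t : ℕ → ℕ} {S : ℕ → ℕ → ℕ} {n : ℕ}
    (h : ∀ j < n, Does (P j) (S j) (S (j + 1)) (t j)) :
    Does (seqAll P n) (S 0) (S n) (∑ j ∈ Finset.range n, t j) := by
  induction n with
  | zero => exact does_skip _
  | succ n ih =>
    rw [Finset.sum_range_succ]
    exact (ih fun j hj => h j (by omega)).seq (h n (by omega))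

/-- Set the register `a` to zero. -/
def clear (a : ℕ) : CounterProg := loop a (dec a)

theorem does_clear (a : ℕ) (R : ℕ → ℕ) :
    Does (clear a) R (Function.update R a 0) (3 * R a + 1) := by
  have := does_loop (i := a) (P := dec a) (t := fun _ => 1) (n := R a)
    (S := fun j => Function.update R a (R a - j)) (fun j hj => by simp; omega) (by simp)
    (fun j hj => (does_dec a _).of_eq (by simp [Nat.sub_sub]) le_rfl)
  simp only [Nat.sub_zero, Function.update_eq_self] at this
  exact this.of_eq (by simp) (by simp; omega)

/-- Add the register `a` to the register `b`, and clear `a`. -/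
def move (a b : ℕ) : CounterProg := loop a (seq (dec a) (inc b))

theorem does_move {a b : ℕ} (hab : a ≠ b) (R : ℕ → ℕ) :
    Does (move a b) R (Function.update (Function.update R b (R b + R a)) a 0) (4 * R a + 1) := by
  have := does_loop (i := a) (P := seq (dec a) (inc b)) (t := fun _ => 2) (n := R a)
    (S := fun j => Function.update (Function.update R b (R b + j)) a (R a - j))
    (fun j hj => by simp; omega) (by simp)
    (fun j hj => by
      refine ((does_dec a _).seq (does_inc b _)).of_eq ?_ le_rfl
      funext x
      by_cases h1 : x = a <;> by_cases h2 : x = b <;>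
        simp [h1, h2, hab, hab.symm] <;> omega)
  simp only [Nat.sub_zero, Nat.add_zero, Function.update_eq_self] at this
  exact this.of_eq (by simp) (by simp; omega)

/-- Add the register `a` to the register `b`, with the help of the register `c`. -/
def copy (a b c : ℕ) : CounterProg := seq (loop a (seq (dec a) (seq (inc b) (inc c)))) (move c a)

theorem does_copy {a b c : ℕ} (hab : a ≠ b) (hac : a ≠ c) (hbc : b ≠ c) (R : ℕ → ℕ)
    (hc : R c = 0) :
    Does (copy a b c) R (Function.update R b (R b + R a)) (9 * R a + 2) := by
  have := does_loop (i := a) (P := seq (dec a) (seq (inc b) (inc c))) (t := fun _ => 3) (n := R a)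
    (S := fun j => Function.update (Function.update (Function.update R b (R b + j)) c j) a (R a - j))
    (fun j hj => by simp; omega) (by simp)
    (fun j hj => by
      refine ((does_dec a _).seq ((does_inc b _).seq (does_inc c _))).of_eq ?_ le_rfl
      funext x
      by_cases h1 : x = a <;> by_cases h2 : x = b <;> by_cases h3 : x = c <;>
        simp [h1, h2, h3, hab, hab.symm, hac, hac.symm, hbc, hbc.symm] <;>
        omega)
  have e : Function.update (Function.update (Function.update R b (R b + 0)) c 0) a (R a - 0) = R := by
    have hc' : Function.update R c 0 = R := Function.update_eq_self_iff.2 hc.symm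
    rw [Nat.add_zero, Nat.sub_zero, Function.update_eq_self, hc', Function.update_eq_self]
  rw [e] at this
  refine (this.seq (does_move hac.symm _)).of_eq ?_ (by simp [hac.symm]; omega)
  funext x
  by_cases h1 : x = a
  · subst h1; simp [hab, hac, hac.symm]
  by_cases h3 : x = c
  · subst h3; simp [hac.symm, hbc.symm, hc]
  simp [Function.update_apply, h1, h3]

/-- A program, for any places `ρ` of the arguments and any `s` above them, that writes `f` of the
arguments into the register `s`, uses only registers from `s` on, which are blank at the start, and
leaves no other trace. Its cost is at most `T` of the arguments. -/
def Computes {k : ℕ} (f T : (Fin k → ℕ) → ℕ) : Prop :=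
  ∃ G : (Fin k → ℕ) → ℕ → CounterProg, ∀ ρ s, (∀ i, ρ i < s) → ∀ R : ℕ → ℕ, (∀ j, s ≤ j → R j = 0) →
    Does (G ρ s) R (Function.update R s (f (R ∘ ρ))) (T (R ∘ ρ))

theorem computes_zero {k : ℕ} : Computes (fun _ : Fin k → ℕ => 0) fun _ => 0 :=
  ⟨fun _ _ => skip, fun ρ s _ R h => by
    have : Function.update R s 0 = R := by rw [← h s le_rfl, Function.update_eq_self]
    rw [this]
    exact does_skip R⟩

theorem computes_proj {k : ℕ} (i : Fin k) : Computes (fun v => v i) fun v => 9 * v i + 2 :=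
  ⟨fun ρ s => copy (ρ i) s (s + 1), fun ρ s hρ R h => by
    have hi := hρ i
    have := does_copy (a := ρ i) (b := s) (c := s + 1) (by omega) (by omega) (by omega) R
      (h _ (by omega))
    rwa [h s le_rfl, Nat.zero_add] at this⟩

theorem Computes.succ {k : ℕ} {f T : (Fin k → ℕ) → ℕ} (hf : Computes f T) :
    Computes (fun v => f v + 1) fun v => T v + 1 := by
  obtain ⟨G, hG⟩ := hf
  refine ⟨fun ρ s => .seq (G ρ s) (inc s), fun ρ s hρ R h => ?_⟩
  have := (hG ρ s hρ R h).seq (does_inc s _)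
  simpa using this

/-- The values of the `g i` are collected in the registers `s + 1, …, s + m`, and `f` is applied to
them with its result in `s + 1 + m`. Then the collected values are cleared and the result is moved
to `s`. -/
theorem Computes.comp {m k : ℕ} {f T : (Fin m → ℕ) → ℕ} {g U : Fin m → (Fin k → ℕ) → ℕ}
    (hf : Computes f T) (hg : ∀ i, Computes (g i) (U i)) :
    Computes (fun v => f fun i => g i v) fun v =>
      ∑ i, U i v + T (fun i => g i v) + ∑ i, (3 * g i v + 1) + 4 * f (fun i => g i v) + 1 := by
  obtain ⟨F, hF⟩ := hf
  choose G hG using hg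
  refine ⟨fun ρ s => .seq (.seq (.seq
      (seqAll (fun j => if h : j < m then G ⟨j, h⟩ ρ (s + 1 + j) else skip) m)
      (F (fun i => s + 1 + i.val) (s + 1 + m)))
      (seqAll (fun j => clear (s + 1 + j)) m)) (move (s + 1 + m) s), fun ρ s hρ R hR => ?_⟩
  set v := R ∘ ρ with hv
  set val : ℕ → ℕ := fun j => if h : j < m then g ⟨j, h⟩ v else 0 with hval
  set fv := f fun i => g i v with hfv
  have hvali : ∀ i : Fin m, val i = g i v := fun i => by simp [hval]
  have h1 := does_seqAll (n := m)
    (P := fun j => if h : j < m then G ⟨j, h⟩ ρ (s + 1 + j) else skip)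
    (t := fun j => if h : j < m then U ⟨j, h⟩ v else 0)
    (S := fun j x => if s + 1 ≤ x ∧ x < s + 1 + j then val (x - (s + 1)) else R x)
    (fun j hj => by
      simp only [dif_pos hj]
      have hcomp : (fun x => if s + 1 ≤ x ∧ x < s + 1 + j then val (x - (s + 1)) else R x) ∘ ρ
          = v := by
        funext i
        have := hρ i
        simp only [Function.comp, hv]
        rw [if_neg (by omega)]
      refine (hG ⟨j, hj⟩ ρ (s + 1 + j) (fun i => by have := hρ i; omega) _
        (fun x hx => by rw [if_neg (by omega)]; exact hR x (by omega))).of_eq ?_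
          (by rw [hcomp])
      rw [hcomp]
      funext x
      by_cases hx : x = s + 1 + j
      · subst hx
        simp [← hvali ⟨j, hj⟩]
      · rw [Function.update_of_ne hx]
        congr 1
        simp only [eq_iff_iff]
        omega)
  have e1 : (fun x => if s + 1 ≤ x ∧ x < s + 1 + 0 then val (x - (s + 1)) else R x) = R := by
    funext x; rw [if_neg (by omega)]
  rw [e1] at h1
  set S₁ : ℕ → ℕ := fun x => if s + 1 ≤ x ∧ x < s + 1 + m then val (x - (s + 1)) else R x with hS₁
  have hcomp : (S₁ ∘ fun i : Fin m => s + 1 + i.val) = fun i => g i v := by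
    funext i
    have := i.2
    simp only [Function.comp, hS₁]
    rw [if_pos (by omega), ← hvali]
    congr 1; omega
  have h2 := hF (fun i => s + 1 + i.val) (s + 1 + m) (fun i => by have := i.2; omega) S₁
    (fun x hx => by simp only [hS₁]; rw [if_neg (by omega)]; exact hR x (by omega))
  rw [hcomp] at h2
  have h3 := does_seqAll (n := m) (P := fun j => clear (s + 1 + j)) (t := fun j => 3 * val j + 1)
    (S := fun j x => if s + 1 + j ≤ x ∧ x < s + 1 + m then val (x - (s + 1))
      else if x = s + 1 + m then fv else R x)
    (fun j hj => by
      refine (does_clear (s + 1 + j) _).of_eq ?_ (le_of_eq ?_)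
      · funext x
        by_cases hx : x = s + 1 + j
        · subst hx
          rw [Function.update_self, if_neg (by omega), if_neg (by omega)]
          exact (hR _ (by omega)).symm
        · rw [Function.update_of_ne hx]
          congr 1
          simp only [eq_iff_iff]
          omega
      · rw [if_pos (by omega)]
        congr 3
        omega)
  have e3 : (fun x => if s + 1 + 0 ≤ x ∧ x < s + 1 + m then val (x - (s + 1))
      else if x = s + 1 + m then fv else R x) = Function.update S₁ (s + 1 + m) fv := by
    funext x
    by_cases hx : x = s + 1 + m
    · subst hx; simp
    · rw [Function.update_of_ne hx]; simp [hx, hS₁]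
  rw [e3] at h3
  refine (((h1.seq h2).seq h3).seq
    (does_move (a := s + 1 + m) (b := s) (by omega) _)).of_eq ?_ ?_
  · clear h1 h2 h3 e1 e3
    funext x
    have hs : R s = 0 := hR s le_rfl
    by_cases hx : x = s + 1 + m
    · subst hx
      rw [Function.update_self, Function.update_of_ne (by omega), hR _ (by omega)]
    · rw [Function.update_of_ne hx]
      by_cases hx' : x = s
      · subst hx'
        have hx'' : x ≠ x + 1 + m := by omega
        simp [hs, hfv, hx'']
      · rw [Function.update_of_ne hx', Function.update_of_ne hx', if_neg (by omega), if_neg hx]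
  · have a1 : ∑ j ∈ Finset.range m, (if h : j < m then U ⟨j, h⟩ v else 0) = ∑ i, U i v := by
      rw [Finset.sum_range]; simp
    have a2 : ∑ j ∈ Finset.range m, (3 * val j + 1) = ∑ i, (3 * g i v + 1) := by
      rw [Finset.sum_range]; simp [hvali]
    rw [a1, a2]
    simp [hfv, Nat.add_assoc]

/-- The values of a primitive recursion. -/
def recVal {k : ℕ} (f : (Fin k → ℕ) → ℕ) (g : (Fin (k + 2) → ℕ) → ℕ) (v : Fin k → ℕ) (n : ℕ) : ℕ :=
  Nat.rec (f v) (fun i a => g (Fin.cons i (Fin.cons a v))) n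

/-- Register `s` holds the current value, `s + 1` the number of remaining rounds and `s + 2` the
index of the round. The next value is formed in `s + 3`, since the old one is still needed as an
argument of `g`. -/
theorem Computes.prec {k : ℕ} {f T : (Fin k → ℕ) → ℕ} {g U : (Fin (k + 2) → ℕ) → ℕ}
    (hf : Computes f T) (hg : Computes g U) :
    Computes (fun v : Fin (k + 1) → ℕ => recVal f g (Fin.tail v) (v 0)) fun v =>
      T (Fin.tail v) + ∑ i ∈ Finset.range (v 0),
        (U (Fin.cons i (Fin.cons (recVal f g (Fin.tail v) i) (Fin.tail v))) +
          3 * recVal f g (Fin.tail v) i + 4 * recVal f g (Fin.tail v) (i + 1) + 6) +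
        12 * v 0 + 4 := by
  obtain ⟨F, hF⟩ := hf
  obtain ⟨G, hG⟩ := hg
  refine ⟨fun ρ s => .seq (.seq (.seq (F (Fin.tail ρ) s) (copy (ρ 0) (s + 1) (s + 2)))
    (loop (s + 1) (.seq (.seq (.seq (.seq (dec (s + 1))
      (G (Fin.cons (s + 2) (Fin.cons s (Fin.tail ρ))) (s + 3))) (clear s)) (move (s + 3) s))
      (inc (s + 2))))) (clear (s + 2)), fun ρ s hρ R hR => ?_⟩
  have hv : R ∘ Fin.tail ρ = Fin.tail (R ∘ ρ) := rfl
  set v := Fin.tail (R ∘ ρ) with hvdef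
  show Does _ R (Function.update R s (recVal f g v (R (ρ 0))))
    (T v + ∑ i ∈ Finset.range (R (ρ 0)),
        (U (Fin.cons i (Fin.cons (recVal f g v i) v)) +
          3 * recVal f g v i + 4 * recVal f g v (i + 1) + 6) + 12 * R (ρ 0) + 4)
  set n := R (ρ 0) with hndef
  have hρ0 := hρ 0
  have h1 := hF (Fin.tail ρ) s (fun i => hρ _) R hR
  rw [hv] at h1
  have h2 := does_copy (a := ρ 0) (b := s + 1) (c := s + 2) (by omega) (by omega) (by omega)
    (Function.update R s (f v)) (by rw [Function.update_of_ne (by omega)]; exact hR _ (by omega))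
  rw [Function.update_of_ne (by omega), Function.update_of_ne (by omega), hR (s + 1) (by omega),
    Nat.zero_add, ← hndef] at h2
  set S : ℕ → ℕ → ℕ := fun j => Function.update (Function.update (Function.update R s
    (recVal f g v j)) (s + 1) (n - j)) (s + 2) j with hS
  have hSge : ∀ j x, s + 3 ≤ x → S j x = 0 := fun j x hx => by
    simp only [hS]
    rw [Function.update_of_ne (by omega), Function.update_of_ne (by omega),
      Function.update_of_ne (by omega), hR _ (by omega)]
  have hSlt : ∀ j x, x < s → S j x = R x := fun j x hx => by
    simp only [hS]
    rw [Function.update_of_ne (by omega), Function.update_of_ne (by omega),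
      Function.update_of_ne (by omega)]
  have h3 := does_loop (i := s + 1) (n := n) (S := S)
    (P := .seq (.seq (.seq (.seq (dec (s + 1))
      (G (Fin.cons (s + 2) (Fin.cons s (Fin.tail ρ))) (s + 3))) (clear s)) (move (s + 3) s))
      (inc (s + 2)))
    (t := fun i => U (Fin.cons i (Fin.cons (recVal f g v i) v)) +
          3 * recVal f g v i + 4 * recVal f g v (i + 1) + 4)
    (fun j hj => by simp [hS]; omega) (by simp [hS])
    (fun j hj => by
      have k1 := does_dec (s + 1) (S j)
      set R₁ := Function.update (S j) (s + 1) (S j (s + 1) - 1) with hR₁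
      have hcomp : R₁ ∘ (Fin.cons (s + 2) (Fin.cons s (Fin.tail ρ)) : Fin (k + 2) → ℕ)
          = Fin.cons j (Fin.cons (recVal f g v j) v) := by
        funext i
        refine Fin.cases ?_ (fun i => Fin.cases ?_ (fun i => ?_) i) i
        · simp [hR₁, hS]
        · simp [hR₁, hS]
        · have := hρ i.succ
          simp only [Function.comp, Fin.cons_succ, hvdef, Fin.tail, hR₁]
          rw [Function.update_of_ne (by omega), hSlt _ _ this]
      have k2 := hG (Fin.cons (s + 2) (Fin.cons s (Fin.tail ρ))) (s + 3)
        (fun i => by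
          refine Fin.cases ?_ (fun i => Fin.cases ?_ (fun i => ?_) i) i
          · simp
          · simp
          · have := hρ i.succ
            simp only [Fin.cons_succ, Fin.tail]; omega) R₁
        (fun x hx => by rw [hR₁, Function.update_of_ne (by omega), hSge _ _ hx])
      rw [hcomp] at k2
      have hstep : g (Fin.cons j (Fin.cons (recVal f g v j) v)) = recVal f g v (j + 1) := rfl
      rw [hstep] at k2
      set R₂ := Function.update R₁ (s + 3) (recVal f g v (j + 1)) with hR₂
      have k3 := does_clear s R₂
      have k4 := does_move (a := s + 3) (b := s) (by omega) (Function.update R₂ s 0)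
      have k5 := does_inc (s + 2) (Function.update (Function.update (Function.update R₂ s 0) s
        (Function.update R₂ s 0 s + Function.update R₂ s 0 (s + 3))) (s + 3) 0)
      refine ((((k1.seq k2).seq k3).seq k4).seq k5).of_eq ?_ ?_
      · funext x
        rcases lt_or_ge x s with hx | hx
        · simp [hR₂, hR₁, hS, show x ≠ s by omega,
            show x ≠ s + 1 by omega, show x ≠ s + 2 by omega, show x ≠ s + 3 by omega]
        rcases lt_or_ge (s + 3) x with hx' | hx'
        · simp [hR₂, hR₁, hS, show x ≠ s by omega,
            show x ≠ s + 1 by omega, show x ≠ s + 2 by omega, show x ≠ s + 3 by omega]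
        obtain rfl | rfl | rfl | rfl : x = s ∨ x = s + 1 ∨ x = s + 2 ∨ x = s + 3 := by omega
        · simp [hR₂, hS]
        · simp [hR₂, hR₁, hS]; omega
        · simp [hR₂, hR₁, hS]
        · simp [hS, hR]
      · have e1 : R₂ s = recVal f g v j := by simp [hR₂, hR₁, hS]
        have e2 : Function.update R₂ s 0 (s + 3) = recVal f g v (j + 1) := by simp [hR₂]
        rw [e1, e2]; omega)
  have e0 : Function.update (Function.update R s (f v)) (s + 1) n = S 0 := by
    have : Function.update (Function.update R s (f v)) (s + 1) n (s + 2) = 0 := by simp [hR]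
    exact (Function.update_eq_self_iff.2 this.symm).symm
  rw [e0] at h2
  have h4 := does_clear (s + 2) (S n)
  refine (((h1.seq h2).seq h3).seq h4).of_eq ?_ ?_
  · funext x
    by_cases h2 : x = s + 2
    · subst h2; simp [hR]
    by_cases h1 : x = s + 1
    · subst h1; simp [hS, hR]
    simp [Function.update_apply, hS, h1, h2]
  · have : S n (s + 2) = n := by simp [hS]
    rw [this]
    have : ∀ i, U (Fin.cons i (Fin.cons (recVal f g v i) v)) +
          3 * recVal f g v i + 4 * recVal f g v (i + 1) + 4 + 2 =
          U (Fin.cons i (Fin.cons (recVal f g v i) v)) +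
          3 * recVal f g v i + 4 * recVal f g v (i + 1) + 6 := fun i => by omega
    simp only [this]
    omega

end CounterProg

/-! ### Polynomially bounded recursion and its cost -/

open CounterProg in
/-- Polynomially bounded recursion: the functions that are obtained from `0`, the successor and the
projections by composition, and by those primitive recursions whose values are bounded by a
polynomial in the arguments. -/
inductive PolyRec : ∀ {k : ℕ}, ((Fin k → ℕ) → ℕ) → Prop
  | zero {k} : PolyRec fun _ : Fin k → ℕ => 0
  | succ {k} {f : (Fin k → ℕ) → ℕ} : PolyRec f → PolyRec fun v => f v + 1
  | proj {k} (i : Fin k) : PolyRec fun v => v i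
  | comp {m k} {f : (Fin m → ℕ) → ℕ} {g : Fin m → (Fin k → ℕ) → ℕ} :
      PolyRec f → (∀ i, PolyRec (g i)) → PolyRec fun v => f fun i => g i v
  | prec {k} {f : (Fin k → ℕ) → ℕ} {g : (Fin (k + 2) → ℕ) → ℕ} (c : ℕ) :
      PolyRec f → PolyRec g → (∀ v n, recVal f g v n ≤ (2 + n + ∑ i, v i) ^ c) →
      PolyRec fun v => recVal f g (Fin.tail v) (v 0)

/-- `f` is bounded by a polynomial in `b`. -/
def GrowsIn {ι : Type} (b f : ι → ℕ) : Prop :=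
  ∃ c, ∀ a, f a ≤ (2 + b a) ^ c

namespace GrowsIn

variable {ι : Type} {b f g : ι → ℕ}

theorem mono (hg : GrowsIn b g) (h : ∀ v, f v ≤ g v) : GrowsIn b f :=
  let ⟨c, hc⟩ := hg
  ⟨c, fun v => (h v).trans (hc v)⟩

/-- The reason for the base `2 + b` in place of `b`: a base of at least `2` lets powers absorb
constants, whatever `b` is. -/
theorem const (n : ℕ) : GrowsIn b fun _ => n :=
  ⟨n, fun v => Nat.lt_two_pow_self.le.trans (Nat.pow_le_pow_left (by omega) n)⟩

theorem of_le (h : ∀ v, f v ≤ b v) : GrowsIn b f :=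
  ⟨1, fun v => by rw [pow_one]; have := h v; omega⟩

theorem add (hf : GrowsIn b f) (hg : GrowsIn b g) : GrowsIn b fun v => f v + g v := by
  obtain ⟨c, hc⟩ := hf
  obtain ⟨d, hd⟩ := hg
  refine ⟨max c d + 1, fun v => ?_⟩
  have h1 := (hc v).trans (Nat.pow_le_pow_right (by omega) (le_max_left c d))
  have h2 := (hd v).trans (Nat.pow_le_pow_right (by omega) (le_max_right c d))
  rw [pow_succ]
  nlinarith [Nat.zero_le (b v)]

theorem mul (hf : GrowsIn b f) (hg : GrowsIn b g) : GrowsIn b fun v => f v * g v := by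
  obtain ⟨c, hc⟩ := hf
  obtain ⟨d, hd⟩ := hg
  exact ⟨c + d, fun v => by rw [pow_add]; exact Nat.mul_le_mul (hc v) (hd v)⟩

theorem pow (hf : GrowsIn b f) (n : ℕ) : GrowsIn b fun v => f v ^ n := by
  obtain ⟨c, hc⟩ := hf
  exact ⟨c * n, fun v => by rw [pow_mul]; exact Nat.pow_le_pow_left (hc v) n⟩

theorem sum {κ : Type} (s : Finset κ) {F : κ → ι → ℕ} (h : ∀ i ∈ s, GrowsIn b (F i)) :
    GrowsIn b fun v => ∑ i ∈ s, F i v := by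
  classical
  induction s using Finset.induction_on with
  | empty => simpa using const 0
  | insert a s ha ih =>
    simp only [Finset.sum_insert ha]
    exact (h a (by simp)).add (ih fun i hi => h i (by simp [hi]))

theorem proj {k : ℕ} (i : Fin k) : GrowsIn (fun v : Fin k → ℕ => ∑ i, v i) fun v => v i :=
  of_le fun v => Finset.single_le_sum (f := v) (fun _ _ => Nat.zero_le _) (Finset.mem_univ i)

theorem comp {m : ℕ} {f : (Fin m → ℕ) → ℕ} {g : Fin m → ι → ℕ}
    (hf : GrowsIn (fun v => ∑ i, v i) f) (hg : ∀ i, GrowsIn b (g i)) :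
    GrowsIn b fun v => f fun i => g i v := by
  obtain ⟨c, hc⟩ := hf
  exact mono (((const 2).add (sum Finset.univ fun i _ => hg i)).pow c) fun v => hc _

/-- A bounded sum, in which all arguments of the summand are bounded. -/
theorem sum_range {m : ℕ} {n : ι → ℕ} {t : (Fin m → ℕ) → ℕ}
    {a : ℕ → ι → Fin m → ℕ} {d : ι → ℕ} (hn : GrowsIn b n)
    (ht : GrowsIn (fun v => ∑ i, v i) t) (hd : GrowsIn b d)
    (h : ∀ v, ∀ i < n v, ∑ j, a i v j ≤ d v) :
    GrowsIn b fun v => ∑ i ∈ Finset.range (n v), t (a i v) := by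
  obtain ⟨c, hc⟩ := ht
  refine mono (hn.mul (((const 2).add hd).pow c)) fun v => ?_
  refine (Finset.sum_le_card_nsmul _ _ ((2 + d v) ^ c) fun i hi => ?_).trans (by simp)
  exact (hc _).trans (Nat.pow_le_pow_left (Nat.add_le_add_left (h v i (Finset.mem_range.1 hi)) 2) c)

end GrowsIn

/-- `f` is bounded by a polynomial in its arguments. -/
abbrev PolyGrowth {k : ℕ} (f : (Fin k → ℕ) → ℕ) : Prop :=
  GrowsIn (fun v => ∑ i, v i) f

open CounterProg

namespace PolyRec

/-- Composition preserves polynomial bounds, and recursion, the only source of faster growth,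
carries its bound as a hypothesis. -/
theorem growth {k : ℕ} {f : (Fin k → ℕ) → ℕ} (hf : PolyRec f) : PolyGrowth f := by
  induction hf with
  | zero => exact .const 0
  | succ _ ih => exact ih.add (.const 1)
  | proj i => exact .proj i
  | comp _ _ ih₁ ih₂ => exact ih₁.comp ih₂
  | prec c _ _ h =>
    refine ⟨c, fun v => (h _ _).trans (Nat.pow_le_pow_left ?_ c)⟩
    dsimp only
    rw [Fin.sum_univ_succ]
    simp only [Fin.tail]
    omega

/-- Functions in the class are computed by counter programs in polynomial time. -/
theorem exists_computes {k : ℕ} {f : (Fin k → ℕ) → ℕ} (hf : PolyRec f) :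
    ∃ T, Computes f T ∧ PolyGrowth T := by
  induction hf with
  | zero => exact ⟨_, computes_zero, .const 0⟩
  | succ _ ih =>
    obtain ⟨T, hT, hp⟩ := ih
    exact ⟨_, hT.succ, hp.add (.const 1)⟩
  | proj i => exact ⟨_, computes_proj i, ((GrowsIn.const 9).mul (.proj i)).add (.const 2)⟩
  | comp hf hg ih₁ ih₂ =>
    obtain ⟨T, hT, hp⟩ := ih₁
    choose U hU hq using ih₂
    refine ⟨_, hT.comp hU, ((((GrowsIn.sum _ fun i _ => hq i).add
      (hp.comp fun i => (hg i).growth)).add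
      (GrowsIn.sum _ fun i _ => ((GrowsIn.const 3).mul (hg i).growth).add (.const 1))).add
      ((GrowsIn.const 4).mul (hf.growth.comp fun i => (hg i).growth))).add (.const 1)⟩
  | @prec k f g c hf hg h ih₁ ih₂ =>
    obtain ⟨T, hT, hp⟩ := ih₁
    obtain ⟨U, hU, hq⟩ := ih₂
    have htail : ∀ i : Fin k, PolyGrowth fun v : Fin (k + 1) → ℕ => Fin.tail v i :=
      fun i => .proj i.succ
    have hsum : ∀ v : Fin (k + 1) → ℕ, ∑ i, v i = v 0 + ∑ i, Fin.tail v i := fun v => by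
      rw [Fin.sum_univ_succ]; rfl
    have hsize : PolyGrowth fun v : Fin (k + 1) → ℕ => (2 + ∑ i, v i) ^ c :=
      ((GrowsIn.const 2).add (.sum _ fun i _ => .proj i)).pow c
    have hrec : ∀ (v : Fin (k + 1) → ℕ), ∀ i ≤ v 0, recVal f g (Fin.tail v) i ≤
        (2 + ∑ i, v i) ^ c := fun v i hi =>
      (h _ _).trans (Nat.pow_le_pow_left (by rw [hsum]; omega) c)
    refine ⟨_, hT.prec hU, ((GrowsIn.add (hp.comp htail) ?_).add
      ((GrowsIn.const 12).mul (.proj 0))).add (.const 4)⟩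
    -- In every round all arguments of `g` are polynomial in the original ones, and so is the cost
    -- of the round; the number of rounds is itself an argument.
    have h1 := GrowsIn.sum_range (n := fun v : Fin (k + 1) → ℕ => v 0)
      (a := fun i v => Fin.cons i (Fin.cons (recVal f g (Fin.tail v) i) (Fin.tail v)))
      (d := fun v => (∑ i, v i) + (2 + ∑ i, v i) ^ c) (.proj 0) hq
      ((GrowsIn.sum _ fun i _ => .proj i).add hsize) (fun v i hi => by
        rw [Fin.sum_univ_succ, Fin.sum_univ_succ]
        simp only [Fin.cons_zero, Fin.cons_succ]
        have := hrec v i hi.le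
        have := hsum v
        omega)
    refine GrowsIn.mono (h1.add ((GrowsIn.proj 0).mul
      (((GrowsIn.const 7).mul hsize).add (.const 6)))) fun v => ?_
    have e : ∀ i, U (Fin.cons i (Fin.cons (recVal f g (Fin.tail v) i) (Fin.tail v))) +
        3 * recVal f g (Fin.tail v) i + 4 * recVal f g (Fin.tail v) (i + 1) + 6 =
        U (Fin.cons i (Fin.cons (recVal f g (Fin.tail v) i) (Fin.tail v))) +
        (3 * recVal f g (Fin.tail v) i + 4 * recVal f g (Fin.tail v) (i + 1) + 6) :=
      fun i => by omega
    simp only [e]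
    rw [Finset.sum_add_distrib]
    refine Nat.add_le_add_left ?_ _
    refine (Finset.sum_le_card_nsmul _ _ (7 * (2 + ∑ i, v i) ^ c + 6) fun i hi => ?_).trans
      (by simp)
    have hi' := Finset.mem_range.1 hi
    have := hrec v i hi'.le
    have := hrec v (i + 1) hi'
    omega

/-- Forgetting the bounds on the recursions leaves primitive recursive functions; this is the way to
recursive enumerability. -/
theorem primrec {k : ℕ} {f : (Fin k → ℕ) → ℕ} (hf : PolyRec f) :
    Nat.Primrec' fun v : List.Vector ℕ k => f v.get := by
  induction hf with
  | zero => exact .const 0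
  | succ _ ih => exact Nat.Primrec'.succ.comp₁ _ ih
  | proj i => exact .get i
  | comp _ _ ih₁ ih₂ =>
    refine (ih₁.comp _ ih₂).of_eq fun v => ?_
    congr 1
    funext i
    rw [List.Vector.get_ofFn]
  | @prec k f g c _ _ _ ih₁ ih₂ =>
    refine (ih₁.prec ih₂).of_eq fun v => ?_
    have h0 : v.get 0 = v.head := List.Vector.get_zero v
    have ht : Fin.tail v.get = v.tail.get := by
      funext i; exact (List.Vector.get_tail_succ v i).symm
    show _ = recVal f g (Fin.tail v.get) (v.get 0)
    rw [h0, ht]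
    generalize v.head = n
    induction n with
    | zero => rfl
    | succ n ih =>
      show g _ = g _
      congr 1
      rw [ih]
      funext i
      refine Fin.cases ?_ (fun i => Fin.cases ?_ (fun i => ?_) i) i
      · rfl
      · rfl
      · rfl

end PolyRec

/-! ### Closure properties of polynomially bounded recursion -/

open CounterProg

namespace PolyRec

variable {k : ℕ} {f g n W : (Fin k → ℕ) → ℕ}

theorem const (m : ℕ) : PolyRec fun _ : Fin k → ℕ => m := by
  induction m with
  | zero => exact zero
  | succ m ih => exact ih.succ

/-- Weakening: add an unused first argument. -/
theorem tail (hf : PolyRec f) : PolyRec fun w : Fin (k + 1) → ℕ => f (Fin.tail w) :=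
  hf.comp fun i => proj i.succ

/-- A convenient form of `prec`: the recursion runs up to an arbitrary term `n v`, the step sees `v`
as parameters, and any bound of polynomial growth is accepted. -/
theorem natRec {base : (Fin k → ℕ) → ℕ} {step : (Fin k → ℕ) → ℕ → ℕ → ℕ}
    {B : (Fin (k + 1) → ℕ) → ℕ} (hn : PolyRec n) (hbase : PolyRec base)
    (hstep : PolyRec fun w : Fin (k + 2) → ℕ => step (Fin.tail (Fin.tail w)) (w 0) (w 1))
    (hB : PolyGrowth B) (h : ∀ v m, Nat.rec (base v) (step v) m ≤ B (Fin.cons m v)) :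
    PolyRec fun v => Nat.rec (motive := fun _ => ℕ) (base v) (step v) (n v) := by
  obtain ⟨c, hc⟩ := hB
  have h1 := prec c hbase hstep fun v m => (h v m).trans ((hc _).trans_eq (by
    dsimp only; rw [Fin.sum_univ_succ]; simp [Nat.add_assoc]))
  exact h1.comp (g := fun i v => Fin.cases (n v) v i) fun i =>
    Fin.cases hn (fun i => proj i) i

theorem add (hf : PolyRec f) (hg : PolyRec g) : PolyRec fun v => f v + g v := by
  have e : ∀ v m, Nat.rec (motive := fun _ => ℕ) (f v) (fun _ a => a + 1) m = f v + m :=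
    fun v m => by induction m with
      | zero => rfl
      | succ m ih => exact congrArg (· + 1) ih
  have := hg.natRec (step := fun _ _ a => a + 1) hf (proj 1).succ
    (hf.tail.growth.add (.proj 0)) (fun v m => (e v m).le)
  simpa only [e] using this

theorem mul (hf : PolyRec f) (hg : PolyRec g) : PolyRec fun v => f v * g v := by
  have e : ∀ v m, Nat.rec (motive := fun _ => ℕ) 0 (fun _ a => a + f v) m = f v * m :=
    fun v m => by induction m with
      | zero => rfl
      | succ m ih => exact congrArg (· + f v) ih
  have := hg.natRec (step := fun v _ a => a + f v) zero ((proj 1).add hf.tail.tail)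
    (hf.tail.growth.mul (.proj 0)) (fun v m => (e v m).le)
  simpa only [e] using this

theorem pred (hf : PolyRec f) : PolyRec fun v => f v - 1 := by
  have e : ∀ m, Nat.rec (motive := fun _ => ℕ) 0 (fun i _ => i) m = m - 1 :=
    fun m => by cases m <;> rfl
  have := hf.natRec (step := fun _ i _ => i) zero (proj 0) (.proj 0)
    (fun v m => (e m).le.trans (Nat.sub_le m 1))
  simpa only [e] using this

theorem sub (hf : PolyRec f) (hg : PolyRec g) : PolyRec fun v => f v - g v := by
  have e : ∀ v m, Nat.rec (motive := fun _ => ℕ) (f v) (fun _ a => a - 1) m = f v - m :=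
    fun v m => by induction m with
      | zero => rfl
      | succ m ih => exact congrArg (· - 1) ih
  have := hg.natRec (step := fun _ _ a => a - 1) hf (proj 1).pred
    hf.tail.growth (fun v m => (e v m).le.trans (Nat.sub_le _ m))
  simpa only [e] using this

theorem min (hf : PolyRec f) (hg : PolyRec g) : PolyRec fun v => Min.min (f v) (g v) := by
  have e : ∀ v, Min.min (f v) (g v) = f v - (f v - g v) := fun v => by omega
  simpa only [e] using hf.sub (hf.sub hg)

theorem sum {t : (Fin k → ℕ) → ℕ → ℕ} (hn : PolyRec n)
    (ht : PolyRec fun w : Fin (k + 1) → ℕ => t (Fin.tail w) (w 0)) :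
    PolyRec fun v => ∑ i ∈ Finset.range (n v), t v i := by
  have e : ∀ v m, Nat.rec (motive := fun _ => ℕ) 0 (fun i a => a + t v i) m =
      ∑ i ∈ Finset.range m, t v i := fun v m => by
    induction m with
    | zero => rfl
    | succ m ih => rw [Finset.sum_range_succ, ← ih]
  have hB := GrowsIn.sum_range (n := fun v : Fin (k + 1) → ℕ => v 0)
    (a := fun i v => Fin.cons i (Fin.tail v)) (d := fun v => ∑ i, v i) (.proj 0) ht.growth
    (.sum _ fun i _ => .proj i) (fun v i hi => by
      rw [Fin.sum_univ_succ, Fin.sum_univ_succ (f := v)]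
      simp only [Fin.cons_zero, Fin.cons_succ, Fin.tail]
      omega)
  have := hn.natRec (step := fun v i a => a + t v i) zero ((proj 1).add
    (ht.comp (g := fun i w => Fin.cases (w 0) (fun i => w i.succ.succ) i)
      fun i => Fin.cases (proj 0) (fun i => proj i.succ.succ) i)) hB
    (fun v m => by rw [e]; exact le_of_eq (by simp))
  simpa only [e] using this

/-- Powers, cut off at `W`. -/
theorem powMin (hW : PolyRec W) (hf : PolyRec f) (hg : PolyRec g) :
    PolyRec fun v => Min.min (W v) (f v ^ g v) := by
  -- Cutting off after each multiplication is the same as cutting off the power: once `w` is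
  -- reached, a positive factor cannot lead below it. The factor `0` is treated apart.
  have e : ∀ w b m : ℕ, Nat.rec (motive := fun _ => ℕ) (Min.min w 1) (fun _ a => Min.min w (a * b)) m =
      Min.min w (b ^ m) := fun w b m => by
    induction m with
    | zero => simp
    | succ m ih =>
      simp only [ih, pow_succ]
      rcases le_total (b ^ m) w with h | h
      · rw [min_eq_right h]
      · rw [min_eq_left h]
        rcases Nat.eq_zero_or_pos b with rfl | hb
        · rcases m with _ | m
          · simp
          · simp
        · rw [min_eq_left (Nat.le_mul_of_pos_right w hb),
            min_eq_left (h.trans (Nat.le_mul_of_pos_right _ hb))]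
  have := hg.natRec (step := fun v _ a => Min.min (W v) (a * f v)) (hW.min (const 1))
    (hW.tail.tail.min ((proj 1).mul hf.tail.tail)) hW.tail.growth
    (fun v m => by rw [e]; exact min_le_left _ _)
  simpa only [e] using this

/-- Iteration of a function that is cut off at `W`. -/
theorem iterate {t : (Fin k → ℕ) → ℕ → ℕ} (hn : PolyRec n) (hf : PolyRec f) (hW : PolyRec W)
    (ht : PolyRec fun w : Fin (k + 1) → ℕ => t (Fin.tail w) (w 0)) :
    PolyRec fun v => (fun a => Min.min (W v) (t v a))^[n v] (f v) := by
  have e : ∀ v m, Nat.rec (motive := fun _ => ℕ) (f v) (fun _ a => Min.min (W v) (t v a)) m =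
      (fun a => Min.min (W v) (t v a))^[m] (f v) := fun v m => by
    induction m with
    | zero => rfl
    | succ m ih => simp only [ih, Function.iterate_succ_apply']
  have := hn.natRec (step := fun v _ a => Min.min (W v) (t v a)) hf (hW.tail.tail.min
    (ht.comp (g := fun i w => Fin.cases (w 1) (fun i => w i.succ.succ) i)
      fun i => Fin.cases (proj 1) (fun i => proj i.succ.succ) i)) (hf.tail.growth.add hW.tail.growth)
    (fun v m => by
      cases m with
      | zero => exact Nat.le_add_right _ _
      | succ m => exact (min_le_left _ _).trans (Nat.le_add_left _ _))
  simpa only [e] using this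

end PolyRec

/-! ### Decision by polynomially bounded recursion -/

open Classical in
/-- Predicates whose characteristic function is computed by polynomially bounded recursion. -/
def PolyDec {k : ℕ} (P : (Fin k → ℕ) → Prop) : Prop :=
  PolyRec fun v => if P v then 1 else 0

namespace PolyDec

variable {k : ℕ} {f g n : (Fin k → ℕ) → ℕ} {P Q : (Fin k → ℕ) → Prop}

theorem intro (hf : PolyRec f) (h1 : ∀ v, P v → f v = 1) (h0 : ∀ v, ¬ P v → f v = 0) :
    PolyDec P := by
  have : f = fun v => @ite _ (P v) (Classical.propDecidable _) 1 0 := by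
    funext v
    split_ifs with h
    · exact h1 v h
    · exact h0 v h
  rw [this] at hf
  exact hf

theorem boole [∀ v, Decidable (P v)] (hP : PolyDec P) :
    PolyRec fun v => if P v then 1 else 0 := by
  unfold PolyDec at hP
  convert hP

theorem of_iff (hP : PolyDec P) (h : ∀ v, Q v ↔ P v) : PolyDec Q := by
  have : Q = P := funext fun v => propext (h v)
  rwa [this]

theorem le (hf : PolyRec f) (hg : PolyRec g) : PolyDec fun v => f v ≤ g v :=
  intro ((PolyRec.const 1).sub (hf.sub hg)) (fun v h => by omega) (fun v h => by omega)

theorem lt (hf : PolyRec f) (hg : PolyRec g) : PolyDec fun v => f v < g v :=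
  le hf.succ hg

theorem not (hP : PolyDec P) : PolyDec fun v => ¬ P v := by
  classical
  exact intro ((PolyRec.const 1).sub hP.boole) (fun v h => by rw [if_neg h])
    (fun v h => by rw [if_pos (not_not.1 h)])

theorem and (hP : PolyDec P) (hQ : PolyDec Q) : PolyDec fun v => P v ∧ Q v := by
  classical
  refine intro (hP.boole.mul hQ.boole) (fun v h => by simp [h]) (fun v h => ?_)
  by_cases h1 : P v <;> simp_all

theorem imp (hP : PolyDec P) (hQ : PolyDec Q) : PolyDec fun v => P v → Q v :=
  (hP.and hQ.not).not.of_iff fun v => by tauto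

theorem eq (hf : PolyRec f) (hg : PolyRec g) : PolyDec fun v => f v = g v :=
  ((le hf hg).and (le hg hf)).of_iff fun v => by omega

/-- A bounded search is a bounded sum of characteristic values being positive. This puts exhaustive
search at disposal. -/
theorem exists_lt {P : (Fin k → ℕ) → ℕ → Prop} (hn : PolyRec n)
    (hP : PolyDec fun w : Fin (k + 1) → ℕ => P (Fin.tail w) (w 0)) :
    PolyDec fun v => ∃ i < n v, P v i := by
  classical
  refine (lt PolyRec.zero (PolyRec.sum (t := fun v i => if P v i then 1 else 0) hn hP.boole)).of_iff
    fun v => ?_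
  rw [Finset.sum_pos_iff]
  simp only [Finset.mem_range]
  refine exists_congr fun i => and_congr_right fun _ => ?_
  split_ifs with h <;> simp [h]

theorem forall_lt {P : (Fin k → ℕ) → ℕ → Prop} (hn : PolyRec n)
    (hP : PolyDec fun w : Fin (k + 1) → ℕ => P (Fin.tail w) (w 0)) :
    PolyDec fun v => ∀ i < n v, P v i :=
  (exists_lt (P := fun v i => ¬ P v i) hn hP.not).not.of_iff fun v => by push Not; rfl

end PolyDec

namespace PolyRec

variable {k : ℕ} {f g n W : (Fin k → ℕ) → ℕ}

theorem ite {P : (Fin k → ℕ) → Prop} [∀ v, Decidable (P v)] (hP : PolyDec P) (hf : PolyRec f) (hg : PolyRec g) :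
    PolyRec fun v => if P v then f v else g v := by
  have e : ∀ v, (if P v then f v else g v) =
      (if P v then 1 else 0) * f v + (1 - if P v then 1 else 0) * g v := fun v => by
    split_ifs <;> simp
  simpa only [e] using (hP.boole.mul hf).add (((const 1).sub hP.boole).mul hg)

/-- The quotient counts the positive multiples of the divisor up to `f v`. The condition `0 < b`
reproduces the convention that division by zero gives `0`. -/
theorem div (hf : PolyRec f) (hg : PolyRec g) : PolyRec fun v => f v / g v := by
  have e : ∀ a b : ℕ, a / b = ∑ i ∈ Finset.range a, if (i + 1) * b ≤ a ∧ 0 < b then 1 else 0 :=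
    fun a b => by
      rw [Finset.sum_boole]
      rcases Nat.eq_zero_or_pos b with rfl | hb
      · simp
      have : (Finset.range a).filter (fun i => (i + 1) * b ≤ a ∧ 0 < b) =
          Finset.range (a / b) := by
        ext i
        simp only [Finset.mem_filter, Finset.mem_range, hb, and_true,
          ← Nat.le_div_iff_mul_le hb]
        have := Nat.div_le_self a b
        omega
      rw [this, Finset.card_range, Nat.cast_id]
  simp only [e (f _) (g _)]
  exact hf.sum (t := fun v i => if (i + 1) * g v ≤ f v ∧ 0 < g v then 1 else 0)
    (((PolyDec.le ((proj 0).succ.mul hg.tail) hf.tail).and (PolyDec.lt zero hg.tail))).boole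

theorem mod (hf : PolyRec f) (hg : PolyRec g) : PolyRec fun v => f v % g v := by
  have e : ∀ a b : ℕ, a % b = a - b * (a / b) := fun a b => Nat.mod_eq_sub_mul_div
  simp only [e]
  exact hf.sub (hg.mul (hf.div hg))

end PolyRec

/-! ### Arithmetical definition of the diagonal language -/

namespace Diag

/-- Powers, cut off at `W`. -/
def pw (W b i : ℕ) : ℕ := min W (b ^ i)

/-- Gödel's `β` function. -/
def lookup (e₁ e₂ i : ℕ) : ℕ := e₁ % ((i + 1) * e₂ + 1)

/-- The digit number `i` of `c` to the base `B`. -/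
def digit (W B c i : ℕ) : ℕ := c / pw W B i % B

/-- The residues modulo `b` of the first `d` digits to the base `B`. -/
def residueKey (W B b d c : ℕ) : ℕ := ∑ i ∈ Finset.range d, digit W B c i % b * pw W b i

/-- One step of the machine with the code `e₁, e₂`. Its configurations are numbers, whose digits
to the base `B` are mapped by affine functions with integer division, chosen by their residues. -/
def machStep (W B e₁ e₂ c : ℕ) : ℕ :=
  -- Layout of the table: entries `0`, `1`, `2` are the base of the tape numbers, the number `d` of
  -- digits and the start state. For the residue key `κ` and the digit `i`, the entries `3 * (κ * d
  -- + i) + 3`, `+ 4` and `+ 5` are factor, divisor and summand.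
  ∑ i ∈ Finset.range (lookup e₁ e₂ 1),
    (lookup e₁ e₂ (3 * (residueKey W B (lookup e₁ e₂ 0) (lookup e₁ e₂ 1) c * lookup e₁ e₂ 1 + i) + 3) *
      (digit W B c i / lookup e₁ e₂
        (3 * (residueKey W B (lookup e₁ e₂ 0) (lookup e₁ e₂ 1) c * lookup e₁ e₂ 1 + i) + 4)) +
      lookup e₁ e₂
        (3 * (residueKey W B (lookup e₁ e₂ 0) (lookup e₁ e₂ 1) c * lookup e₁ e₂ 1 + i) + 5)) *
      pw W B i

/-- `T` steps of the machine with the code `e₁, e₂`. -/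
def machRun (W B e₁ e₂ T c : ℕ) : ℕ := (fun c => min W (machStep W B e₁ e₂ c))^[T] c

/-- The number to the base `b` that represents a tape with the bit string of length `n` and
value `x`. -/
def tapeNum (W b n x : ℕ) : ℕ :=
  -- The number of the blank is `0`, so a bit `c` has the number `1 + c`. The first bit is under the
  -- head: it is the most significant digit of `x`, but the least significant one to the base `b`,
  -- whence the exponent `n - 1 - i`.
  ∑ i ∈ Finset.range n, (1 + x / pw W 2 i % 2) * pw W b (n - 1 - i)

/-- The final configuration of the sampler. -/
def sampEnd (n x N B W e₁ e₂ r s : ℕ) : ℕ :=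
  -- Digit `0` is the state, and the digits `2 * j + 1` and `2 * j + 2` are the left and right
  -- halves of tape `j`. The left halves are blank at the start, so inputs occupy the even digits
  -- from `2` on.
  machRun W B e₁ e₂ N (lookup e₁ e₂ 2 + tapeNum W (lookup e₁ e₂ 0) n x * pw W B 2 +
    tapeNum W (lookup e₁ e₂ 0) r s * pw W B 4)

/-- The final configuration of the decider. -/
def decEnd (n x N B W e₁ e₂ q a u v α β : ℕ) : ℕ :=
  machRun W B e₁ e₂ N (lookup e₁ e₂ 2 + tapeNum W (lookup e₁ e₂ 0) n x * pw W B 2 +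
    tapeNum W (lookup e₁ e₂ 0) q u * pw W B 4 + tapeNum W (lookup e₁ e₂ 0) q v * pw W B 6 +
    tapeNum W (lookup e₁ e₂ 0) a α * pw W B 8 + tapeNum W (lookup e₁ e₂ 0) a β * pw W B 10)

/-- The number of seeds for which the questions are `u` and `v`. -/
def seedCount (n x N B W e₁ e₂ r q u v : ℕ) : ℕ :=
  ∑ s ∈ Finset.range (pw W 2 r),
    if digit W B (sampEnd n x N B W e₁ e₂ r s) 6 = tapeNum W (lookup e₁ e₂ 0) q u ∧
      digit W B (sampEnd n x N B W e₁ e₂ r s) 8 = tapeNum W (lookup e₁ e₂ 0) q v then 1 else 0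

/-- The probability of the questions `u` and `v`, rounded up to a multiple of `1 / (2 ^ s - 1)`, if
the answers `α` and `β` lose, and `0` otherwise. -/
def loss (n x N B W e₁ e₂ e₃ e₄ r q a s u v α β : ℕ) : ℕ :=
  if digit W B (decEnd n x N B W e₃ e₄ q a u v α β) 0 % 2 = 1 then 0
  -- Rounding up keeps positive probabilities positive, and the factor `2 ^ s - 1` makes the result
  -- an `s`-bit number.
  else (seedCount n x N B W e₁ e₂ r q u v * (pw W 2 s - 1) + (pw W 2 r - 1)) / pw W 2 r

/-- The games of the instances `z` and `z'` are indistinguishable. -/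
def Same (n N B W e₁ e₂ e₃ e₄ r q a s z z' : ℕ) : Prop :=
  ∀ u < pw W 2 q, ∀ v < pw W 2 q, ∀ α < pw W 2 a, ∀ β < pw W 2 a,
    loss n z N B W e₁ e₂ e₃ e₄ r q a s u v α β = loss n z' N B W e₁ e₂ e₃ e₄ r q a s u v α β

/-- The set of strings of length `n` that is represented by the binary digits of `l` separates two
indistinguishable instances, for each pair of machines and all parameters that are small enough. -/
def Good (n N B W l : ℕ) : Prop :=
  ∀ e₁ < N, ∀ e₂ < N, ∀ e₃ < N, ∀ e₄ < N, ∀ r < N, ∀ q < N, ∀ a < N, ∀ s < N,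
    -- The table of losses has at most `4 ^ (q + a)` entries of `s` bits. With fewer than `n` bits
    -- altogether there are at most half as many tables as instances.
    s * pw W 4 (q + a) < n →
      ∃ z < N, ∃ z' < N, l / pw W 2 z % 2 = 1 ∧ l / pw W 2 z' % 2 = 0 ∧
        Same n N B W e₁ e₂ e₃ e₄ r q a s z z'

/-- The bit string of length `n` and value `x` belongs to the diagonal language. -/
def InLang (n x N B W : ℕ) : Prop :=
  -- Minimality singles out one set, so that the language is well defined and `l` can be found by
  -- search.
  ∃ l < B, Good n N B W l ∧ (∀ l' < l, ¬ Good n N B W l') ∧ l / pw W 2 x % 2 = 1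

section

variable {k : ℕ} {n x N B W e₁ e₂ e₃ e₄ r q a s u v α β b c d i T f g : (Fin k → ℕ) → ℕ}

theorem polyRec_pw (hW : PolyRec W) (hf : PolyRec f) (hg : PolyRec g) :
    PolyRec fun v => pw (W v) (f v) (g v) := hW.powMin hf hg

theorem polyRec_lookup (h₁ : PolyRec e₁) (h₂ : PolyRec e₂) (hf : PolyRec f) :
    PolyRec fun v => lookup (e₁ v) (e₂ v) (f v) := h₁.mod ((hf.succ.mul h₂).succ)

theorem polyRec_digit (hW : PolyRec W) (hB : PolyRec B) (hc : PolyRec c) (hi : PolyRec i) :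
    PolyRec fun v => digit (W v) (B v) (c v) (i v) :=
  (hc.div (polyRec_pw hW hB hi)).mod hB

theorem polyRec_residueKey (hW : PolyRec W) (hB : PolyRec B) (hb : PolyRec b) (hd : PolyRec d)
    (hc : PolyRec c) : PolyRec fun v => residueKey (W v) (B v) (b v) (d v) (c v) :=
  hd.sum (((polyRec_digit hW.tail hB.tail hc.tail (.proj 0)).mod hb.tail).mul
    (polyRec_pw hW.tail hb.tail (.proj 0)))

theorem polyRec_machStep (hW : PolyRec W) (hB : PolyRec B) (h₁ : PolyRec e₁) (h₂ : PolyRec e₂)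
    (hc : PolyRec c) : PolyRec fun v => machStep (W v) (B v) (e₁ v) (e₂ v) (c v) := by
  have hl : ∀ m, PolyRec fun v => lookup (e₁ v) (e₂ v) m := fun m =>
    polyRec_lookup h₁ h₂ (.const m)
  have hk := ((PolyRec.const 3).mul (((polyRec_residueKey hW hB (hl 0) (hl 1) hc).tail.mul
    (hl 1).tail).add (.proj 0)))
  exact (hl 1).sum (((((polyRec_lookup h₁.tail h₂.tail (hk.add (.const 3)))).mul
    ((polyRec_digit hW.tail hB.tail hc.tail (.proj 0)).div
      (polyRec_lookup h₁.tail h₂.tail (hk.add (.const 4))))).add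
    (polyRec_lookup h₁.tail h₂.tail (hk.add (.const 5)))).mul
    (polyRec_pw hW.tail hB.tail (.proj 0)))

theorem polyRec_machRun (hW : PolyRec W) (hB : PolyRec B) (h₁ : PolyRec e₁) (h₂ : PolyRec e₂)
    (hT : PolyRec T) (hc : PolyRec c) :
    PolyRec fun v => machRun (W v) (B v) (e₁ v) (e₂ v) (T v) (c v) :=
  hT.iterate hc hW (polyRec_machStep hW.tail hB.tail h₁.tail h₂.tail (.proj 0))

theorem polyRec_tapeNum (hW : PolyRec W) (hb : PolyRec b) (hn : PolyRec n) (hx : PolyRec x) :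
    PolyRec fun v => tapeNum (W v) (b v) (n v) (x v) :=
  hn.sum (((PolyRec.const 1).add ((hx.tail.div (polyRec_pw hW.tail (.const 2) (.proj 0))).mod
    (.const 2))).mul (polyRec_pw hW.tail hb.tail (hn.tail.pred.sub (.proj 0))))

theorem polyRec_sampEnd (hn : PolyRec n) (hx : PolyRec x) (hN : PolyRec N) (hB : PolyRec B)
    (hW : PolyRec W) (h₁ : PolyRec e₁) (h₂ : PolyRec e₂) (hr : PolyRec r) (hs : PolyRec s) :
    PolyRec fun w => sampEnd (n w) (x w) (N w) (B w) (W w) (e₁ w) (e₂ w) (r w) (s w) :=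
  have hl := fun m => polyRec_lookup h₁ h₂ (.const m)
  have hB' := fun m => polyRec_pw hW hB (.const m)
  polyRec_machRun hW hB h₁ h₂ hN (((hl 2).add ((polyRec_tapeNum hW (hl 0) hn hx).mul (hB' 2))).add
    ((polyRec_tapeNum hW (hl 0) hr hs).mul (hB' 4)))

theorem polyRec_decEnd (hn : PolyRec n) (hx : PolyRec x) (hN : PolyRec N) (hB : PolyRec B)
    (hW : PolyRec W) (h₁ : PolyRec e₁) (h₂ : PolyRec e₂) (hq : PolyRec q) (ha : PolyRec a)
    (hu : PolyRec u) (hv : PolyRec v) (hα : PolyRec α) (hβ : PolyRec β) :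
    PolyRec fun w => decEnd (n w) (x w) (N w) (B w) (W w) (e₁ w) (e₂ w) (q w) (a w) (u w) (v w)
      (α w) (β w) :=
  have hl := fun m => polyRec_lookup h₁ h₂ (.const m)
  have hB' := fun m => polyRec_pw hW hB (.const m)
  polyRec_machRun hW hB h₁ h₂ hN
    ((((((hl 2).add ((polyRec_tapeNum hW (hl 0) hn hx).mul (hB' 2))).add
    ((polyRec_tapeNum hW (hl 0) hq hu).mul (hB' 4))).add
    ((polyRec_tapeNum hW (hl 0) hq hv).mul (hB' 6))).add
    ((polyRec_tapeNum hW (hl 0) ha hα).mul (hB' 8))).add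
    ((polyRec_tapeNum hW (hl 0) ha hβ).mul (hB' 10)))

theorem polyRec_seedCount (hn : PolyRec n) (hx : PolyRec x) (hN : PolyRec N) (hB : PolyRec B)
    (hW : PolyRec W) (h₁ : PolyRec e₁) (h₂ : PolyRec e₂) (hr : PolyRec r) (hq : PolyRec q)
    (hu : PolyRec u) (hv : PolyRec v) :
    PolyRec fun w => seedCount (n w) (x w) (N w) (B w) (W w) (e₁ w) (e₂ w) (r w) (q w) (u w)
      (v w) := by
  have hend := polyRec_sampEnd hn.tail hx.tail hN.tail hB.tail hW.tail h₁.tail h₂.tail hr.tail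
    (.proj 0)
  have hl := polyRec_lookup h₁ h₂ (.const 0)
  exact (polyRec_pw hW (.const 2) hr).sum
    (((PolyDec.eq (polyRec_digit hW.tail hB.tail hend (.const 6))
      (polyRec_tapeNum hW.tail hl.tail hq.tail hu.tail)).and
    (PolyDec.eq (polyRec_digit hW.tail hB.tail hend (.const 8))
      (polyRec_tapeNum hW.tail hl.tail hq.tail hv.tail))).boole)

theorem polyRec_loss (hn : PolyRec n) (hx : PolyRec x) (hN : PolyRec N) (hB : PolyRec B)
    (hW : PolyRec W) (h₁ : PolyRec e₁) (h₂ : PolyRec e₂) (h₃ : PolyRec e₃) (h₄ : PolyRec e₄)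
    (hr : PolyRec r) (hq : PolyRec q) (ha : PolyRec a) (hs : PolyRec s)
    (hu : PolyRec u) (hv : PolyRec v) (hα : PolyRec α) (hβ : PolyRec β) :
    PolyRec fun w => loss (n w) (x w) (N w) (B w) (W w) (e₁ w) (e₂ w) (e₃ w) (e₄ w) (r w) (q w)
      (a w) (s w) (u w) (v w) (α w) (β w) :=
  have hpw := fun {f : (Fin k → ℕ) → ℕ} (hf : PolyRec f) => polyRec_pw hW (.const 2) hf
  PolyRec.ite (PolyDec.eq ((polyRec_digit hW hB
    (polyRec_decEnd hn hx hN hB hW h₃ h₄ hq ha hu hv hα hβ) (.const 0)).mod (.const 2)) (.const 1))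
    (.const 0) ((((polyRec_seedCount hn hx hN hB hW h₁ h₂ hr hq hu hv).mul
      (hpw hs).pred).add (hpw hr).pred).div (hpw hr))

end

/-- Every quantifier in `Good` and `Same` is bounded by `N` or by a power cut off at `W`, hence is a
bounded search. -/
theorem polyDec_good {k : ℕ} {n N B W l : (Fin k → ℕ) → ℕ} (hn : PolyRec n) (hN : PolyRec N)
    (hB : PolyRec B) (hW : PolyRec W) (hl : PolyRec l) :
    PolyDec fun v => Good (n v) (N v) (B v) (W v) (l v) := by
  unfold Good
  refine .forall_lt hN (.forall_lt hN.tail (.forall_lt hN.tail.tail (.forall_lt hN.tail.tail.tail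
    (.forall_lt hN.tail.tail.tail.tail (.forall_lt hN.tail.tail.tail.tail.tail
    (.forall_lt hN.tail.tail.tail.tail.tail.tail (.forall_lt hN.tail.tail.tail.tail.tail.tail.tail
    ?_)))))))
  replace hn := hn.tail.tail.tail.tail.tail.tail.tail.tail
  replace hN := hN.tail.tail.tail.tail.tail.tail.tail.tail
  replace hB := hB.tail.tail.tail.tail.tail.tail.tail.tail
  replace hW := hW.tail.tail.tail.tail.tail.tail.tail.tail
  replace hl := hl.tail.tail.tail.tail.tail.tail.tail.tail
  -- Variables are numbered from the innermost quantifier outwards: `0, 1, 2, 3` are `s, a, q, r`,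
  -- and `4` to `7` are the codes, `e₄` first.
  refine .imp (.lt (.mul (.proj 0) (polyRec_pw hW (.const 4) (.add (.proj 2) (.proj 1)))) hn)
    (.exists_lt hN (.exists_lt hN.tail (.and (.eq (.mod (.div hl.tail.tail
      (polyRec_pw hW.tail.tail (.const 2) (.proj 1))) (.const 2)) (.const 1))
      (.and (.eq (.mod (.div hl.tail.tail
      (polyRec_pw hW.tail.tail (.const 2) (.proj 0))) (.const 2)) (.const 0)) ?_))))
  unfold Same
  have hp : ∀ {m : ℕ} (i : Fin m), PolyRec fun w : Fin m → ℕ => w i := PolyRec.proj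
  replace hn := hn.tail.tail.tail.tail.tail.tail
  replace hN := hN.tail.tail.tail.tail.tail.tail
  replace hB := hB.tail.tail.tail.tail.tail.tail
  refine .forall_lt (polyRec_pw hW.tail.tail (.const 2) (hp 4))
    (.forall_lt (polyRec_pw hW.tail.tail.tail (.const 2) (hp 5))
    (.forall_lt (polyRec_pw hW.tail.tail.tail.tail (.const 2) (hp 5))
    (.forall_lt (polyRec_pw hW.tail.tail.tail.tail.tail (.const 2) (hp 6)) ?_)))
  replace hW := hW.tail.tail.tail.tail.tail.tail
  exact .eq
    (polyRec_loss hn (hp 5) hN hB hW (hp 13) (hp 12) (hp 11) (hp 10) (hp 9) (hp 8) (hp 7) (hp 6)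
      (hp 3) (hp 2) (hp 1) (hp 0))
    (polyRec_loss hn (hp 4) hN hB hW (hp 13) (hp 12) (hp 11) (hp 10) (hp 9) (hp 8) (hp 7) (hp 6)
      (hp 3) (hp 2) (hp 1) (hp 0))

theorem polyDec_inLang : PolyDec fun v : Fin 5 → ℕ => InLang (v 0) (v 1) (v 2) (v 3) (v 4) := by
  unfold InLang
  have hp : ∀ {m : ℕ} (i : Fin m), PolyRec fun w : Fin m → ℕ => w i := PolyRec.proj
  refine .exists_lt (hp 3) (.and (polyDec_good (hp 1) (hp 3) (hp 4) (hp 5) (hp 0)) (.and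
    (.forall_lt (hp 0) (.not (polyDec_good (hp 2) (hp 4) (hp 5) (hp 6) (hp 0)))) ?_))
  exact .eq (.mod (.div (hp 0) (polyRec_pw (hp 5) (.const 2) (hp 2))) (.const 2)) (.const 1)

end Diag

open CounterProg

/-! ### From polynomially bounded recursion to doubly exponential time -/

/-- Exponentials grow too fast for `PolyRec`, but doubling computes `2 ^ n` at a cost polynomial in
the result. This is the only ingredient beyond bounded recursion that is needed for doubly
exponential arguments. -/
theorem computes_two_pow : ∃ T : (Fin 1 → ℕ) → ℕ, Computes (fun v => 2 ^ v 0) T ∧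
    GrowsIn (fun v => 2 ^ v 0) T := by
  have hg : PolyRec fun w : Fin 2 → ℕ => w 1 + w 1 := (PolyRec.proj 1).add (.proj 1)
  obtain ⟨T, hT, -⟩ := (PolyRec.const (k := 0) 1).exists_computes
  obtain ⟨U, hU, hUp⟩ := hg.exists_computes
  have e : ∀ v n, recVal (fun _ : Fin 0 → ℕ => 1) (fun w : Fin 2 → ℕ => w 1 + w 1) v n = 2 ^ n := by
    intro v n
    induction n with
    | zero => rfl
    | succ n ih =>
      refine Eq.trans (b := 2 ^ n + 2 ^ n) ?_ (by rw [pow_succ]; omega)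
      exact congrArg (fun m => m + m) ih
  have h := hT.prec hU
  simp only [e] at h
  refine ⟨_, h, ?_⟩
  have hself : GrowsIn (fun v : Fin 1 → ℕ => 2 ^ v 0) fun v => 2 ^ v 0 := .of_le fun _ => le_rfl
  have hlin : GrowsIn (fun v : Fin 1 → ℕ => 2 ^ v 0) fun v => v 0 :=
    .of_le fun _ => Nat.lt_two_pow_self.le
  have h1 := GrowsIn.sum_range (n := fun v : Fin 1 → ℕ => v 0) (b := fun v => 2 ^ v 0)
    (a := fun i v => Fin.cons i (Fin.cons (2 ^ i) (Fin.tail v)))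
    (d := fun v => v 0 + 2 ^ v 0) hlin hUp (hlin.add hself) (fun v i hi => by
      rw [Fin.sum_univ_two]
      simp only [Fin.cons_zero, Fin.cons_one]
      have := Nat.pow_le_pow_right (n := 2) (by norm_num) hi.le
      omega)
  refine GrowsIn.mono ((((GrowsIn.const (T Fin.elim0)).add (h1.add (hlin.mul
    (((GrowsIn.const 11).mul hself).add (.const 6))))).add ((GrowsIn.const 12).mul hlin)).add
    (.const 4)) fun v => ?_
  have ht : Fin.tail v = Fin.elim0 := Subsingleton.elim _ _
  rw [ht]
  refine Nat.add_le_add_right (Nat.add_le_add_right (Nat.add_le_add_left ?_ _) _) _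
  simp only [Nat.add_assoc]
  rw [Finset.sum_add_distrib, ← ht]
  refine Nat.add_le_add_left ?_ _
  refine (Finset.sum_le_card_nsmul _ _ (11 * 2 ^ v 0 + 6) fun i hi => ?_).trans (by simp)
  have hi' := Finset.mem_range.1 hi
  have := Nat.pow_le_pow_right (n := 2) (by norm_num) hi'.le
  have := Nat.pow_le_pow_right (n := 2) (by norm_num) (show i + 1 ≤ v 0 from hi')
  omega

/-- The value of a bit string, the most significant bit first. -/
def bitsVal (z : List Bool) : ℕ := z.foldl (fun x b => 2 * x + b.toNat) 0

theorem foldl_bits (z : List Bool) (x : ℕ) :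
    z.foldl (fun x b => 2 * x + b.toNat) x = x * 2 ^ z.length + bitsVal z := by
  induction z generalizing x with
  | nil => simp [bitsVal]
  | cons b z ih =>
    rw [bitsVal, List.foldl_cons, List.foldl_cons, ih, ih (2 * 0 + b.toNat), List.length_cons]
    ring

theorem bitsVal_cons (b : Bool) (z : List Bool) :
    bitsVal (b :: z) = b.toNat * 2 ^ z.length + bitsVal z := by
  rw [bitsVal, List.foldl_cons, foldl_bits]; simp

theorem bitsVal_lt (z : List Bool) : bitsVal z < 2 ^ z.length := by
  induction z with
  | nil => simp [bitsVal]
  | cons b z ih =>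
    rw [bitsVal_cons, List.length_cons, pow_succ]
    have : b.toNat ≤ 1 := Bool.toNat_le b
    nlinarith

namespace CounterProg

/-- Double the register `1`, with the help of the register `2`. -/
def double : CounterProg := seq (loop 1 (seq (dec 1) (seq (inc 2) (inc 2)))) (move 2 1)

theorem does_double (R : ℕ → ℕ) (h : R 2 = 0) :
    Does double R (Function.update R 1 (2 * R 1)) (13 * R 1 + 2) := by
  have := does_loop (i := 1) (P := seq (dec 1) (seq (inc 2) (inc 2))) (t := fun _ => 3) (n := R 1)
    (S := fun j => Function.update (Function.update R 2 (2 * j)) 1 (R 1 - j))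
    (fun j hj => by simp; omega) (by simp)
    (fun j hj => by
      refine ((does_dec 1 _).seq ((does_inc 2 _).seq (does_inc 2 _))).of_eq ?_ le_rfl
      funext x
      by_cases h1 : x = 1
      · subst h1; simp; omega
      by_cases h2 : x = 2
      · subst h2; simp; omega
      simp [h1, h2])
  have e : Function.update (Function.update R 2 (2 * 0)) 1 (R 1 - 0) = R := by
    have : Function.update R 2 (2 * 0) = R := Function.update_eq_self_iff.2 h.symm
    rw [this, Nat.sub_zero, Function.update_eq_self]
  rw [e] at this
  refine (this.seq (does_move (by norm_num) _)).of_eq ?_ (by simp; omega)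
  funext x
  by_cases h1 : x = 1
  · subst h1; simp
  by_cases h2 : x = 2
  · subst h2; simp [h]
  simp [h1, h2]

/-- Read the input: its length goes to the register `0`, and its value to the register `1`. -/
def readInput : CounterProg := scan (seq double (inc 0)) (seq double (seq (inc 1) (inc 0)))

/-- Horner's rule. As registers are unary, each bit costs time linear in the value read so far,
which is negligible against doubly exponential time. -/
theorem exec_readInput (z : List Bool) : ∀ R : ℕ → ℕ, R 2 = 0 →
    ∃ τ ≤ z.length * (13 * (R 1 + 1) * 2 ^ z.length + 6) + 1,
      Exec readInput R z (Function.update (Function.update R 0 (R 0 + z.length)) 1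
        (z.foldl (fun x b => 2 * x + b.toNat) (R 1))) [] τ := by
  induction z with
  | nil =>
    intro R _
    exact ⟨1, by simp, by simpa [readInput] using Exec.scan_nil _ _ R⟩
  | cons b z ih =>
    intro R h
    set R₁ := Function.update (Function.update R 0 (R 0 + 1)) 1 (2 * R 1 + b.toNat) with hR₁
    have hbody : ∃ τ ≤ 13 * R 1 + 4, Exec (bif b then seq double (seq (inc 1) (inc 0)) else
        seq double (inc 0)) R z R₁ z τ := by
      cases b
      · refine ((does_double R h).seq (does_inc 0 _)).of_eq ?_ (by omega) z
        funext x
        by_cases h0 : x = 0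
        · subst h0; simp [hR₁]
        by_cases h1 : x = 1
        · subst h1; simp [hR₁]
        simp [hR₁, h0, h1]
      · refine ((does_double R h).seq ((does_inc 1 _).seq (does_inc 0 _))).of_eq ?_ (by omega) z
        funext x
        by_cases h0 : x = 0
        · subst h0; simp [hR₁]
        by_cases h1 : x = 1
        · subst h1; simp [hR₁]
        simp [hR₁, h0, h1]
    obtain ⟨τ₁, ht₁, e₁⟩ := hbody
    obtain ⟨τ₂, ht₂, e₂⟩ := ih R₁ (by simp [hR₁, h])
    refine ⟨τ₁ + τ₂ + 2, ?_, cast ?_ (Exec.scan_cons e₁ e₂)⟩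
    · have h1 : R₁ 1 = 2 * R 1 + b.toNat := by simp [hR₁]
      have h2 : b.toNat ≤ 1 := Bool.toNat_le b
      have h3 : 13 * (R₁ 1 + 1) * 2 ^ z.length ≤ 13 * (R 1 + 1) * 2 ^ (z.length + 1) := by
        rw [pow_succ, h1]
        nlinarith [Nat.zero_le (2 ^ z.length)]
      have h4 : z.length * (13 * (R₁ 1 + 1) * 2 ^ z.length + 6) ≤
          z.length * (13 * (R 1 + 1) * 2 ^ (z.length + 1) + 6) :=
        Nat.mul_le_mul_left _ (by omega)
      have h5 : 13 * (R 1 + 1) * 1 ≤ 13 * (R 1 + 1) * 2 ^ (z.length + 1) :=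
        Nat.mul_le_mul_left _ Nat.one_le_two_pow
      rw [List.length_cons, Nat.add_mul]
      omega
    · rw [readInput]
      congr 1
      funext x
      by_cases h0 : x = 0
      · subst h0; simp [hR₁]; omega
      by_cases h1 : x = 1
      · subst h1; simp [hR₁]
      simp [hR₁, h0, h1]

end CounterProg

theorem two_add_pow_le {b m c : ℕ} (hb : 2 + b ≤ 2 ^ m) : (2 + b) ^ c ≤ 2 ^ (m * c) := by
  rw [pow_mul]; exact Nat.pow_le_pow_left hb c

/-- The arguments that are computed from the length and the value of an instance. -/
def expArgs (n x : ℕ) : Fin 5 → ℕ := ![n, x, 2 ^ n, 2 ^ 2 ^ n, 2 ^ (2 ^ n * 2 ^ n)]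

theorem computes_expArgs (i : Fin 5) : ∃ T : (Fin 2 → ℕ) → ℕ,
    Computes (fun v => expArgs (v 0) (v 1) i) T ∧
      GrowsIn (fun v => v 1 + 2 ^ (2 ^ v 0 * 2 ^ v 0)) T := by
  set b : (Fin 2 → ℕ) → ℕ := fun v => v 1 + 2 ^ (2 ^ v 0 * 2 ^ v 0) with hb
  obtain ⟨T, hT, hTp⟩ := computes_two_pow
  have hproj : ∀ i : Fin 2, Computes (fun v : Fin 2 → ℕ => v i) _ := computes_proj
  have g0 : GrowsIn b fun v => 2 ^ (2 ^ v 0 * 2 ^ v 0) := .of_le fun v => Nat.le_add_left _ _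
  have g1 : GrowsIn b fun v => 2 ^ v 0 * 2 ^ v 0 := g0.mono fun v => Nat.lt_two_pow_self.le
  have g2 : GrowsIn b fun v => 2 ^ v 0 := g1.mono fun v => Nat.le_mul_of_pos_left _ (by positivity)
  have g3 : GrowsIn b fun v => 2 ^ 2 ^ v 0 := g0.mono fun v =>
    Nat.pow_le_pow_right (by norm_num) (Nat.le_mul_of_pos_left _ (by positivity))
  have g4 : GrowsIn b fun v => v 0 := g2.mono fun v => Nat.lt_two_pow_self.le
  have g5 : GrowsIn b fun v => v 1 := .of_le fun v => Nat.le_add_right _ _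
  have gp : ∀ i : Fin 2, GrowsIn b fun v => v i := fun i => by fin_cases i <;> assumption
  -- One more exponentiation stays affordable as long as its result is polynomial in the largest
  -- argument `2 ^ (2 ^ n * 2 ^ n)`.
  have key : ∀ {f U : (Fin 2 → ℕ) → ℕ}, Computes f U → GrowsIn b U → GrowsIn b f →
      GrowsIn b (fun v => 2 ^ f v) → ∃ V, Computes (fun v => 2 ^ f v) V ∧ GrowsIn b V := by
    intro f U hf hU hfb hfe
    refine ⟨_, hT.comp (g := fun _ => f) (U := fun _ => U) fun _ => hf, ?_⟩
    refine ((((GrowsIn.sum _ fun _ _ => hU).add ?_).add (GrowsIn.sum _ fun _ _ =>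
      ((GrowsIn.const 3).mul hfb).add (.const 1))).add ((GrowsIn.const 4).mul hfe)).add (.const 1)
    obtain ⟨c, hc⟩ := hTp
    exact (((GrowsIn.const 2).add hfe).pow c).mono fun v => hc _
  have hp : ∀ i : Fin 2, ∃ V, Computes (fun v : Fin 2 → ℕ => v i) V ∧ GrowsIn b V := fun i =>
    ⟨_, hproj i, ((GrowsIn.const 9).mul (gp i)).add (.const 2)⟩
  obtain ⟨V₂, hV₂, hb₂⟩ := key (hproj 0) (((GrowsIn.const 9).mul g4).add (.const 2)) g4 g2
  obtain ⟨V₃, hV₃, hb₃⟩ := key hV₂ hb₂ g2 g3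
  obtain ⟨M, hM, hMp⟩ := ((PolyRec.proj (0 : Fin 1)).mul (.proj 0)).exists_computes
  have hmul := hM.comp (g := fun _ v => 2 ^ v 0) (U := fun _ => V₂) fun _ => hV₂
  have hmulb := ((((GrowsIn.sum (b := b) (Finset.univ : Finset (Fin 1)) fun _ _ => hb₂).add
    (hMp.comp (g := fun _ v => 2 ^ v 0) fun _ => g2)).add (GrowsIn.sum (Finset.univ : Finset (Fin 1))
      fun _ _ => ((GrowsIn.const 3).mul g2).add (.const 1))).add ((GrowsIn.const 4).mul g1)).add
      (.const 1)
  obtain ⟨V₄, hV₄, hb₄⟩ := key hmul hmulb g1 g0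
  fin_cases i
  · exact hp 0
  · exact hp 1
  · exact ⟨V₂, hV₂, hb₂⟩
  · exact ⟨V₃, hV₃, hb₃⟩
  · exact ⟨V₄, hV₄, hb₄⟩

/-- The language that is decided by polynomially bounded recursion from numbers that are doubly
exponential in the length of the instance. -/
def expLang (P : (Fin 5 → ℕ) → Prop) : Set (List Bool) :=
  {z | P (expArgs z.length (bitsVal z))}

/-- The cost is polynomial in the largest argument `2 ^ (4 ^ n)`, and a power of this number is
still doubly exponential in `n`. -/
theorem expLang_mem_EEXP {P : (Fin 5 → ℕ) → Prop} (hP : PolyDec P) : expLang P ∈ EEXP := by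
  classical
  obtain ⟨T, hT, hTp⟩ := PolyRec.exists_computes hP.boole
  choose U hU hUp using computes_expArgs
  set b : (Fin 2 → ℕ) → ℕ := fun v => v 1 + 2 ^ (2 ^ v 0 * 2 ^ v 0) with hb
  have hargs : ∀ i, GrowsIn b fun v => expArgs (v 0) (v 1) i := by
    have g0 : GrowsIn b fun v => 2 ^ (2 ^ v 0 * 2 ^ v 0) := .of_le fun v => Nat.le_add_left _ _
    have g1 : GrowsIn b fun v => 2 ^ v 0 * 2 ^ v 0 := g0.mono fun v => Nat.lt_two_pow_self.le
    have g2 : GrowsIn b fun v => 2 ^ v 0 :=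
      g1.mono fun v => Nat.le_mul_of_pos_left _ (by positivity)
    intro i
    fin_cases i
    · exact g2.mono fun v => Nat.lt_two_pow_self.le
    · exact .of_le fun v => Nat.le_add_right _ _
    · exact g2
    · exact g0.mono fun v =>
        Nat.pow_le_pow_right (by norm_num) (Nat.le_mul_of_pos_left _ (by positivity))
    · exact g0
  have hbool : GrowsIn (ι := Fin 2 → ℕ) b fun v => if P (expArgs (v 0) (v 1)) then 1 else 0 :=
    (GrowsIn.const 1).mono fun v => by split_ifs <;> omega
  obtain ⟨G, hG⟩ := hT.comp hU
  have htot := ((((((GrowsIn.sum Finset.univ fun i _ => hUp i).add (hTp.comp hargs)).add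
    (GrowsIn.sum Finset.univ fun i _ => ((GrowsIn.const 3).mul (hargs i)).add (.const 1))).add
    ((GrowsIn.const 4).mul hbool)).add (.const 1)).add
    (((hargs 0).mul (((GrowsIn.const 13).mul (hargs 2)).add (.const 6))).add (.const 1))).add
    (.const 2)
  obtain ⟨c, hc⟩ := htot
  obtain ⟨M, hM⟩ := (CounterProg.seq readInput (G ![0, 1] 2)).exists_turingMachine 2
  -- The cost is at most `(2 + b) ^ c ≤ 2 ^ (3 * 4 ^ n * c)`, and `3 * c * 4 ^ n ≤ 2 ^ (2 * n + 3 *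
  -- c)`.
  refine ⟨M, 2 * .X + .C (3 * c), fun z => ?_⟩
  obtain ⟨τ, hτ, e⟩ := exec_readInput z (fun _ => 0) rfl
  set R : ℕ → ℕ := Function.update (Function.update (fun _ => 0) 0 (0 + z.length)) 1
    (z.foldl (fun x b => 2 * x + b.toNat) 0) with hR
  have hρ : R ∘ ![0, 1] = ![z.length, bitsVal z] := by
    funext i
    fin_cases i
    · simp [hR]
    · simp [hR, bitsVal]
  have h2 := hG ![0, 1] 2 (fun i => by fin_cases i <;> simp) R (fun j hj => by
    simp [hR, show j ≠ 0 by omega, show j ≠ 1 by omega])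
  rw [hρ] at h2
  obtain ⟨τ', hτ', e'⟩ := h2 []
  have hdec := hM z _ _ _ (e.seq e')
  refine ⟨_, hdec.mono ?_, ?_⟩
  · have h := hc ![z.length, bitsVal z]
    have hx := bitsVal_lt z
    set N := 2 ^ z.length with hN
    have hbb : 2 + b ![z.length, bitsVal z] ≤ 2 ^ (3 * (N * N)) := by
      have hN1 : 1 ≤ N := Nat.one_le_two_pow
      have h1 : N < 2 ^ N := Nat.lt_two_pow_self
      have h2 : 2 ^ N ≤ 2 ^ (N * N) := Nat.pow_le_pow_right (by norm_num) (by nlinarith)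
      have h3 : 2 ^ 1 ≤ 2 ^ (N * N) := Nat.pow_le_pow_right (by norm_num) (by nlinarith)
      have h4 : 2 ^ (3 * (N * N)) = 2 ^ (N * N) * (2 ^ (N * N) * 2 ^ (N * N)) := by
        rw [← pow_add, ← pow_add]; ring
      have h5 : b ![z.length, bitsVal z] = bitsVal z + 2 ^ (N * N) := by simp [hb, hN]
      rw [h4, h5]
      nlinarith
    have h6 := two_add_pow_le (c := c) hbb
    have h7 : 3 * (N * N) * c ≤ 2 ^ (Polynomial.eval z.length (2 * .X + .C (3 * c))) := by
      have : Polynomial.eval z.length (2 * Polynomial.X + Polynomial.C (3 * c)) =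
          z.length + z.length + 3 * c := by simp; ring
      rw [this, pow_add, pow_add, ← hN]
      have : 3 * c < 2 ^ (3 * c) := Nat.lt_two_pow_self
      nlinarith [Nat.zero_le (N * N)]
    have h8 := Nat.pow_le_pow_right (n := 2) (by norm_num) h7
    refine le_trans ?_ ((h.trans h6).trans h8)
    refine Nat.add_le_add_right ?_ 2
    rw [add_comm τ τ']
    refine Nat.add_le_add hτ' (hτ.trans ?_)
    simp [expArgs, hN]
  · simp only [Function.update_self]
    simp [expLang]

theorem primrec_two_pow : Primrec fun n : ℕ => 2 ^ n := by
  refine (Primrec.nat_rec₁ (f := fun _ a => 2 * a) 1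
    (Primrec.nat_mul.comp (.const 2) .snd)).of_eq fun n => ?_
  induction n with
  | zero => rfl
  | succ n ih => simp only [ih, pow_succ]; omega

theorem primrec_bitsVal : Primrec bitsVal :=
  Primrec.list_foldl (h := fun _ p => 2 * p.1 + Bool.toNat p.2) .id (.const 0) <|
    Primrec.to₂ (Primrec.nat_add.comp (Primrec.nat_mul.comp (.const 2)
    (Primrec.fst.comp .snd)) ((Primrec.dom_bool Bool.toNat).comp (Primrec.snd.comp .snd)))

theorem expLang_mem_RE {P : (Fin 5 → ℕ) → Prop} (hP : PolyDec P) : expLang P ∈ RE := by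
  classical
  have h1 := (PolyRec.primrec hP.boole).to_prim
  have hlen : Primrec fun z : List Bool => z.length := .list_length
  have hN := primrec_two_pow.comp hlen
  have hargs : ∀ i, Primrec fun z : List Bool => expArgs z.length (bitsVal z) i := by
    intro i
    fin_cases i
    · exact hlen
    · exact primrec_bitsVal
    · exact hN
    · exact primrec_two_pow.comp hN
    · exact primrec_two_pow.comp (Primrec.nat_mul.comp hN hN)
  have h2 := h1.comp (Primrec.vector_ofFn hargs)
  have h3 : PrimrecPred fun z => z ∈ expLang P := by
    have := (PrimrecRel.comp Primrec.eq h2 (.const 1))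
    refine this.of_eq fun z => ?_
    have e : (List.Vector.ofFn fun i => expArgs z.length (bitsVal z) i).get =
        expArgs z.length (bitsVal z) := by
      funext i; rw [List.Vector.get_ofFn]
    rw [e]
    by_cases h : P (expArgs z.length (bitsVal z)) <;> simp [expLang, h]
  exact (PrimrecPred.computablePred h3).to_re

/-! ### The universal machine -/

theorem sum_digits_div_mod {B : ℕ} : ∀ {d : ℕ} {x : ℕ → ℕ} {j : ℕ}, (∀ i < d, x i < B) → j < d →
    (∑ i ∈ Finset.range d, x i * B ^ i) / B ^ j % B = x j := by
  intro d
  induction d with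
  | zero => intro x j _ hj; omega
  | succ d ih =>
    intro x j hx hj
    have e : ∑ i ∈ Finset.range (d + 1), x i * B ^ i =
        x 0 + B * ∑ i ∈ Finset.range d, x (i + 1) * B ^ i := by
      rw [Finset.sum_range_succ', Finset.mul_sum, pow_zero, mul_one, add_comm]
      congr 1
      exact Finset.sum_congr rfl fun i _ => by rw [pow_succ]; ring
    have h0 := hx 0 (by omega)
    rw [e]
    cases j with
    | zero => rw [pow_zero, Nat.div_one, Nat.add_mul_mod_self_left, Nat.mod_eq_of_lt h0]
    | succ j =>
      rw [pow_succ', ← Nat.div_div_eq_div_mul, Nat.add_mul_div_left _ _ (by omega),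
        Nat.div_eq_of_lt h0, Nat.zero_add]
      exact ih (x := fun i => x (i + 1)) (fun i hi => hx _ (by omega)) (by omega)

theorem sum_digits_lt {B d : ℕ} {x : ℕ → ℕ} (hx : ∀ i < d, x i < B) :
    ∑ i ∈ Finset.range d, x i * B ^ i < B ^ d := by
  induction d with
  | zero => simp
  | succ d ih =>
    have h1 := ih fun i hi => hx i (by omega)
    have h2 := hx d (by omega)
    rw [Finset.sum_range_succ, pow_succ]
    nlinarith [Nat.zero_le (B ^ d)]

/-- The number of a tape symbol; the blank has the number `0`. -/
def symCode {a : ℕ} : TapeSymbol a → ℕ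
  | none => 0
  | some (.inl b) => 1 + b.toNat
  | some (.inr j) => 3 + j.val

theorem symCode_lt {a : ℕ} (s : TapeSymbol a) : symCode s < a + 3 := by
  rcases s with _ | b | j
  · simp [symCode]
  · cases b <;> simp [symCode]
  · have := j.2; simp only [symCode]; omega

theorem symCode_injective {a : ℕ} : Function.Injective (symCode (a := a)) := by
  rintro (_ | b | j) (_ | b' | j') h
  · rfl
  · simp only [symCode] at h; omega
  · simp only [symCode] at h; omega
  · simp only [symCode] at h; omega
  · simp only [symCode] at h
    have : b = b' := by cases b <;> cases b' <;> simp_all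
    rw [this]
  · cases b <;> simp only [symCode, Bool.toNat] at h <;> simp at h <;> omega
  · simp only [symCode] at h; omega
  · cases b' <;> simp only [symCode, Bool.toNat] at h <;> simp at h <;> omega
  · simp only [symCode] at h
    have : j = j' := Fin.ext (by omega)
    rw [this]

/-- The number to the base `b` that represents a list of symbols. -/
def listNum (b : ℕ) {a : ℕ} (l : List (TapeSymbol a)) : ℕ :=
  l.foldr (fun s x => symCode s + b * x) 0

theorem listNum_append_replicate (b n : ℕ) {a : ℕ} (l : List (TapeSymbol a)) :
    listNum b (l ++ List.replicate n none) = listNum b l := by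
  have h : listNum b (List.replicate n (none : TapeSymbol a)) = 0 := by
    induction n with
    | zero => rfl
    | succ n ih =>
      show symCode none + b * listNum b (List.replicate n (none : TapeSymbol a)) = 0
      rw [ih]; rfl
  induction l with
  | nil => exact h
  | cons s l ih => exact congrArg (fun x => symCode s + b * x) ih

theorem listNum_lt {b a : ℕ} (hb : a + 3 ≤ b) (l : List (TapeSymbol a)) :
    listNum b l < b ^ l.length := by
  induction l with
  | nil => simp [listNum]
  | cons s l ih =>
    show symCode s + b * listNum b l < b ^ (l.length + 1)
    have := symCode_lt s
    rw [pow_succ]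
    nlinarith

/-- The number to the base `b` that represents a half tape. -/
def blankNum (b : ℕ) {a : ℕ} (L : Turing.ListBlank (TapeSymbol a)) : ℕ :=
  L.liftOn (listNum b) (by
    rintro l _ ⟨n, rfl⟩
    exact (listNum_append_replicate b n l).symm)

theorem blankNum_mk (b : ℕ) {a : ℕ} (l : List (TapeSymbol a)) :
    blankNum b (Turing.ListBlank.mk l) = listNum b l := rfl

theorem blankNum_cons (b : ℕ) {a : ℕ} (s : TapeSymbol a) (L : Turing.ListBlank (TapeSymbol a)) :
    blankNum b (L.cons s) = symCode s + b * blankNum b L := by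
  refine L.induction_on fun l => ?_
  rw [Turing.ListBlank.cons_mk]
  rfl

theorem blankNum_eq (b : ℕ) {a : ℕ} (L : Turing.ListBlank (TapeSymbol a)) :
    blankNum b L = symCode L.head + b * blankNum b L.tail := by
  conv_lhs => rw [← L.cons_head_tail, blankNum_cons]

theorem blankNum_mod {b a : ℕ} (hb : a + 3 ≤ b) (L : Turing.ListBlank (TapeSymbol a)) :
    blankNum b L % b = symCode L.head := by
  rw [blankNum_eq, Nat.add_mul_mod_self_left,
    Nat.mod_eq_of_lt ((symCode_lt _).trans_le hb)]

theorem blankNum_div {b a : ℕ} (hb : a + 3 ≤ b) (L : Turing.ListBlank (TapeSymbol a)) :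
    blankNum b L / b = blankNum b L.tail := by
  rw [blankNum_eq, Nat.add_mul_div_left _ _ (by omega),
    Nat.div_eq_of_lt ((symCode_lt _).trans_le hb), Nat.zero_add]

namespace MultiTapeTM

variable {m : ℕ} (M : MultiTapeTM m)

/-- A base that exceeds the numbers of symbols and states. -/
def base : ℕ := M.numAux + 3 + 2 * M.numStates

/-- The number of coordinates of a configuration. -/
def dim : ℕ := 1 + 2 * (m + M.numWork)

/-- The number of a state; it is odd for accepting states. -/
def stateCode (q : Fin M.numStates) : ℕ := 2 * q.val + (M.accepting q).toNat

theorem stateCode_lt (q : Fin M.numStates) : M.stateCode q < M.base := by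
  have := q.2
  have := Bool.toNat_le (M.accepting q)
  rw [stateCode, base]; omega

theorem stateCode_injective : Function.Injective M.stateCode := by
  intro q q' h
  have := Bool.toNat_le (M.accepting q)
  have := Bool.toNat_le (M.accepting q')
  rw [stateCode, stateCode] at h
  exact Fin.ext (by omega)

/-- The state, and the two halves of each tape, as numbers. -/
def coords (c : M.Cfg) (i : ℕ) : ℕ :=
  if i = 0 then M.stateCode c.state
  else if h : (i - 1) / 2 < m + M.numWork then
    if i % 2 = 1 then blankNum M.base (c.tape (finSumFinEquiv.symm ⟨(i - 1) / 2, h⟩)).left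
    else blankNum M.base (c.tape (finSumFinEquiv.symm ⟨(i - 1) / 2, h⟩)).right₀
  else 0

theorem coords_zero (c : M.Cfg) : M.coords c 0 = M.stateCode c.state := rfl

theorem coords_left (c : M.Cfg) (j : Fin m ⊕ Fin M.numWork) :
    M.coords c (2 * (finSumFinEquiv j).val + 1) = blankNum M.base (c.tape j).left := by
  have h := (finSumFinEquiv j).2
  have h2 : (2 * (finSumFinEquiv j).val + 1 - 1) / 2 = (finSumFinEquiv j).val := by omega
  rw [coords, if_neg (by omega), dif_pos (by omega), if_pos (by omega)]
  congr 3
  rw [Equiv.symm_apply_eq]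
  exact Fin.ext h2

theorem coords_right (c : M.Cfg) (j : Fin m ⊕ Fin M.numWork) :
    M.coords c (2 * (finSumFinEquiv j).val + 2) = blankNum M.base (c.tape j).right₀ := by
  have h := (finSumFinEquiv j).2
  have h2 : (2 * (finSumFinEquiv j).val + 2 - 1) / 2 = (finSumFinEquiv j).val := by omega
  rw [coords, if_neg (by omega), dif_pos (by omega), if_neg (by omega)]
  congr 3
  rw [Equiv.symm_apply_eq]
  exact Fin.ext h2

variable {M} in
/-- Each coordinate is the state, or half of a tape. -/
theorem coord_cases {i : ℕ} (hi : i < M.dim) : i = 0 ∨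
    ∃ j : Fin m ⊕ Fin M.numWork, i = 2 * (finSumFinEquiv j).val + 1 ∨
      i = 2 * (finSumFinEquiv j).val + 2 := by
  rcases Nat.eq_zero_or_pos i with h | h
  · exact .inl h
  · rw [dim] at hi
    refine .inr ⟨finSumFinEquiv.symm ⟨(i - 1) / 2, by omega⟩, ?_⟩
    rw [Equiv.apply_symm_apply]
    dsimp only
    omega

theorem base_ge : M.numAux + 3 ≤ M.base := by rw [base]; omega

/-- The part of a configuration on which the next step depends. -/
def obs (c : M.Cfg) : Fin M.numStates × (Fin m ⊕ Fin M.numWork → TapeSymbol M.numAux) ×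
    (Fin m ⊕ Fin M.numWork → TapeSymbol M.numAux) :=
  (c.state, fun i => (c.tape i).head, fun i => (c.tape i).left.head)

theorem obs_eq {c c' : M.Cfg} (h : ∀ i < M.dim, M.coords c i % M.base = M.coords c' i % M.base) :
    M.obs c = M.obs c' := by
  have hd : ∀ j : Fin m ⊕ Fin M.numWork, 2 * (finSumFinEquiv j).val + 2 < M.dim := fun j => by
    have := (finSumFinEquiv j).2
    rw [dim]; omega
  refine Prod.ext ?_ (Prod.ext (funext fun j => ?_) (funext fun j => ?_))
  · have := h 0 (by rw [dim]; omega)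
    rw [coords_zero, coords_zero, Nat.mod_eq_of_lt (M.stateCode_lt _),
      Nat.mod_eq_of_lt (M.stateCode_lt _)] at this
    exact M.stateCode_injective this
  · have := h _ (hd j)
    rw [coords_right, coords_right, blankNum_mod M.base_ge, blankNum_mod M.base_ge] at this
    have := symCode_injective this
    show (c.tape j).head = (c'.tape j).head
    simpa [Turing.Tape.right₀] using this
  · have := h _ (Nat.lt_of_succ_lt (hd j))
    rw [coords_left, coords_left, blankNum_mod M.base_ge, blankNum_mod M.base_ge] at this
    exact symCode_injective this

/-- The configuration after the next step. -/
def next (c : M.Cfg) : M.Cfg := (M.step c).getD c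

/-- The coordinates of the next configuration are images of the present ones under affine maps
with integer division, which depend on the observable part of the configuration. -/
theorem exists_affine (c₀ : M.Cfg) (i : ℕ) (hi : i < M.dim) : ∃ α γ β : ℕ,
    (∀ c, M.obs c = M.obs c₀ → M.coords (M.next c) i = α * (M.coords c i / γ) + β) ∧
    ∀ v l, v < M.base ^ (l + 1) → α * (v / γ) + β < M.base ^ (l + 2) := by
  have hb := M.base_ge
  have hb0 : 0 < M.base := by omega
  have hid : ∀ v l, v < M.base ^ (l + 1) → 1 * (v / 1) + 0 < M.base ^ (l + 2) := fun v l hv => by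
    rw [pow_succ]; simp only [Nat.div_one]; nlinarith
  rcases htr : M.trans c₀.state (fun i => (c₀.tape i).head) with _ | p
  · refine ⟨1, 1, 0, fun c hc => ?_, hid⟩
    have h1 : M.step c = none := by
      have e1 : c.state = c₀.state := congrArg Prod.fst hc
      have e2 : (fun i => (c.tape i).head) = fun i => (c₀.tape i).head :=
        congrArg (fun o => o.2.1) hc
      rw [step, e1, e2, htr]; rfl
    rw [next, h1]; simp
  have hnext : ∀ c, M.obs c = M.obs c₀ → M.next c =
      ⟨p.1, fun i => tapeAction (c.tape i) (p.2 i)⟩ := fun c hc => by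
    have e1 : c.state = c₀.state := congrArg Prod.fst hc
    have e2 : (fun i => (c.tape i).head) = fun i => (c₀.tape i).head :=
      congrArg (fun o => o.2.1) hc
    rw [next, step, e1, e2, htr]
    rfl
  have hcons : ∀ (s : TapeSymbol M.numAux) (v l : ℕ), v < M.base ^ (l + 1) →
      M.base * (v / 1) + symCode s < M.base ^ (l + 2) := fun s v l hv => by
    have := symCode_lt s
    rw [pow_succ]; simp only [Nat.div_one]; nlinarith
  have htail : ∀ v l, v < M.base ^ (l + 1) → 1 * (v / M.base) + 0 < M.base ^ (l + 2) :=
    fun v l hv => by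
      have := Nat.div_le_self v M.base
      rw [pow_succ]; nlinarith
  have hdiv : ∀ v l, v < M.base ^ (l + 1) → v / M.base < M.base ^ l := fun v l hv => by
    rw [Nat.div_lt_iff_lt_mul hb0, ← pow_succ]; exact hv
  rcases coord_cases hi with rfl | ⟨j, hj⟩
  · refine ⟨0, 1, M.stateCode p.1, fun c hc => ?_, fun v l _ => ?_⟩
    · rw [hnext c hc, coords_zero]; simp
    · have := M.stateCode_lt p.1
      have h2 : M.base ^ 1 ≤ M.base ^ (l + 2) := Nat.pow_le_pow_right hb0 (by omega)
      rw [pow_one] at h2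
      omega
  have hlh : ∀ c, M.obs c = M.obs c₀ → (c.tape j).left.head = (c₀.tape j).left.head :=
    fun c hc => congrFun (congrArg (fun o => o.2.2) hc) j
  rcases hd : (p.2 j).2 with _ | (_ | _)
  · rcases hj with rfl | rfl
    · refine ⟨1, 1, 0, fun c hc => ?_, hid⟩
      rw [hnext c hc, coords_left, coords_left]
      simp [tapeAction, hd, Turing.Tape.write]
    · refine ⟨M.base, M.base, symCode (p.2 j).1, fun c hc => ?_, fun v l hv => ?_⟩
      · rw [hnext c hc, coords_right, coords_right, blankNum_div hb]
        simp [tapeAction, hd, Turing.Tape.write, Turing.Tape.right₀, blankNum_cons]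
        omega
      · have h1 := symCode_lt (p.2 j).1
        have h2 := hdiv v l hv
        have h3 : M.base * (v / M.base) + symCode (p.2 j).1 < M.base ^ (l + 1) := by
          rw [pow_succ]; nlinarith
        exact h3.trans_le (Nat.pow_le_pow_right hb0 (by omega))
  · rcases hj with rfl | rfl
    · refine ⟨1, M.base, 0, fun c hc => ?_, htail⟩
      rw [hnext c hc, coords_left, coords_left, blankNum_div hb]
      simp [tapeAction, hd, Turing.Tape.write, Turing.Tape.move]
    -- A move to the left replaces the lowest symbol of the right half and pushes the neighbouring
    -- symbol of the left half in front of it. This is why `obs` records the left neighbours too,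
    -- although the transition does not depend on them.
    · refine ⟨M.base * M.base, M.base, M.base * symCode (p.2 j).1 + symCode (c₀.tape j).left.head,
        fun c hc => ?_, fun v l hv => ?_⟩
      · rw [hnext c hc, coords_right, coords_right, blankNum_div hb, ← hlh c hc]
        simp [tapeAction, hd, Turing.Tape.write, Turing.Tape.move, Turing.Tape.right₀,
          blankNum_cons]
        ring
      · have h1 := symCode_lt (p.2 j).1
        have h2 := symCode_lt (c₀.tape j).left.head
        have h3 := hdiv v l hv
        have h4 : M.base * (v / M.base) + symCode (p.2 j).1 < M.base ^ (l + 1) := by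
          rw [pow_succ]; nlinarith
        rw [pow_succ]; nlinarith
  · rcases hj with rfl | rfl
    · refine ⟨M.base, 1, symCode (p.2 j).1, fun c hc => ?_, hcons _⟩
      rw [hnext c hc, coords_left, coords_left]
      simp [tapeAction, hd, Turing.Tape.write, Turing.Tape.move, blankNum_cons]
      omega
    · refine ⟨1, M.base, 0, fun c hc => ?_, htail⟩
      rw [hnext c hc, coords_right, coords_right, blankNum_div hb]
      simp [tapeAction, hd, Turing.Tape.write, Turing.Tape.move, Turing.Tape.right₀]

/-- The residues of the coordinates, as one number. -/
def obsKey (c : M.Cfg) : ℕ := ∑ i ∈ Finset.range M.dim, M.coords c i % M.base * M.base ^ i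

theorem obs_eq_of_obsKey {c c' : M.Cfg} (h : M.obsKey c = M.obsKey c') : M.obs c = M.obs c' := by
  have hb0 : 0 < M.base := by have := M.base_ge; omega
  refine M.obs_eq fun i hi => ?_
  have h1 : ∀ c : M.Cfg, ∀ i < M.dim, M.coords c i % M.base < M.base :=
    fun c i _ => Nat.mod_lt _ hb0
  rw [← sum_digits_div_mod (h1 c) hi, ← sum_digits_div_mod (h1 c') hi]
  exact congrArg (fun k => k / M.base ^ i % M.base) h

theorem obsKey_lt (c : M.Cfg) : M.obsKey c < M.base ^ M.dim :=
  sum_digits_lt fun _ _ => Nat.mod_lt _ (by have := M.base_ge; omega)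

end MultiTapeTM

/-- Gödel's `β` function stores any finite table in two numbers, so a machine of any size becomes a
pair of numbers. -/
theorem exists_lookup (f : ℕ → ℕ) (n : ℕ) : ∃ e₁ e₂, ∀ i < n, Diag.lookup e₁ e₂ i = f i := by
  set l := (List.range n).map f with hl
  refine ⟨(Nat.unbeta l).unpair.1, (Nat.unbeta l).unpair.2, fun i hi => ?_⟩
  have := Nat.beta_unbeta_coe l ⟨i, by simpa [hl] using hi⟩
  simpa [Diag.lookup, Nat.beta, hl] using this

namespace MultiTapeTM

variable {m : ℕ} (M : MultiTapeTM m)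

/-- `e₁, e₂` is a code of the machine `M` for the universal machine. -/
structure IsCode (e₁ e₂ : ℕ) : Prop where
  base : Diag.lookup e₁ e₂ 0 = M.base
  dim : Diag.lookup e₁ e₂ 1 = M.dim
  start : Diag.lookup e₁ e₂ 2 = M.stateCode M.start
  next : ∀ c, ∀ i < M.dim, M.coords (M.next c) i =
    Diag.lookup e₁ e₂ (3 * (M.obsKey c * M.dim + i) + 3) *
      (M.coords c i / Diag.lookup e₁ e₂ (3 * (M.obsKey c * M.dim + i) + 4)) +
      Diag.lookup e₁ e₂ (3 * (M.obsKey c * M.dim + i) + 5)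

/-- There are finitely many keys, all below `base ^ dim`, so the affine maps for all keys and
coordinates form a finite table. -/
theorem exists_isCode : ∃ e₁ e₂, M.IsCode e₁ e₂ := by
  classical
  choose α γ β h _ using M.exists_affine
  -- The entry is read off from some configuration with the given key; it serves all others, because
  -- equal keys mean equal observations. Keys that never occur get the value `0`.
  set A : (∀ _ : M.Cfg, ∀ i, i < M.dim → ℕ) → ℕ → ℕ := fun a k =>
    if h : (∃ c, M.obsKey c = k / M.dim) ∧ k % M.dim < M.dim then a h.1.choose (k % M.dim) h.2
    else 0 with hA
  obtain ⟨e₁, e₂, he⟩ := exists_lookup (fun k => if k = 0 then M.base else if k = 1 then M.dim else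
    if k = 2 then M.stateCode M.start else if k % 3 = 0 then A α ((k - 3) / 3) else
    if k % 3 = 1 then A γ ((k - 3) / 3) else A β ((k - 3) / 3))
    (3 * (M.base ^ M.dim * M.dim) + 6)
  refine ⟨e₁, e₂, he 0 (by omega), he 1 (by omega), he 2 (by omega), fun c i hi => ?_⟩
  have hlt : M.obsKey c * M.dim + i < M.base ^ M.dim * M.dim := by
    have := M.obsKey_lt c
    nlinarith
  set k := M.obsKey c * M.dim + i with hk
  rw [he _ (by omega), he _ (by omega), he _ (by omega)]
  rw [if_neg (by omega), if_neg (by omega), if_neg (by omega), if_pos (by omega),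
    if_neg (by omega), if_neg (by omega), if_neg (by omega), if_neg (by omega), if_pos (by omega),
    if_neg (by omega), if_neg (by omega), if_neg (by omega), if_neg (by omega), if_neg (by omega),
    show (3 * k + 3 - 3) / 3 = k by omega, show (3 * k + 4 - 3) / 3 = k by omega,
    show (3 * k + 5 - 3) / 3 = k by omega]
  have hex : ∃ c', M.obs c = M.obs c' ∧ A α k = α c' i hi ∧ A γ k = γ c' i hi ∧
      A β k = β c' i hi := by
    have hkd : k / M.dim = M.obsKey c := by
      rw [hk, mul_comm, Nat.mul_add_div (by omega), Nat.div_eq_of_lt hi, Nat.add_zero]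
    have hr : k % M.dim = i := by
      rw [hk, mul_comm, Nat.mul_add_mod, Nat.mod_eq_of_lt hi]
    have hex : (∃ c', M.obsKey c' = k / M.dim) ∧ k % M.dim < M.dim :=
      ⟨⟨c, hkd.symm⟩, by rw [hr]; exact hi⟩
    have hA' : ∀ a : (∀ _ : M.Cfg, ∀ i, i < M.dim → ℕ), A a k = a hex.1.choose i hi := by
      intro a
      simp only [hA]
      rw [dif_pos hex]
      congr 1
    exact ⟨hex.1.choose, M.obs_eq_of_obsKey (by rw [hex.1.choose_spec, hkd]), hA' _, hA' _, hA' _⟩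
  obtain ⟨c', hc, h1, h2, h3⟩ := hex
  rw [h1, h2, h3]
  exact h c' i hi c hc

theorem coords_next_lt {c : M.Cfg} {l : ℕ} (h : ∀ i < M.dim, M.coords c i < M.base ^ (l + 1)) :
    ∀ i < M.dim, M.coords (M.next c) i < M.base ^ (l + 2) := by
  intro i hi
  obtain ⟨α, γ, β, h1, h2⟩ := M.exists_affine c i hi
  rw [h1 c rfl]
  exact h2 _ _ (h i hi)

theorem coords_after_lt {inp : Fin m → List Bool} {l : ℕ}
    (h : ∀ i < M.dim, M.coords (M.init inp) i < M.base ^ (l + 1)) (k : ℕ) :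
    ∀ i < M.dim, M.coords (M.after inp k) i < M.base ^ (l + k + 1) := by
  induction k with
  | zero => exact h
  | succ k ih =>
    have : M.after inp (k + 1) = M.next (M.after inp k) := M.after_add inp k 1
    rw [this]
    exact M.coords_next_lt ih

/-- A configuration as a number to the base `B`. -/
def cfgNum (B : ℕ) (c : M.Cfg) : ℕ := ∑ i ∈ Finset.range M.dim, M.coords c i * B ^ i

section

variable {M} {e₁ e₂ W B : ℕ}

theorem digit_cfgNum {c : M.Cfg} (hW : B ^ M.dim ≤ W) (hc : ∀ i < M.dim, M.coords c i < B) {i : ℕ}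
    (hi : i < M.dim) : Diag.digit W B (M.cfgNum B c) i = M.coords c i := by
  have hB : 0 < B := (Nat.zero_le _).trans_lt (hc i hi)
  rw [Diag.digit, Diag.pw, min_eq_right ((Nat.pow_le_pow_right hB hi.le).trans hW)]
  exact sum_digits_div_mod hc hi

theorem IsCode.machStep_cfgNum (h : M.IsCode e₁ e₂) {c : M.Cfg} (hW : B ^ M.dim ≤ W)
    (hb : M.base ≤ B) (hc : ∀ i < M.dim, M.coords c i < B) :
    Diag.machStep W B e₁ e₂ (M.cfgNum B c) = M.cfgNum B (M.next c) := by
  have hb0 : 0 < M.base := by have := M.base_ge; omega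
  have hpw : ∀ i < M.dim, Diag.pw W B i = B ^ i := fun i hi =>
    min_eq_right ((Nat.pow_le_pow_right (by omega) hi.le).trans hW)
  have hpw' : ∀ i < M.dim, Diag.pw W M.base i = M.base ^ i := fun i hi =>
    min_eq_right (((Nat.pow_le_pow_right (by omega) hi.le).trans
      (Nat.pow_le_pow_left hb _)).trans hW)
  have hkey : Diag.residueKey W B M.base M.dim (M.cfgNum B c) = M.obsKey c := by
    refine Finset.sum_congr rfl fun i hi => ?_
    have hi' := Finset.mem_range.1 hi
    rw [digit_cfgNum hW hc hi', hpw' i hi']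
  rw [Diag.machStep, h.base, h.dim, hkey]
  refine Finset.sum_congr rfl fun i hi => ?_
  have hi' := Finset.mem_range.1 hi
  rw [digit_cfgNum hW hc hi', hpw i hi', h.next c i hi']

/-- The universal machine simulates `M`. -/
theorem IsCode.machRun_cfgNum (h : M.IsCode e₁ e₂) {inp : Fin m → List Bool} (hW : B ^ M.dim ≤ W)
    (hb : M.base ≤ B) (hc : ∀ k, ∀ i < M.dim, M.coords (M.after inp k) i < B) (T : ℕ) :
    Diag.machRun W B e₁ e₂ T (M.cfgNum B (M.init inp)) = M.cfgNum B (M.after inp T) := by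
  induction T with
  | zero => rfl
  | succ T ih =>
    have hn : M.after inp (T + 1) = M.next (M.after inp T) := M.after_add inp T 1
    rw [Diag.machRun, Function.iterate_succ_apply']
    rw [Diag.machRun] at ih
    rw [ih, h.machStep_cfgNum hW hb (hc T), ← hn]
    -- Numbers of configurations stay below `B ^ dim ≤ W`, so the cut-off has no effect.
    exact min_eq_right ((sum_digits_lt (hc (T + 1))).le.trans hW)

/-- A halted machine keeps its configuration, so a bound up to the halting time holds forever.
Therefore the universal machine may always run for `N` steps without knowing the time bound `t`. -/
theorem coords_after_lt_of_halts {inp : Fin m → List Bool} {l t : ℕ}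
    (h : ∀ i < M.dim, M.coords (M.init inp) i < M.base ^ (l + 1)) (ht : M.HaltsWithin inp t)
    (hB : M.base ^ (l + t + 1) ≤ B) (k : ℕ) : ∀ i < M.dim, M.coords (M.after inp k) i < B := by
  have hb0 : 0 < M.base := by have := M.base_ge; omega
  intro i hi
  rcases le_total k t with hk | hk
  · exact (M.coords_after_lt h k i hi).trans_le ((Nat.pow_le_pow_right hb0 (by omega)).trans hB)
  · rw [ht.after_eq hk]
    exact (M.coords_after_lt h t i hi).trans_le hB

end

theorem coords_init_left (inp : Fin m → List Bool) (j : Fin m ⊕ Fin M.numWork) :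
    M.coords (M.init inp) (2 * (finSumFinEquiv j).val + 1) = 0 := by
  rw [coords_left]
  rcases j with j | j <;> rfl

theorem coords_init_work (inp : Fin m → List Bool) (j : Fin M.numWork) :
    M.coords (M.init inp) (2 * (finSumFinEquiv (Sum.inr j : Fin m ⊕ Fin M.numWork)).val + 2) = 0 := by
  rw [coords_right]
  show blankNum _ (Turing.Tape.mk' _ (Turing.ListBlank.mk [])).right₀ = 0
  rw [Turing.Tape.mk'_right₀]; rfl

theorem coords_init_input (inp : Fin m → List Bool) (j : Fin m) :
    M.coords (M.init inp) (2 * j.val + 2) = listNum M.base (bitSymbols M.numAux (inp j)) := by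
  have := M.coords_right (M.init inp) (Sum.inl j)
  rw [finSumFinEquiv_apply_left, Fin.val_castAdd] at this
  rw [this]
  show blankNum _ (Turing.Tape.mk' _ (Turing.ListBlank.mk (bitSymbols M.numAux (inp j)))).right₀ = _
  rw [Turing.Tape.mk'_right₀]; rfl

theorem coords_init_lt {inp : Fin m → List Bool} {l : ℕ} (hl : ∀ j, (inp j).length ≤ l) :
    ∀ i < M.dim, M.coords (M.init inp) i < M.base ^ (l + 1) := by
  have hb := M.base_ge
  have hb0 : 0 < M.base := by omega
  intro i hi
  rcases coord_cases hi with rfl | ⟨j, rfl | rfl⟩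
  · exact (M.stateCode_lt _).trans_le (by
      simpa using Nat.pow_le_pow_right hb0 (show 1 ≤ l + 1 by omega))
  · rw [coords_init_left]; positivity
  · rcases j with j | j
    · rw [finSumFinEquiv_apply_left, Fin.val_castAdd, coords_init_input]
      refine (listNum_lt hb _).trans_le (Nat.pow_le_pow_right hb0 ?_)
      have := hl j
      simp only [bitSymbols, List.length_map]; omega
    · rw [coords_init_work]; positivity

theorem sum_range_odd_even (g : ℕ → ℕ) (k : ℕ) : ∑ i ∈ Finset.range (1 + 2 * k), g i =
    g 0 + ∑ t ∈ Finset.range k, (g (2 * t + 1) + g (2 * t + 2)) := by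
  induction k with
  | zero => simp
  | succ k ih =>
    rw [show 1 + 2 * (k + 1) = 1 + 2 * k + 1 + 1 by ring, Finset.sum_range_succ,
      Finset.sum_range_succ, ih, Finset.sum_range_succ, show 1 + 2 * k = 2 * k + 1 by ring]
    ring

theorem cfgNum_init (B : ℕ) (inp : Fin m → List Bool) :
    M.cfgNum B (M.init inp) = M.stateCode M.start +
      ∑ j : Fin m, listNum M.base (bitSymbols M.numAux (inp j)) * B ^ (2 * j.val + 2) := by
  rw [cfgNum, dim, sum_range_odd_even, coords_zero, pow_zero, mul_one]
  congr 1
  rw [Finset.sum_range, ← finSumFinEquiv.sum_comp, Fintype.sum_sum_type]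
  have h1 : ∀ j : Fin M.numWork, M.coords (M.init inp)
      (2 * (finSumFinEquiv (Sum.inr j : Fin m ⊕ Fin M.numWork)).val + 1) *
        B ^ (2 * (finSumFinEquiv (Sum.inr j : Fin m ⊕ Fin M.numWork)).val + 1) +
      M.coords (M.init inp)
      (2 * (finSumFinEquiv (Sum.inr j : Fin m ⊕ Fin M.numWork)).val + 2) *
        B ^ (2 * (finSumFinEquiv (Sum.inr j : Fin m ⊕ Fin M.numWork)).val + 2) = 0 := fun j => by
    rw [coords_init_left, coords_init_work]; simp
  rw [Finset.sum_congr rfl fun j _ => h1 j, Finset.sum_const_zero, add_zero]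
  refine Finset.sum_congr rfl fun j _ => ?_
  rw [coords_init_left]
  rw [finSumFinEquiv_apply_left, Fin.val_castAdd, coords_init_input]
  simp

end MultiTapeTM

theorem listNum_bitSymbols {W b : ℕ} (a : ℕ) (l : List Bool) (h2 : 2 ^ l.length ≤ W)
    (hb : b ^ l.length ≤ W) (hb0 : 0 < b) :
    listNum b (bitSymbols a l) = Diag.tapeNum W b l.length (bitsVal l) := by
  have e : Diag.tapeNum W b l.length (bitsVal l) = ∑ i ∈ Finset.range l.length,
      (1 + bitsVal l / 2 ^ i % 2) * b ^ (l.length - 1 - i) := by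
    refine Finset.sum_congr rfl fun i hi => ?_
    have hi' := Finset.mem_range.1 hi
    rw [Diag.pw, Diag.pw, min_eq_right ((Nat.pow_le_pow_right (by norm_num) hi'.le).trans h2),
      min_eq_right ((Nat.pow_le_pow_right hb0 (by omega)).trans hb)]
  rw [e]
  clear e h2 hb
  induction l with
  | nil => rfl
  | cons c l ih =>
    show symCode (some (Sum.inl c)) + b * listNum b (bitSymbols a l) = _
    rw [ih, bitsVal_cons, List.length_cons, Finset.sum_range_succ, add_comm, Finset.mul_sum]
    congr 1
    · refine Finset.sum_congr rfl fun i hi => ?_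
      have hi' := Finset.mem_range.1 hi
      have h1 : (c.toNat * 2 ^ l.length + bitsVal l) / 2 ^ i % 2 = bitsVal l / 2 ^ i % 2 := by
        obtain ⟨k, hk⟩ := Nat.exists_eq_add_of_lt hi'
        rw [hk, show c.toNat * 2 ^ (i + k + 1) + bitsVal l =
          bitsVal l + 2 ^ i * (2 * (c.toNat * 2 ^ k)) by rw [pow_succ, pow_add]; ring,
          Nat.add_mul_div_left _ _ (by positivity), Nat.add_mul_mod_self_left]
      rw [h1, show l.length + 1 - 1 - i = l.length - 1 - i + 1 by omega, pow_succ]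
      ring
    · have h1 : (c.toNat * 2 ^ l.length + bitsVal l) / 2 ^ l.length = c.toNat := by
        rw [mul_comm, Nat.mul_add_div (by positivity), Nat.div_eq_of_lt (bitsVal_lt l), add_zero]
      rw [h1]
      cases c <;> simp [symCode]

/-! ### The codes of verifiers -/

theorem listNum_inj {b a : ℕ} (hb : a + 3 ≤ b) : ∀ {l l' : List (TapeSymbol a)},
    l.length = l'.length → listNum b l = listNum b l' → l = l'
  | [], [], _, _ => rfl
  | s :: l, s' :: l', hl, h => by
    have h : symCode s + b * listNum b l = symCode s' + b * listNum b l' := h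
    have h1 := congrArg (fun x => x % b) h
    have h2 := congrArg (fun x => x / b) h
    have hs := (symCode_lt s).trans_le hb
    have hs' := (symCode_lt s').trans_le hb
    simp only [Nat.add_mul_mod_self_left, Nat.mod_eq_of_lt hs, Nat.mod_eq_of_lt hs'] at h1
    simp only [Nat.add_mul_div_left _ _ (show 0 < b by omega), Nat.div_eq_of_lt hs,
      Nat.div_eq_of_lt hs', Nat.zero_add] at h2
    rw [symCode_injective h1, listNum_inj hb (Nat.succ_injective hl) h2]

theorem bitSymbols_injective (a : ℕ) : Function.Injective (bitSymbols a) :=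
  List.map_injective_iff.2 fun _ _ h => Sum.inl_injective (Option.some_injective _ h)

theorem bitsVal_inj : ∀ {z z' : List Bool}, z.length = z'.length → bitsVal z = bitsVal z' → z = z'
  | [], [], _, _ => rfl
  | b :: z, b' :: z', hl, h => by
    have hk : z.length = z'.length := Nat.succ_injective hl
    have h1 := bitsVal_lt z
    have h2 := bitsVal_lt z'
    rw [bitsVal_cons, bitsVal_cons, hk] at h
    rw [hk] at h1
    have hb : b = b' := by
      cases b <;> cases b' <;> simp at h ⊢ <;> omega
    subst hb
    have e : bitsVal z = bitsVal z' := by omega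
    rw [bitsVal_inj hk e]

/-- Bit strings as numbers. -/
noncomputable def bitsEquiv (k : ℕ) : Bits k ≃ Fin (2 ^ k) :=
  Equiv.ofBijective
    (fun x => ⟨bitsVal (List.ofFn x), by simpa using bitsVal_lt (List.ofFn x)⟩)
    ((Fintype.bijective_iff_injective_and_card _).2 ⟨fun x y h => by
      have := bitsVal_inj (by simp) (congrArg Fin.val h)
      exact List.ofFn_injective this, by simp⟩)

theorem coe_bitsEquiv {k : ℕ} (x : Bits k) : (bitsEquiv k x : ℕ) = bitsVal (List.ofFn x) := rfl

theorem tapeNum_bitsEquiv {W b k : ℕ} (a : ℕ) (x : Bits k) (h : b ^ k ≤ W) (hb : a + 3 ≤ b) :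
    Diag.tapeNum W b k (bitsEquiv k x) = listNum b (bitSymbols a (List.ofFn x)) := by
  have h2 : 2 ^ k ≤ W := (Nat.pow_le_pow_left (by omega) k).trans h
  have := listNum_bitSymbols (W := W) (b := b) a (List.ofFn x) (by simpa using h2)
    (by simpa using h) (by omega)
  rw [this, List.length_ofFn, coe_bitsEquiv]

theorem tapeNum_bitsEquiv_inj {W b k : ℕ} {x y : Bits k} (h : b ^ k ≤ W) (hb : 3 ≤ b) :
    Diag.tapeNum W b k (bitsEquiv k x) = Diag.tapeNum W b k (bitsEquiv k y) ↔ x = y := by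
  refine ⟨fun e => ?_, fun e => by rw [e]⟩
  rw [tapeNum_bitsEquiv 0 x h hb, tapeNum_bitsEquiv 0 y h hb] at e
  exact List.ofFn_injective (bitSymbols_injective 0 (listNum_inj hb (by simp [bitSymbols]) e))

namespace MultiTapeTM

variable {m : ℕ} {M : MultiTapeTM m} {e₁ e₂ l t N B W : ℕ}

/-- The bounds within which the universal machine simulates `M` faithfully. -/
structure Fits (M : MultiTapeTM m) (e₁ e₂ l t N B W : ℕ) : Prop where
  code : M.IsCode e₁ e₂
  time : t ≤ N
  digit : M.base ^ (l + t + 1) ≤ B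
  total : B ^ M.dim ≤ W

theorem Fits.base_pow_le (h : M.Fits e₁ e₂ l t N B W) {k : ℕ} (hk : k ≤ l) : M.base ^ k ≤ W := by
  have hb := M.base_ge
  have h1 : M.base ^ k ≤ B := (Nat.pow_le_pow_right (by omega) (by omega)).trans h.digit
  refine (h1.trans ?_).trans h.total
  exact Nat.le_self_pow (by rw [dim]; omega) B

theorem Fits.pw_eq (h : M.Fits e₁ e₂ l t N B W) {i : ℕ} (hi : i < M.dim) :
    Diag.pw W B i = B ^ i := by
  have hb := M.base_ge
  have h1 : 0 < B := (Nat.pow_pos (by omega)).trans_le h.digit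
  exact min_eq_right ((Nat.pow_le_pow_right h1 hi.le).trans h.total)

/-- The interface between arithmetic and machines: below, outputs and verdicts are read off as
digits of the final number. -/
theorem Fits.digit_machRun (h : M.Fits e₁ e₂ l t N B W) {inp : Fin m → List Bool}
    (hl : ∀ j, (inp j).length ≤ l) (ht : M.HaltsWithin inp t) {i : ℕ} (hi : i < M.dim) :
    Diag.digit W B (Diag.machRun W B e₁ e₂ N (M.stateCode M.start +
      ∑ j : Fin m, Diag.tapeNum W M.base (inp j).length (bitsVal (inp j)) *
        Diag.pw W B (2 * j.val + 2))) i = M.coords (M.after inp t) i := by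
  have hb := M.base_ge
  have hc := M.coords_after_lt_of_halts (coords_init_lt M hl) ht h.digit
  have e : M.stateCode M.start + ∑ j : Fin m, Diag.tapeNum W M.base (inp j).length
      (bitsVal (inp j)) * Diag.pw W B (2 * j.val + 2) = M.cfgNum B (M.init inp) := by
    rw [cfgNum_init]
    congr 1
    refine Finset.sum_congr rfl fun j _ => ?_
    have hw := h.base_pow_le (hl j)
    rw [h.pw_eq (by have := j.2; rw [dim]; omega), listNum_bitSymbols M.numAux (inp j)
      ((Nat.pow_le_pow_left (by omega) _).trans hw) hw (by omega)]
  have hbB : M.base ≤ B := by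
    refine le_trans ?_ h.digit
    exact Nat.le_self_pow (by omega) _
  rw [e, h.code.machRun_cfgNum h.total hbB hc, ht.after_eq h.time,
    digit_cfgNum h.total (hc t) hi]

theorem HasOutput.coords_eq {inp : Fin m → List Bool} {j : Fin m} {k : ℕ} {x : Bits k}
    (h : M.HasOutput inp t j (List.ofFn x)) (hW : M.base ^ k ≤ W) :
    M.coords (M.after inp t) (2 * j.val + 2) = Diag.tapeNum W M.base k (bitsEquiv k x) := by
  have := M.coords_right (M.after inp t) (Sum.inl j)
  rw [finSumFinEquiv_apply_left, Fin.val_castAdd] at this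
  rw [this, h, blankNum_mk, tapeNum_bitsEquiv M.numAux x hW M.base_ge]

end MultiTapeTM

namespace Verifier

open MultiTapeTM

variable {r q a t : ℕ → ℕ} (V : Verifier r q a t) (z : List Bool)

/-- The number of seeds for the given questions. -/
noncomputable def seeds (x y : Bits (q z.length)) : ℕ :=
  (Finset.univ.filter fun w => V.questions z w = (x, y)).card

theorem game_μ_toReal (x y : Bits (q z.length)) :
    ((V.game z).μ (x, y)).toReal = V.seeds z x y / 2 ^ r z.length := by
  have : (V.game z).μ (x, y) = ∑ w : Bits (r z.length),
      if V.questions z w = (x, y) then ((2 ^ r z.length : ℕ) : ENNReal)⁻¹ else 0 := by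
    simp only [game, PMF.map_apply, tsum_fintype, PMF.uniformOfFintype_apply]
    refine Finset.sum_congr rfl fun w _ => ?_
    simp [eq_comm]
  rw [this, ← Finset.sum_filter, Finset.sum_const, nsmul_eq_mul, ENNReal.toReal_mul]
  simp [seeds, div_eq_mul_inv]

variable {V z} {e₁ e₂ e₃ e₄ l N B W s : ℕ}

theorem seedCount_eq (h : V.sampler.Fits e₁ e₂ l (t z.length) N B W) (hz : z.length ≤ l)
    (hr : r z.length ≤ l) (hq : q z.length ≤ l) (x y : Bits (q z.length)) :
    Diag.seedCount z.length (bitsVal z) N B W e₁ e₂ (r z.length) (q z.length)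
      (bitsEquiv _ x) (bitsEquiv _ y) = V.seeds z x y := by
  have hb := V.sampler.base_ge
  have h2 : 2 ^ r z.length ≤ W :=
    (Nat.pow_le_pow_left (by omega) _).trans (h.base_pow_le hr)
  rw [Diag.seedCount, Diag.pw, min_eq_right h2, Finset.sum_range, seeds,
    Finset.card_filter, ← (bitsEquiv (r z.length)).sum_comp]
  refine Finset.sum_congr rfl fun w _ => ?_
  have hl : ∀ j, ((![z, List.ofFn w, [], []] : Fin 4 → List Bool) j).length ≤ l := by
    intro j; fin_cases j <;> simp [hz, hr]
  have hend : Diag.sampEnd z.length (bitsVal z) N B W e₁ e₂ (r z.length)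
      (bitsEquiv (r z.length) w) = Diag.machRun W B e₁ e₂ N (V.sampler.stateCode V.sampler.start +
      ∑ j : Fin 4, Diag.tapeNum W V.sampler.base
        ((![z, List.ofFn w, [], []] : Fin 4 → List Bool) j).length
        (bitsVal ((![z, List.ofFn w, [], []] : Fin 4 → List Bool) j)) *
        Diag.pw W B (2 * j.val + 2)) := by
    rw [Diag.sampEnd, h.code.start, h.code.base]
    congr 1
    simp [Fin.sum_univ_four, Diag.tapeNum, coe_bitsEquiv, add_assoc]
  have hd : ∀ i, i < 9 → i < V.sampler.dim := fun i hi => by rw [dim]; omega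
  -- Digits `6` and `8` are the right halves of tapes `2` and `3`, where the sampler leaves the
  -- questions.
  rw [hend, h.digit_machRun hl (V.sampler_halts z w) (hd 6 (by norm_num)),
    h.digit_machRun hl (V.sampler_halts z w) (hd 8 (by norm_num)), h.code.base]
  have o1 := (V.sampler_fst z w).coords_eq (h.base_pow_le hq)
  have o2 := (V.sampler_snd z w).coords_eq (h.base_pow_le hq)
  have o1 : V.sampler.coords (V.sampler.after ![z, List.ofFn w, [], []] (t z.length)) 6 = _ := o1
  have o2 : V.sampler.coords (V.sampler.after ![z, List.ofFn w, [], []] (t z.length)) 8 = _ := o2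
  rw [o1, o2]
  refine if_congr ?_ rfl rfl
  rw [tapeNum_bitsEquiv_inj (h.base_pow_le hq) (by omega),
    tapeNum_bitsEquiv_inj (h.base_pow_le hq) (by omega), Prod.ext_iff]

theorem digit_decEnd (h : V.decider.Fits e₃ e₄ l (t z.length) N B W) (hz : z.length ≤ l)
    (hq : q z.length ≤ l) (ha : a z.length ≤ l) (x y : Bits (q z.length))
    (α β : Bits (a z.length)) :
    Diag.digit W B (Diag.decEnd z.length (bitsVal z) N B W e₃ e₄ (q z.length) (a z.length)
      (bitsEquiv _ x) (bitsEquiv _ y) (bitsEquiv _ α) (bitsEquiv _ β)) 0 % 2 = 1 ↔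
      V.verdict z x y α β = true := by
  set inp : Fin 5 → List Bool := ![z, List.ofFn x, List.ofFn y, List.ofFn α, List.ofFn β]
    with hinp
  have hl : ∀ j, (inp j).length ≤ l := by
    intro j; fin_cases j <;> simp [hinp, hz, hq, ha]
  obtain ⟨hh, hv⟩ := V.decider_spec z x y α β
  have hend : Diag.decEnd z.length (bitsVal z) N B W e₃ e₄ (q z.length) (a z.length)
      (bitsEquiv _ x) (bitsEquiv _ y) (bitsEquiv _ α) (bitsEquiv _ β) =
      Diag.machRun W B e₃ e₄ N (V.decider.stateCode V.decider.start +
      ∑ j : Fin 5, Diag.tapeNum W V.decider.base (inp j).length (bitsVal (inp j)) *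
        Diag.pw W B (2 * j.val + 2)) := by
    rw [Diag.decEnd, h.code.start, h.code.base]
    congr 1
    simp [hinp, Fin.sum_univ_five, coe_bitsEquiv, add_assoc]
  rw [hend, h.digit_machRun hl hh (by rw [dim]; omega), coords_zero, stateCode, hv]
  cases V.verdict z x y α β <;> simp [Nat.add_mod]

theorem loss_eq (h : V.sampler.Fits e₁ e₂ l (t z.length) N B W)
    (h' : V.decider.Fits e₃ e₄ l (t z.length) N B W) (hz : z.length ≤ l)
    (hr : r z.length ≤ l) (hq : q z.length ≤ l) (ha : a z.length ≤ l) (hs : 2 ^ s ≤ W)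
    (x y : Bits (q z.length)) (α β : Bits (a z.length)) :
    Diag.loss z.length (bitsVal z) N B W e₁ e₂ e₃ e₄ (r z.length) (q z.length) (a z.length) s
      (bitsEquiv _ x) (bitsEquiv _ y) (bitsEquiv _ α) (bitsEquiv _ β) =
      if V.verdict z x y α β then 0
      else (V.seeds z x y * (2 ^ s - 1) + (2 ^ r z.length - 1)) / 2 ^ r z.length := by
  have hb := V.sampler.base_ge
  have h2 : 2 ^ r z.length ≤ W :=
    (Nat.pow_le_pow_left (by omega) _).trans (h.base_pow_le hr)
  rw [Diag.loss, seedCount_eq h hz hr hq, Diag.pw, Diag.pw, min_eq_right h2, min_eq_right hs]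
  exact if_congr (digit_decEnd h' hz hq ha x y α β) rfl rfl

/-- This accounts for the choice of `N`, `B` and `W`. The constant `C` exceeds the codes, bases and
dimensions of both machines, so half tapes are below `base ^ (l + t + 1) ≤ 2 ^ (C * (l + t + 1)) ≤ 2
^ N = B`, and configurations below `B ^ dim ≤ 2 ^ (N * N) = W`. -/
theorem exists_fits (V : Verifier r q a t) : ∃ C e₁ e₂ e₃ e₄ : ℕ, ∀ n,
    C * (n + r n + q n + a n + t n + 1) ≤ 2 ^ n → (e₁ < 2 ^ n ∧ e₂ < 2 ^ n ∧ e₃ < 2 ^ n ∧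
      e₄ < 2 ^ n ∧ r n < 2 ^ n ∧ q n < 2 ^ n ∧ a n < 2 ^ n) ∧
      V.sampler.Fits e₁ e₂ (n + r n + q n + a n) (t n) (2 ^ n) (2 ^ 2 ^ n) (2 ^ (2 ^ n * 2 ^ n)) ∧
      V.decider.Fits e₃ e₄ (n + r n + q n + a n) (t n) (2 ^ n) (2 ^ 2 ^ n)
        (2 ^ (2 ^ n * 2 ^ n)) := by
  obtain ⟨e₁, e₂, h₁⟩ := V.sampler.exists_isCode
  obtain ⟨e₃, e₄, h₂⟩ := V.decider.exists_isCode
  set C := e₁ + e₂ + e₃ + e₄ + V.sampler.base + V.decider.base + V.sampler.dim + V.decider.dim + 1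
    with hC
  have key : ∀ {m : ℕ} (M : MultiTapeTM m) (e e' n : ℕ), M.IsCode e e' → M.base ≤ C → M.dim ≤ C →
      C * (n + r n + q n + a n + t n + 1) ≤ 2 ^ n →
      M.Fits e e' (n + r n + q n + a n) (t n) (2 ^ n) (2 ^ 2 ^ n) (2 ^ (2 ^ n * 2 ^ n)) := by
    intro m M e e' n h hb hd hn
    have hC1 : 1 ≤ C := by omega
    refine ⟨h, by nlinarith, ?_, ?_⟩
    · refine (Nat.pow_le_pow_left Nat.lt_two_pow_self.le _).trans ?_
      rw [← pow_mul]
      exact Nat.pow_le_pow_right (by norm_num) (le_trans (Nat.mul_le_mul_right _ hb) hn)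
    · rw [← pow_mul]
      refine Nat.pow_le_pow_right (by norm_num) (Nat.mul_le_mul_left _ ?_)
      nlinarith
  refine ⟨C, e₁, e₂, e₃, e₄, fun n hn => ⟨?_, key _ _ _ n h₁ (by omega) (by omega) hn,
    key _ _ _ n h₂ (by omega) (by omega) hn⟩⟩
  have hC1 : 1 ≤ C := by omega
  have h3 : C + (r n + q n + a n) ≤ C * (n + r n + q n + a n + t n + 1) := by nlinarith
  have : 0 < V.sampler.base := by have := V.sampler.base_ge; omega
  refine ⟨?_, ?_, ?_, ?_, ?_, ?_, ?_⟩ <;> omega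

end Verifier

/-! ### Games with equal rounded tables -/

namespace NonlocalGame

variable {X Y A B : Type}

/-- The probability of the questions, if the answers lose. -/
noncomputable def loss (G : NonlocalGame X Y A B) (x : X) (y : Y) (a : A) (b : B) : ℝ :=
  if G.D x y a b then 0 else (G.μ (x, y)).toReal

/-- Two games whose losing probabilities differ by at most `δ` and have the same support. -/
def Close (δ : ℝ) (G G' : NonlocalGame X Y A B) : Prop :=
  ∀ x y a b, |G.loss x y a b - G'.loss x y a b| ≤ δ ∧ (G.loss x y a b = 0 ↔ G'.loss x y a b = 0)

end NonlocalGame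

theorem roundUp_bounds {c m R : ℕ} (hR : 0 < R) :
    (c : ℝ) / R * m ≤ ((c * m + (R - 1)) / R : ℕ) ∧
      (((c * m + (R - 1)) / R : ℕ) : ℝ) ≤ (c : ℝ) / R * m + 1 := by
  set k := (c * m + (R - 1)) / R with hk
  have h1 : k * R ≤ c * m + (R - 1) := Nat.div_mul_le_self _ _
  have h2 : c * m + (R - 1) < (k + 1) * R := by
    rw [← Nat.div_lt_iff_lt_mul hR]; omega
  have hR' : (0 : ℝ) < R := by exact_mod_cast hR
  have e : (c : ℝ) / R * m = c * m / R := by ring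
  rw [e]
  constructor
  · rw [div_le_iff₀ hR']
    have : c * m ≤ k * R := by rw [Nat.add_mul] at h2; omega
    exact_mod_cast this
  · rw [← sub_le_iff_le_add, le_div_iff₀ hR', sub_mul, sub_le_iff_le_add]
    have : k * R ≤ c * m + 1 * R := by omega
    exact_mod_cast this

/-- Equal rounded probabilities stem from nearby probabilities. -/
theorem close_of_roundUp_eq {P P' : Prop} [Decidable P] [Decidable P'] {c c' s R : ℕ} (hR : 0 < R)
    (hs : 0 < s)
    (h : (if P then 0 else (c * (2 ^ s - 1) + (R - 1)) / R) =
      if P' then 0 else (c' * (2 ^ s - 1) + (R - 1)) / R) :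
    |(if P then 0 else (c : ℝ) / R) - (if P' then 0 else (c' : ℝ) / R)| ≤ 1 / (2 ^ s - 1) ∧
      ((if P then 0 else (c : ℝ) / R) = 0 ↔ (if P' then 0 else (c' : ℝ) / R) = 0) := by
  have hm0 : 1 ≤ 2 ^ s - 1 := by
    have : 2 ^ 1 ≤ 2 ^ s := Nat.pow_le_pow_right (by norm_num) hs
    omega
  have hm1 : ((2 ^ s - 1 : ℕ) : ℝ) = 2 ^ s - 1 := by
    rw [Nat.cast_sub Nat.one_le_two_pow]; simp
  set m := 2 ^ s - 1 with hm
  have hm' : (1 : ℝ) ≤ m := by exact_mod_cast hm0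
  have key : ∀ (P : Prop) [Decidable P] (c : ℕ), ∃ p : ℝ, (if P then 0 else (c : ℝ) / R) = p ∧
      p * m ≤ ((if P then 0 else (c * m + (R - 1)) / R : ℕ) : ℝ) ∧
      ((if P then 0 else (c * m + (R - 1)) / R : ℕ) : ℝ) ≤ p * m + 1 ∧
      (p = 0 ↔ (if P then 0 else (c * m + (R - 1)) / R) = 0) := by
    intro P _ c
    refine ⟨_, rfl, ?_⟩
    split_ifs
    · simp
    · obtain ⟨h1, h2⟩ := roundUp_bounds (c := c) (m := m) hR
      refine ⟨h1, h2, ?_⟩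
      rw [div_eq_zero_iff, Nat.div_eq_zero_iff]
      simp only [Nat.cast_eq_zero]
      constructor
      · rintro (rfl | h)
        · right; omega
        · omega
      · rintro (h | h)
        · omega
        · left
          by_contra hc
          have : 1 ≤ c * m := Nat.mul_pos (by omega) hm0
          omega
  obtain ⟨p, e, h1, h2, h3⟩ := key P c
  obtain ⟨p', e', h1', h2', h3'⟩ := key P' c'
  rw [e, e', h3, h3', h, ← hm1]
  refine ⟨?_, Iff.rfl⟩
  rw [h] at h1 h2
  rw [le_div_iff₀ (by linarith), ← abs_of_pos (show (0 : ℝ) < m by linarith), ← abs_mul, abs_le,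
    sub_mul]
  constructor <;> linarith

namespace Verifier

variable {r q a t : ℕ → ℕ}

/-- The types of the two games depend on `z.length` and `z'.length` and cannot be compared directly.
Both games are therefore replaced by copies over the common length `n` with the same values. -/
theorem close_of_same (V : Verifier r q a t) {e₁ e₂ e₃ e₄ l N B W s n : ℕ}
    (h : V.sampler.Fits e₁ e₂ l (t n) N B W) (h' : V.decider.Fits e₃ e₄ l (t n) N B W)
    (hn : n ≤ l) (hr : r n ≤ l) (hq : q n ≤ l) (ha : a n ≤ l) (hs : 2 ^ s ≤ W) (hs0 : 0 < s)
    {z z' : List Bool} (hz : z.length = n) (hz' : z'.length = n)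
    (hsame : Diag.Same n N B W e₁ e₂ e₃ e₄ (r n) (q n) (a n) s (bitsVal z) (bitsVal z')) :
    ∃ G G' : NonlocalGame (Bits (q n)) (Bits (q n)) (Bits (a n)) (Bits (a n)),
      (G.val = (V.game z).val ∧ G.syncVal = (V.game z).syncVal) ∧
      (G'.val = (V.game z').val ∧ G'.syncVal = (V.game z').syncVal) ∧
      G.Close (1 / (2 ^ s - 1)) G' := by
  have key : ∀ z : List Bool, z.length = n → ∃ G : NonlocalGame (Bits (q n)) (Bits (q n))
      (Bits (a n)) (Bits (a n)), (G.val = (V.game z).val ∧ G.syncVal = (V.game z).syncVal) ∧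
      ∃ c : Bits (q n) → Bits (q n) → ℕ, (∀ x y, (G.μ (x, y)).toReal = c x y / 2 ^ r n) ∧
        ∀ x y α β, Diag.loss n (bitsVal z) N B W e₁ e₂ e₃ e₄ (r n) (q n) (a n) s
          (bitsEquiv _ x) (bitsEquiv _ y) (bitsEquiv _ α) (bitsEquiv _ β) =
          if G.D x y α β then 0 else (c x y * (2 ^ s - 1) + (2 ^ r n - 1)) / 2 ^ r n := by
    rintro z rfl
    exact ⟨V.game z, ⟨rfl, rfl⟩, V.seeds z, V.game_μ_toReal z, loss_eq h h' hn hr hq ha hs⟩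
  obtain ⟨G, hv, c, hμ, hl⟩ := key z hz
  obtain ⟨G', hv', c', hμ', hl'⟩ := key z' hz'
  refine ⟨G, G', hv, hv', fun x y α β => ?_⟩
  have hb := V.sampler.base_ge
  have hW : ∀ k ≤ l, 2 ^ k ≤ W := fun k hk =>
    (Nat.pow_le_pow_left (by omega) _).trans (h.base_pow_le hk)
  have hpw : ∀ k ≤ l, ∀ x : Bits k, (bitsEquiv k x : ℕ) < Diag.pw W 2 k := fun k hk x =>
    lt_min ((bitsEquiv k x).2.trans_le (hW k hk)) (bitsEquiv k x).2
  have e := hsame _ (hpw _ hq x) _ (hpw _ hq y) _ (hpw _ ha α) _ (hpw _ ha β)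
  rw [hl, hl'] at e
  have := close_of_roundUp_eq (by positivity) hs0 e
  simp only [NonlocalGame.loss, hμ, hμ']
  push_cast at this
  exact this

end Verifier

/-! ### The diagonal language exists -/

theorem exists_lt_forall_notMem {ι : Type*} [Fintype ι] (bad : ι → Finset ℕ) {K M : ℕ}
    (hK : ∀ i, (bad i).card ≤ K) (hM : Fintype.card ι * K < M) : ∃ l < M, ∀ i, l ∉ bad i := by
  classical
  have h : (Finset.univ.biUnion bad).card < (Finset.range M).card := by
    rw [Finset.card_range]
    exact (Finset.card_biUnion_le_card_mul _ _ _ fun i _ => hK i).trans_lt hM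
  obtain ⟨l, hl, hl'⟩ := Finset.exists_mem_notMem_of_card_lt_card h
  exact ⟨l, Finset.mem_range.1 hl, fun i hi => hl' (Finset.mem_biUnion.2 ⟨i, Finset.mem_univ _, hi⟩)⟩

theorem Nat.eq_of_bits_eq {N l l' : ℕ} (hl : l < 2 ^ N) (hl' : l' < 2 ^ N)
    (h : ∀ z < N, l / 2 ^ z % 2 = l' / 2 ^ z % 2) : l = l' := by
  refine Nat.eq_of_testBit_eq fun z => ?_
  rcases lt_or_ge z N with hz | hz
  · rw [Nat.testBit_eq_decide_div_mod_eq, Nat.testBit_eq_decide_div_mod_eq, h z hz]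
  · rw [Nat.testBit_lt_two_pow (hl.trans_le (Nat.pow_le_pow_right (by norm_num) hz)),
      Nat.testBit_lt_two_pow (hl'.trans_le (Nat.pow_le_pow_right (by norm_num) hz))]

/-- At most `2 ^ K` sets of numbers are unions of classes, if there are at most `K` classes. -/
theorem card_saturated_le {T : Type*} [Fintype T] (N K : ℕ) (Φ : ℕ → T) (hK : Fintype.card T ≤ K)
    (s : Finset ℕ) (hs : ∀ l ∈ s, l < 2 ^ N ∧ ∀ z < N, ∀ z' < N, l / 2 ^ z % 2 = 1 →
      l / 2 ^ z' % 2 = 0 → Φ z ≠ Φ z') : s.card ≤ 2 ^ K := by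
  classical
  have h1 : s.card ≤ (Finset.univ : Finset (Finset T)).card := by
    -- A union of classes is determined by the set of classes that it meets.
    refine Finset.card_le_card_of_injOn
      (fun l => ((Finset.range N).filter fun z => l / 2 ^ z % 2 = 1).image Φ)
      (fun _ _ => Finset.mem_univ _) fun l hl l' hl' h => ?_
    have key : ∀ l ∈ s, ∀ l' ∈ s,
        ((Finset.range N).filter fun z => l / 2 ^ z % 2 = 1).image Φ =
          ((Finset.range N).filter fun z => l' / 2 ^ z % 2 = 1).image Φ →
        ∀ z < N, l / 2 ^ z % 2 = 1 → l' / 2 ^ z % 2 = 1 := by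
      intro l hl l' hl' h z hz hb
      have : Φ z ∈ ((Finset.range N).filter fun z => l' / 2 ^ z % 2 = 1).image Φ := by
        rw [← h]
        exact Finset.mem_image_of_mem _ (Finset.mem_filter.2 ⟨Finset.mem_range.2 hz, hb⟩)
      obtain ⟨y, hy, e⟩ := Finset.mem_image.1 this
      obtain ⟨hy1, hy2⟩ := Finset.mem_filter.1 hy
      by_contra hc
      exact (hs l' hl').2 y (Finset.mem_range.1 hy1) z hz hy2 (by omega) e
    refine Nat.eq_of_bits_eq (hs l hl).1 (hs l' hl').1 fun z hz => ?_
    have h2 := key l hl l' hl' h z hz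
    have h3 := key l' hl' l hl h.symm z hz
    omega
  refine h1.trans ?_
  rw [Finset.card_univ, Fintype.card_finset]
  exact Nat.pow_le_pow_right (by norm_num) hK

namespace Diag

/-- At most all seeds produce the given questions, so the rounded probability is at most `2 ^ s -
1`. This holds for arbitrary numbers `e₁, …, e₄`, even if they are not codes of machines, as the
counting requires. -/
theorem loss_lt (n x N B : ℕ) {W : ℕ} (hW : 0 < W) (e₁ e₂ e₃ e₄ r q a s u v α β : ℕ) :
    loss n x N B W e₁ e₂ e₃ e₄ r q a s u v α β < 2 ^ s := by
  have hp : ∀ k, 0 < pw W 2 k := fun k => lt_min hW (by positivity)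
  have h1 : seedCount n x N B W e₁ e₂ r q u v ≤ pw W 2 r := by
    refine (Finset.sum_le_card_nsmul _ _ 1 fun i _ => ?_).trans (by simp)
    split_ifs <;> simp
  rw [loss]
  split_ifs
  · positivity
  · refine lt_of_lt_of_le ?_ (min_le_right W (2 ^ s))
    rw [Nat.div_lt_iff_lt_mul (hp r)]
    have h2 := Nat.mul_le_mul_right (pw W 2 s - 1) h1
    have h3 := hp s
    have h4 := hp r
    obtain ⟨k, hk⟩ := Nat.exists_eq_add_of_lt h3
    have hk : pw W 2 s = k + 1 := by omega
    change _ < pw W 2 s * _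
    rw [hk] at h2 ⊢
    rw [Nat.add_sub_cancel] at h2 ⊢
    rw [Nat.add_mul, mul_comm k]
    omega

/-- The counting argument. Each choice of the eight parameters below `2 ^ n` allows at most `2 ^ (n
- 1)` tables and so spoils at most `2 ^ 2 ^ (n - 1)` sets. A good set remains because `8 * n + 2 ^
(n - 1) < 2 ^ n`, which holds from `n = 7` on. -/
theorem exists_good {n : ℕ} (hn : 7 ≤ n) :
    ∃ l < 2 ^ 2 ^ n, Good n (2 ^ n) (2 ^ 2 ^ n) (2 ^ (2 ^ n * 2 ^ n)) l := by
  classical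
  set N := 2 ^ n with hN
  set B := 2 ^ N with hB
  set W := 2 ^ (N * N) with hW
  have hW0 : 0 < W := by positivity
  have hnN : n < N := Nat.lt_two_pow_self
  have hNN : N ≤ N * N := Nat.le_mul_self N
  have hNW : N < W := hNN.trans_lt Nat.lt_two_pow_self
  have hpwz : ∀ z < N, pw W 2 z = 2 ^ z := fun z hz =>
    min_eq_right (Nat.pow_le_pow_right (by norm_num) (hz.le.trans hNN))
  set bad : (Fin 8 → Fin N) → Finset ℕ := fun v => (Finset.range B).filter fun l =>
    (v 7 : ℕ) * pw W 4 (v 5 + v 6) < n ∧ ∀ z < N, ∀ z' < N, l / 2 ^ z % 2 = 1 →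
      l / 2 ^ z' % 2 = 0 → ¬ Same n N B W (v 0) (v 1) (v 2) (v 3) (v 4) (v 5) (v 6) (v 7) z z'
    with hbad
  have hcard : ∀ v, (bad v).card ≤ 2 ^ (2 ^ (n - 1)) := by
    intro v
    by_cases hv : (v 7 : ℕ) * pw W 4 (v 5 + v 6) < n
    swap
    · rw [hbad]; simp [hv]
    have hv' : (v 7 : ℕ) * 4 ^ ((v 5 : ℕ) + v 6) < n := by
      -- If the power reaches the cut-off `W > n`, the condition forces `s = 0`, and the inequality
      -- without cut-off is trivial.
      rcases le_total (4 ^ ((v 5 : ℕ) + v 6)) W with h | h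
      · rwa [pw, min_eq_right h] at hv
      · rw [pw, min_eq_left h] at hv
        rcases Nat.eq_zero_or_pos (v 7 : ℕ) with h0 | h0
        · rw [h0]; omega
        · nlinarith
    refine card_saturated_le (T := Fin (pw W 2 (v 5)) × Fin (pw W 2 (v 5)) × Fin (pw W 2 (v 6)) ×
      Fin (pw W 2 (v 6)) → Fin (2 ^ (v 7 : ℕ))) N _ (fun z p =>
      ⟨loss n z N B W (v 0) (v 1) (v 2) (v 3) (v 4) (v 5) (v 6) (v 7) p.1 p.2.1 p.2.2.1 p.2.2.2,
        loss_lt _ _ _ _ hW0 _ _ _ _ _ _ _ _ _ _ _ _⟩) ?_ _ fun l hl => ?_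
    · simp only [Fintype.card_fun, Fintype.card_fin, Fintype.card_prod]
      rw [← pow_mul]
      refine Nat.pow_le_pow_right (by norm_num) ?_
      have h1 : pw W 2 (v 5) ≤ 2 ^ (v 5 : ℕ) := min_le_right _ _
      have h2 : pw W 2 (v 6) ≤ 2 ^ (v 6 : ℕ) := min_le_right _ _
      have h3 : pw W 2 (v 5) * (pw W 2 (v 5) * (pw W 2 (v 6) * pw W 2 (v 6))) ≤
          4 ^ ((v 5 : ℕ) + v 6) := by
        rw [show 4 ^ ((v 5 : ℕ) + v 6) = 2 ^ (v 5 : ℕ) * (2 ^ (v 5 : ℕ) *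
          (2 ^ (v 6 : ℕ) * 2 ^ (v 6 : ℕ))) by
          rw [show (4 : ℕ) = 2 ^ 2 by norm_num, ← pow_mul]; ring]
        gcongr
      have := Nat.mul_le_mul_left (v 7 : ℕ) h3
      omega
    · rw [hbad] at hl
      simp only [Finset.mem_filter, Finset.mem_range] at hl
      refine ⟨hl.1, fun z hz z' hz' h1 h2 e => hl.2.2 z hz z' hz' h1 h2 ?_⟩
      intro u hu w hw α hα β hβ
      exact congrArg Fin.val (congrFun e (⟨u, hu⟩, ⟨w, hw⟩, ⟨α, hα⟩, ⟨β, hβ⟩))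
  have htot : Fintype.card (Fin 8 → Fin N) * 2 ^ (2 ^ (n - 1)) < B := by
    rw [Fintype.card_fun, Fintype.card_fin, Fintype.card_fin, hB, hN, ← pow_mul, ← pow_add]
    refine Nat.pow_lt_pow_right (by norm_num) ?_
    have h8 : ∀ m, 6 ≤ m → 8 * (m + 1) < 2 ^ m := by
      intro m hm
      induction m, hm using Nat.le_induction with
      | base => norm_num
      | succ m hm ih => rw [pow_succ]; omega
    have := h8 (n - 1) (by omega)
    obtain ⟨m, rfl⟩ : ∃ m, n = m + 1 := ⟨n - 1, by omega⟩
    rw [Nat.add_sub_cancel] at this ⊢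
    rw [pow_succ]; omega
  obtain ⟨l, hl, h⟩ := exists_lt_forall_notMem bad hcard htot
  refine ⟨l, hl, fun e₁ h₁ e₂ h₂ e₃ h₃ e₄ h₄ r hr q hq a ha s hs hlt => ?_⟩
  have := h ![⟨e₁, h₁⟩, ⟨e₂, h₂⟩, ⟨e₃, h₃⟩, ⟨e₄, h₄⟩, ⟨r, hr⟩, ⟨q, hq⟩, ⟨a, ha⟩, ⟨s, hs⟩]
  rw [hbad] at this
  simp only [Finset.mem_filter, Finset.mem_range, not_and, not_forall, not_not] at this
  obtain ⟨z, hz, z', hz', b1, b2, hsame⟩ := this hl hlt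
  refine ⟨z, hz, z', hz', ?_, ?_, hsame⟩
  · rwa [hpwz z hz]
  · rwa [hpwz z' hz']

/-- The diagonal language. -/
def lang : Set (List Bool) := expLang fun v => InLang (v 0) (v 1) (v 2) (v 3) (v 4)

theorem exists_same_of_lt {n e₁ e₂ e₃ e₄ r q a s : ℕ} (hn : 7 ≤ n) (h₁ : e₁ < 2 ^ n)
    (h₂ : e₂ < 2 ^ n) (h₃ : e₃ < 2 ^ n) (h₄ : e₄ < 2 ^ n) (hr : r < 2 ^ n) (hq : q < 2 ^ n)
    (ha : a < 2 ^ n) (hs : s < 2 ^ n) (hlt : s * 4 ^ (q + a) < n) :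
    ∃ z z' : List Bool, z.length = n ∧ z'.length = n ∧ z ∈ lang ∧ z' ∉ lang ∧
      Same n (2 ^ n) (2 ^ 2 ^ n) (2 ^ (2 ^ n * 2 ^ n)) e₁ e₂ e₃ e₄ r q a s
        (bitsVal z) (bitsVal z') := by
  classical
  have hex := exists_good hn
  obtain ⟨hl, hgood⟩ := Nat.find_spec hex
  have hmin : ∀ l' < Nat.find hex, ¬ Good n (2 ^ n) (2 ^ 2 ^ n) (2 ^ (2 ^ n * 2 ^ n)) l' :=
    fun l' h hg => Nat.find_min hex h ⟨h.trans hl, hg⟩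
  obtain ⟨z, hz, z', hz', b1, b2, hsame⟩ := hgood e₁ h₁ e₂ h₂ e₃ h₃ e₄ h₄ r hr q hq a ha s hs
    ((Nat.mul_le_mul_left s (min_le_right _ _)).trans_lt hlt)
  have hstr : ∀ z < 2 ^ n, ∃ w : List Bool, w.length = n ∧ bitsVal w = z := fun z hz =>
    ⟨List.ofFn ((bitsEquiv n).symm ⟨z, hz⟩), by simp, by rw [← coe_bitsEquiv]; simp⟩
  obtain ⟨w, hw, rfl⟩ := hstr z hz
  obtain ⟨w', hw', rfl⟩ := hstr z' hz'
  refine ⟨w, w', hw, hw', ?_, ?_, hsame⟩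
  · show InLang w.length (bitsVal w) (2 ^ w.length) (2 ^ 2 ^ w.length)
      (2 ^ (2 ^ w.length * 2 ^ w.length))
    rw [hw]
    exact ⟨_, hl, hgood, hmin, b1⟩
  · show ¬ InLang w'.length (bitsVal w') (2 ^ w'.length) (2 ^ 2 ^ w'.length)
      (2 ^ (2 ^ w'.length * 2 ^ w'.length))
    rw [hw']
    rintro ⟨l, -, hg, hm, b⟩
    have : l = Nat.find hex := by
      rcases lt_trichotomy l (Nat.find hex) with h | h | h
      · exact absurd hg (hmin l h)
      · exact h
      · exact absurd hgood (hm _ h)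
    rw [this, b2] at b
    omega

end Diag

/-! ### Values of nearby games -/

namespace NonlocalGame

theorem loss_nonneg {X Y A B : Type} (G : NonlocalGame X Y A B) (x : X) (y : Y) (a : A) (b : B) :
    0 ≤ G.loss x y a b := by
  rw [loss]; split_ifs <;> simp

theorem sum_μ {X Y A B : Type} [Fintype X] [Fintype Y] (G : NonlocalGame X Y A B) :
    ∑ x, ∑ y, (G.μ (x, y)).toReal = 1 := by
  rw [← Fintype.sum_prod_type', ← ENNReal.toReal_sum fun _ _ => G.μ.apply_ne_top _]
  have := G.μ.tsum_coe
  rw [tsum_fintype] at this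
  rw [this, ENNReal.toReal_one]

variable {X Y A B : Type} [Fintype X] [Fintype Y] [Fintype A] [Fintype B]

/-- The conditional distributions of the answers, given the questions. -/
structure IsCorrelation (p : X → Y → A → B → ℝ) : Prop where
  nonneg : ∀ x y a b, 0 ≤ p x y a b
  sum_eq_one : ∀ x y, ∑ a, ∑ b, p x y a b = 1

/-- The winning probability of a correlation. -/
noncomputable def win (G : NonlocalGame X Y A B) (p : X → Y → A → B → ℝ) : ℝ :=
  ∑ x, ∑ y, ∑ a, ∑ b, (G.μ (x, y)).toReal * (if G.D x y a b then 1 else 0) * p x y a b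

variable {G G' : NonlocalGame X Y A B} {p : X → Y → A → B → ℝ} {δ : ℝ}

/-- The bridge from values to tables: up to the constant `1`, the winning probability is a linear
function of the losses. -/
theorem win_add (G : NonlocalGame X Y A B) (hp : IsCorrelation p) :
    G.win p + ∑ x, ∑ y, ∑ a, ∑ b, G.loss x y a b * p x y a b = 1 := by
  rw [win]
  simp only [← Finset.sum_add_distrib]
  refine Eq.trans ?_ G.sum_μ
  refine Finset.sum_congr rfl fun x _ => Finset.sum_congr rfl fun y _ => ?_
  have h : ∀ a b, (G.μ (x, y)).toReal * (if G.D x y a b then 1 else 0) * p x y a b +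
      G.loss x y a b * p x y a b = (G.μ (x, y)).toReal * p x y a b := fun a b => by
    rw [loss]; split_ifs <;> ring
  simp only [h, ← Finset.mul_sum, hp.sum_eq_one, mul_one]

theorem sum_loss_nonneg (G : NonlocalGame X Y A B) (hp : IsCorrelation p) :
    0 ≤ ∑ x, ∑ y, ∑ a, ∑ b, G.loss x y a b * p x y a b :=
  Finset.sum_nonneg fun x _ => Finset.sum_nonneg fun y _ => Finset.sum_nonneg fun a _ =>
    Finset.sum_nonneg fun b _ => mul_nonneg (G.loss_nonneg x y a b) (hp.nonneg x y a b)

theorem win_le_one (G : NonlocalGame X Y A B) (hp : IsCorrelation p) : G.win p ≤ 1 := by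
  have := G.win_add hp
  have := G.sum_loss_nonneg hp
  linarith

/-- The answer probabilities sum to `1` for each pair of questions, so each pair contributes an
error of at most `δ`, independently of the number of answers. -/
theorem Close.win_le (h : G.Close δ G') (hp : IsCorrelation p) :
    G.win p ≤ G'.win p + Fintype.card X * (Fintype.card Y * δ) := by
  have h1 := G.win_add hp
  have h2 := G'.win_add hp
  have h3 : ∑ x, ∑ y, ∑ a, ∑ b, G'.loss x y a b * p x y a b ≤
      ∑ x, ∑ y, ∑ a, ∑ b, (G.loss x y a b * p x y a b + δ * p x y a b) := by
    refine Finset.sum_le_sum fun x _ => Finset.sum_le_sum fun y _ => Finset.sum_le_sum fun a _ =>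
      Finset.sum_le_sum fun b _ => ?_
    rw [← add_mul]
    refine mul_le_mul_of_nonneg_right ?_ (hp.nonneg x y a b)
    have := (abs_le.1 (h x y a b).1).1
    linarith
  simp only [Finset.sum_add_distrib, ← Finset.mul_sum, hp.sum_eq_one, mul_one, Finset.sum_const,
    Finset.card_univ, nsmul_eq_mul] at h3
  linarith

theorem Close.exists_loss_le (h : G.Close δ G') :
    ∃ K : ℝ, 0 < K ∧ ∀ x y a b, G'.loss x y a b ≤ K * G.loss x y a b := by
  set f : X × Y × A × B → ℝ := fun w =>
    G'.loss w.1 w.2.1 w.2.2.1 w.2.2.2 / G.loss w.1 w.2.1 w.2.2.1 w.2.2.2 with hf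
  have hf0 : ∀ w, 0 ≤ f w := fun w => div_nonneg (G'.loss_nonneg _ _ _ _) (G.loss_nonneg _ _ _ _)
  -- The sum of all ratios bounds each of them. Ratios with denominator `0` are `0` by convention;
  -- there the common support gives the claim.
  refine ⟨1 + ∑ w, f w, add_pos_of_pos_of_nonneg one_pos (Finset.sum_nonneg fun w _ => hf0 w),
    fun x y a b => ?_⟩
  rcases (G.loss_nonneg x y a b).eq_or_lt with h0 | h0
  · rw [← h0, (h x y a b).2.1 h0.symm, mul_zero]
  · rw [← div_le_iff₀ h0]
    have := Finset.single_le_sum (fun w _ => hf0 w) (Finset.mem_univ (x, y, a, b))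
    have : G'.loss x y a b / G.loss x y a b ≤ ∑ w, f w := this
    linarith

section

variable {ι : Type*} {P : ι → X → Y → A → B → ℝ}

theorem bddAbove_win (G : NonlocalGame X Y A B) (hP : ∀ i, IsCorrelation (P i)) :
    BddAbove (Set.range fun i => G.win (P i)) :=
  ⟨1, by rintro _ ⟨i, rfl⟩; exact G.win_le_one (hP i)⟩

theorem Close.iSup_win_le (h : G.Close δ G') (hδ : 0 ≤ δ) (hP : ∀ i, IsCorrelation (P i)) :
    ⨆ i, G.win (P i) ≤ (⨆ i, G'.win (P i)) + Fintype.card X * (Fintype.card Y * δ) := by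
  rcases isEmpty_or_nonempty ι with _ | _
  · rw [Real.iSup_of_isEmpty, Real.iSup_of_isEmpty]; positivity
  · exact ciSup_le fun i => (h.win_le (hP i)).trans
      (add_le_add_left (le_ciSup (G'.bddAbove_win hP) i) _)

/-- The supremum need not be attained, so a single perfect strategy cannot be transferred. But the
losing probability in `G'` is at most `K` times that in `G`, and strategies with losses tending to
`0` in one game do the same in the other. -/
theorem Close.iSup_win_eq_one (h : G.Close δ G') (hP : ∀ i, IsCorrelation (P i))
    (h1 : ⨆ i, G.win (P i) = 1) : ⨆ i, G'.win (P i) = 1 := by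
  rcases isEmpty_or_nonempty ι with _ | _
  -- Without strategies the supremum is `0` by convention.
  · rw [Real.iSup_of_isEmpty] at h1; exact absurd h1 zero_ne_one
  obtain ⟨K, hK, hle⟩ := h.exists_loss_le
  refine le_antisymm (ciSup_le fun i => G'.win_le_one (hP i)) (le_of_forall_pos_lt_add fun ε hε => ?_)
  obtain ⟨i, hi⟩ := exists_lt_of_lt_ciSup (show 1 - ε / K < ⨆ i, G.win (P i) by
    rw [h1]; have := div_pos hε hK; linarith)
  have e1 := G.win_add (hP i)
  have e2 := G'.win_add (hP i)
  have e3 : ∑ x, ∑ y, ∑ a, ∑ b, G'.loss x y a b * P i x y a b ≤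
      K * ∑ x, ∑ y, ∑ a, ∑ b, G.loss x y a b * P i x y a b := by
    simp only [Finset.mul_sum, ← mul_assoc]
    exact Finset.sum_le_sum fun x _ => Finset.sum_le_sum fun y _ => Finset.sum_le_sum fun a _ =>
      Finset.sum_le_sum fun b _ => mul_le_mul_of_nonneg_right (hle x y a b) ((hP i).nonneg x y a b)
  have e4 : K * ∑ x, ∑ y, ∑ a, ∑ b, G.loss x y a b * P i x y a b < K * (ε / K) :=
    mul_lt_mul_of_pos_left (by linarith) hK
  rw [mul_div_cancel₀ _ hK.ne'] at e4
  have e5 := le_ciSup (G'.bddAbove_win hP) i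
  linarith

end

end NonlocalGame

section

open scoped ComplexOrder

variable {X Y A B : Type} [Fintype A] [Fintype B]

/-- The correlation of a measurement of a bipartite state. -/
noncomputable def correlation {dA dB : ℕ} (ψ : Fin dA × Fin dB → ℂ)
    (MA : X → A → Matrix (Fin dA) (Fin dA) ℂ) (MB : Y → B → Matrix (Fin dB) (Fin dB) ℂ)
    (x : X) (y : Y) (a : A) (b : B) : ℝ :=
  (star ψ ⬝ᵥ (Matrix.kronecker (MA x a) (MB y b)).mulVec ψ).re

/-- Nothing else about quantum strategies enters, which is why one comparison covers both the tensor
product and the synchronous value. -/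
theorem isCorrelation_correlation {dA dB : ℕ} {ψ : Fin dA × Fin dB → ℂ}
    {MA : X → A → Matrix (Fin dA) (Fin dA) ℂ} {MB : Y → B → Matrix (Fin dB) (Fin dB) ℂ}
    (unit : star ψ ⬝ᵥ ψ = 1) (posA : ∀ x a, (MA x a).PosSemidef) (posB : ∀ y b, (MB y b).PosSemidef)
    (sumA : ∀ x, ∑ a, MA x a = 1) (sumB : ∀ y, ∑ b, MB y b = 1) :
    NonlocalGame.IsCorrelation (correlation ψ MA MB) where
  nonneg x y a b := ((posA x a).kronecker (posB y b)).re_dotProduct_nonneg ψ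
  sum_eq_one x y := by
    have h : ∑ a, ∑ b, Matrix.kronecker (MA x a) (MB y b) = 1 := by
      ext ⟨i, j⟩ ⟨i', j'⟩
      have h1 := congrFun (congrFun (sumA x) i) i'
      have h2 := congrFun (congrFun (sumB y) j) j'
      simp only [Matrix.sum_apply] at h1 h2 ⊢
      simp only [Matrix.kronecker, Matrix.kroneckerMap_apply, ← Finset.mul_sum, ← Finset.sum_mul,
        h1, h2]
      rw [← Matrix.one_kronecker_one]
      rfl
    simp only [correlation, ← Complex.re_sum, ← dotProduct_sum, ← Matrix.sum_mulVec]
    rw [h, Matrix.one_mulVec, unit, Complex.one_re]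

theorem star_maxEntangled_dotProduct {d : ℕ} (hd : 0 < d) :
    star (maxEntangled d) ⬝ᵥ maxEntangled d = 1 := by
  have hd' : (0 : ℝ) < d := by exact_mod_cast hd
  have h : ∀ p : Fin d × Fin d, star (maxEntangled d) p * maxEntangled d p =
      if p.1 = p.2 then (((d : ℝ)⁻¹ : ℝ) : ℂ) else 0 := fun p => by
    simp only [Pi.star_apply, maxEntangled]
    split_ifs
    · rw [RCLike.star_def, Complex.conj_ofReal, ← Complex.ofReal_mul, ← mul_inv,
        Real.mul_self_sqrt hd'.le]
    · simp
  simp only [dotProduct, h, Fintype.sum_prod_type]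
  simp [hd.ne']

theorem Strategy.isCorrelation (S : Strategy X Y A B) :
    NonlocalGame.IsCorrelation (correlation S.ψ S.MA S.MB) :=
  isCorrelation_correlation S.unit S.posA S.posB S.sumA S.sumB

theorem SyncStrategy.isCorrelation (S : SyncStrategy X A) :
    NonlocalGame.IsCorrelation
      (correlation (maxEntangled S.d) S.P fun y b => (S.P y b).transpose) := by
  have hpos : ∀ x a, (S.P x a).PosSemidef := fun x a => by
    have := Matrix.posSemidef_conjTranspose_mul_self (S.P x a)
    rwa [S.herm x a, S.proj x a] at this
  refine isCorrelation_correlation (star_maxEntangled_dotProduct S.d_pos) hpos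
    (fun y b => (hpos y b).transpose) S.sum fun y => ?_
  rw [← Matrix.transpose_sum, S.sum, Matrix.transpose_one]

namespace NonlocalGame

variable {δ : ℝ} [Fintype X] [Fintype Y]

theorem Close.val_le {G G' : NonlocalGame X Y A B} (h : G.Close δ G') (hδ : 0 ≤ δ) :
    G.val ≤ G'.val + Fintype.card X * (Fintype.card Y * δ) :=
  h.iSup_win_le hδ fun S : Strategy X Y A B => S.isCorrelation

theorem Close.val_eq_one {G G' : NonlocalGame X Y A B} (h : G.Close δ G') (h1 : G.val = 1) :
    G'.val = 1 :=
  h.iSup_win_eq_one (fun S : Strategy X Y A B => S.isCorrelation) h1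

theorem Close.syncVal_eq_one {G G' : NonlocalGame X X A A} (h : G.Close δ G')
    (h1 : G.syncVal = 1) : G'.syncVal = 1 :=
  h.iSup_win_eq_one (fun S : SyncStrategy X A => S.isCorrelation) h1

end NonlocalGame

end

/-! ### Asymptotics of logarithmic communication -/

open Filter Asymptotics in
theorem Polynomial.eventually_eval_le_two_pow (p : Polynomial ℕ) :
    ∀ᶠ n : ℕ in atTop, p.eval n ≤ 2 ^ n := by
  have h : (fun n : ℕ => ((p.eval n : ℕ) : ℝ)) =o[atTop] fun n : ℕ => (2 : ℝ) ^ n := by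
    induction p using Polynomial.induction_on' with
    | add p q hp hq => simpa using hp.add hq
    | monomial k a =>
      simp only [Polynomial.eval_monomial, Nat.cast_mul, Nat.cast_pow]
      exact (isLittleO_pow_const_const_pow_of_one_lt k one_lt_two).const_mul_left _
  filter_upwards [h.bound one_pos] with n hn
  rw [one_mul, Real.norm_of_nonneg (by positivity), Real.norm_of_nonneg (by positivity)] at hn
  exact_mod_cast hn

open Filter Asymptotics in
/-- A logarithmic number of bits has fewer than `n` configurations. -/
theorem eventually_mul_four_pow_lt {γ : ℝ} (hγ : γ < 1 / 2) (k : ℕ) :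
    ∀ᶠ n : ℕ in atTop, ∀ u : ℕ, (u : ℝ) ≤ γ * Real.logb 2 n → (2 * u + k) * 4 ^ u < n := by
  -- The hypothesis `γ < 1 / 2` is decisive here: `4 ^ u ≤ n ^ (2 * γ)` leaves the factor `n ^ (1 -
  -- 2 * γ)`, a positive power, to dominate the logarithmic `2 * u + k`.
  have h1 : (fun x : ℝ => 2 * γ / Real.log 2 * Real.log x + k) =o[atTop]
      fun x => x ^ (1 - 2 * γ) :=
    ((isLittleO_log_rpow_atTop (by linarith)).const_mul_left _).add
      ((isLittleO_const_left.2 (Or.inr (tendsto_norm_atTop_atTop.comp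
        (tendsto_rpow_atTop (by linarith))))))
  have h2 := (h1.bound (show (0 : ℝ) < 1 / 2 by norm_num))
  filter_upwards [tendsto_natCast_atTop_atTop.eventually h2, eventually_gt_atTop 0] with n hn hn0 u hu
  have hn0' : (0 : ℝ) < n := by exact_mod_cast hn0
  rw [Real.norm_of_nonneg (show (0 : ℝ) ≤ (n : ℝ) ^ (1 - 2 * γ) by positivity)] at hn
  have h3 : (2 * (u : ℝ) + k) ≤ 1 / 2 * (n : ℝ) ^ (1 - 2 * γ) := by
    refine le_trans ?_ ((Real.le_norm_self _).trans hn)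
    rw [Real.logb] at hu
    have : 2 * γ / Real.log 2 * Real.log n = 2 * (γ * (Real.log n / Real.log 2)) := by ring
    rw [this]
    linarith
  have h4 : (4 : ℝ) ^ u ≤ (n : ℝ) ^ (2 * γ) := by
    have e1 : (4 : ℝ) ^ u = 2 ^ (2 * (u : ℝ)) := by
      rw [Real.rpow_mul (by norm_num), Real.rpow_natCast]; norm_num
    have e2 : (n : ℝ) ^ (2 * γ) = 2 ^ (Real.logb 2 n * (2 * γ)) := by
      rw [Real.rpow_mul two_pos.le, Real.rpow_logb two_pos (by norm_num) hn0']
    rw [e1, e2]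
    exact Real.rpow_le_rpow_of_exponent_le (by norm_num) (by linarith)
  have h5 : (2 * (u : ℝ) + k) * 4 ^ u ≤ 1 / 2 * (n : ℝ) ^ (1 - 2 * γ) * (n : ℝ) ^ (2 * γ) :=
    mul_le_mul h3 h4 (by positivity) (by positivity)
  rw [mul_assoc, ← Real.rpow_add hn0', show 1 - 2 * γ + 2 * γ = 1 by ring, Real.rpow_one] at h5
  have h6 : (2 * (u : ℝ) + k) * 4 ^ u < n := by linarith
  exact_mod_cast h6

/-! ### Failure of all verifiers with short messages -/

namespace Diag

open Filter

variable {r q a t : ℕ → ℕ}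

/-- Short questions and answers do not separate the diagonal language from its complement. -/
theorem exists_close (hr : PolyBounded r) (ht : PolyBounded t) {γ : ℝ} (hγ : γ < 1 / 2)
    (hqa : ∃ᶠ n : ℕ in atTop, (q n : ℝ) + a n ≤ γ * Real.logb 2 n) (V : Verifier r q a t) {ε : ℝ}
    (hε : 0 < ε) : ∃ z ∈ lang, ∃ z' ∉ lang, (V.game z).val ≤ (V.game z').val + ε ∧
      ((V.game z).val = 1 → (V.game z').val = 1) ∧
      ((V.game z).syncVal = 1 → (V.game z').syncVal = 1) := by
  obtain ⟨k, hk⟩ := exists_pow_lt_of_lt_one hε (show (1 / 2 : ℝ) < 1 by norm_num)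
  obtain ⟨p₁, h₁⟩ := hr
  obtain ⟨p₂, h₂⟩ := ht
  obtain ⟨C, e₁, e₂, e₃, e₄, hC⟩ := V.exists_fits
  -- The term `2 * X` covers `n + q n + a n`, since short messages have `q n + a n ≤ n`.
  have hpoly := (Polynomial.C C * (2 * .X + p₁ + p₂ + 1)).eventually_eval_le_two_pow
  obtain ⟨n, hn, hlt, hp, h7⟩ := (hqa.and_eventually ((eventually_mul_four_pow_lt hγ (k + 1)).and
    (hpoly.and (eventually_ge_atTop 7)))).exists
  have hlt := hlt (q n + a n) (by exact_mod_cast hn)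
  have h4 : 1 ≤ 4 ^ (q n + a n) := Nat.one_le_pow _ _ (by norm_num)
  -- The precision is `s = 2 * q n + k + 1`: then `2 ^ s = 2 * 4 ^ q * 2 ^ k`, and the total error
  -- `4 ^ q / (2 ^ s - 1)` over all pairs of questions is at most `2 ^ (-k) < ε`.
  have hlt' : (2 * q n + (k + 1)) * 4 ^ (q n + a n) < n := by
    refine lt_of_le_of_lt (Nat.mul_le_mul_right _ ?_) hlt
    omega
  have hqan : q n + a n ≤ n := by nlinarith
  have hsn : 2 * q n + (k + 1) < n := by nlinarith
  obtain ⟨⟨b₁, b₂, b₃, b₄, br, bq, ba⟩, f₁, f₂⟩ := hC n (by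
    refine (Nat.mul_le_mul_left _
      (?_ : _ ≤ 2 * n + p₁.eval n + p₂.eval n + 1)).trans ((le_of_eq ?_).trans hp)
    · have := h₁ n
      have := h₂ n
      omega
    · simp)
  have hn2 : n < 2 ^ n := Nat.lt_two_pow_self
  obtain ⟨z, z', hz, hz', hzL, hzL', hsame⟩ :=
    exists_same_of_lt h7 b₁ b₂ b₃ b₄ br bq ba (hsn.trans hn2) hlt'
  have hsW : 2 ^ (2 * q n + (k + 1)) ≤ 2 ^ (2 ^ n * 2 ^ n) :=
    Nat.pow_le_pow_right (by norm_num) (by nlinarith)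
  obtain ⟨G, G', ⟨v₁, v₂⟩, ⟨v₁', v₂'⟩, hclose⟩ := V.close_of_same f₁ f₂ (by omega) (by omega)
    (by omega) (by omega) hsW (by omega) hz hz' hsame
  refine ⟨z, hzL, z', hzL', ?_, ?_, ?_⟩
  · rw [← v₁, ← v₁']
    have hpow : (2 : ℝ) ^ (2 * q n + (k + 1)) = 2 * (2 ^ q n * (2 ^ q n * 2 ^ k)) := by ring
    have hge : (1 : ℝ) ≤ 2 ^ q n * (2 ^ q n * 2 ^ k) := by
      exact one_le_mul_of_one_le_of_one_le (one_le_pow₀ one_le_two)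
        (one_le_mul_of_one_le_of_one_le (one_le_pow₀ one_le_two) (one_le_pow₀ one_le_two))
    have hδ : (0 : ℝ) ≤ 1 / (2 ^ (2 * q n + (k + 1)) - 1) := by
      rw [hpow]; exact div_nonneg zero_le_one (by linarith)
    refine (hclose.val_le hδ).trans (add_le_add_right (le_trans ?_ hk.le) _)
    rw [show Fintype.card (Bits (q n)) = 2 ^ q n by simp, hpow, ← mul_assoc, mul_one_div,
      one_div_pow, div_le_div_iff₀ (by linarith) (by positivity)]
    push_cast
    linarith
  · rw [← v₁, ← v₁']; exact hclose.val_eq_one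
  · rw [← v₂, ← v₂']; exact hclose.syncVal_eq_one

/-- Short messages at infinitely many lengths suffice, because a verifier fails as soon as it fails
at one of them. The negation of an `Ω(log n)` bound provides no more than that. -/
theorem lang_notMem (hr : PolyBounded r) (ht : PolyBounded t) {γ : ℝ} (hγ : γ < 1 / 2)
    (hqa : ∃ᶠ n : ℕ in atTop, (q n : ℝ) + a n ≤ γ * Real.logb 2 n) :
    (∀ c s : ℝ, s < c → lang ∉ MIPStar c s r q a t) ∧ lang ∉ MIPStarZero r q a t ∧
      lang ∉ MIPStarZeroSync r q a t := by
  refine ⟨?_, ?_, ?_⟩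
  · rintro c s hcs ⟨V, hV⟩
    obtain ⟨z, hz, z', hz', h, -, -⟩ :=
      exists_close hr ht hγ hqa V (show 0 < (c - s) / 2 by linarith)
    have h1 := (hV z).1 hz
    have h2 := (hV z').2 hz'
    linarith
  · rintro ⟨V, hV⟩
    obtain ⟨z, hz, z', hz', -, h, -⟩ := exists_close hr ht hγ hqa V one_pos
    exact ((hV z').2 hz').ne (h ((hV z).1 hz))
  · rintro ⟨V, hV⟩
    obtain ⟨z, hz, z', hz', -, -, h⟩ := exists_close hr ht hγ hqa V one_pos
    exact ((hV z').2 hz').ne (h ((hV z).1 hz))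

end Diag

theorem mainTheorem4 :
    (∀ r q a t : ℕ → ℕ, PolyBounded r → PolyBounded t →
      (∃ (n₀ : ℕ) (γ : ℝ), γ < 1 / 2 ∧
        ∀ n : ℕ, n₀ < n → ((q n : ℝ) + (a n : ℝ)) ≤ γ * Real.logb 2 (n : ℝ)) →
      (∀ c s : ℝ, s < c → ¬ EEXP ⊆ MIPStar c s r q a t) ∧
      ¬ EEXP ⊆ MIPStarZero r q a t ∧
      ¬ EEXP ⊆ MIPStarZeroSync r q a t) ∧
    (∀ q a : ℕ → ℕ,
      ((∃ c s : ℝ, s < c ∧ ∀ L ∈ RE, ∃ r t : ℕ → ℕ,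
          PolyBounded r ∧ PolyBounded t ∧ L ∈ MIPStar c s r q a t) ∨
        (∀ L ∈ RE, ∃ r t : ℕ → ℕ,
          PolyBounded r ∧ PolyBounded t ∧ L ∈ MIPStarZero r q a t) ∨
        (∀ L ∈ RE, ∃ r t : ℕ → ℕ,
          PolyBounded r ∧ PolyBounded t ∧ L ∈ MIPStarZeroSync r q a t)) →
      (fun n : ℕ => Real.log (n : ℝ)) =O[Filter.atTop]
        (fun n : ℕ => 2 * ((q n : ℝ) + (a n : ℝ)))) := by
  have hE : Diag.lang ∈ EEXP := expLang_mem_EEXP Diag.polyDec_inLang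
  have hR : Diag.lang ∈ RE := expLang_mem_RE Diag.polyDec_inLang
  refine ⟨?_, fun q a h => ?_⟩
  · rintro r q a t hr ht ⟨n₀, γ, hγ, h⟩
    have hqa : ∀ᶠ n : ℕ in Filter.atTop, (q n : ℝ) + a n ≤ γ * Real.logb 2 n :=
      (Filter.eventually_gt_atTop n₀).mono h
    obtain ⟨h1, h2, h3⟩ := Diag.lang_notMem hr ht hγ hqa.frequently
    exact ⟨fun c s hcs hsub => h1 c s hcs (hsub hE), fun hsub => h2 (hsub hE),
      fun hsub => h3 (hsub hE)⟩
  · by_contra hO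
    -- Any constant below `1 / 2` would do. If messages were eventually longer than `log₂ n / 4`,
    -- then `log n ≤ log₂ n < 4 * (q + a)`, which is twice the total communication. As `Diag.lang`
    -- is independent of all parameters, `r` and `t` may depend on the language.
    have hqa : ∃ᶠ n : ℕ in Filter.atTop, (q n : ℝ) + a n ≤ 1 / 4 * Real.logb 2 n := by
      intro hev
      refine hO (Asymptotics.IsBigO.of_bound 2 ?_)
      filter_upwards [hev] with n hn
      have h0 : 0 ≤ Real.log n := Real.log_natCast_nonneg n
      rw [Real.norm_of_nonneg h0, Real.norm_of_nonneg (by positivity)]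
      have h2 : Real.log n ≤ Real.logb 2 n := by
        rw [Real.logb, le_div_iff₀ (Real.log_pos one_lt_two)]
        have := Real.log_two_lt_d9
        nlinarith
      linarith [not_le.1 hn]
    have hγ : (1 / 4 : ℝ) < 1 / 2 := by norm_num
    rcases h with ⟨c, s, hcs, h⟩ | h | h
    · obtain ⟨r, t, hr, ht, hL⟩ := h _ hR
      exact (Diag.lang_notMem hr ht hγ hqa).1 c s hcs hL
    · obtain ⟨r, t, hr, ht, hL⟩ := h _ hR
      exact (Diag.lang_notMem hr ht hγ hqa).2.1 hL
    · obtain ⟨r, t, hr, ht, hL⟩ := h _ hR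
      exact (Diag.lang_notMem hr ht hγ hqa).2.2 hL
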